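/- Let $k$ be an algebraically closed field of characteristic $0$, let $G$ be a finite group with a faithful representation $G\to\mathrm{GL}(V^\vee)$, $\dim V=n+1$ (so that $G$ acts on $V$ from the right), and let $C\subseteq G$ be the subgroup of elements acting by scalars, so that $\bar G:=G/C$ acts faithfully on $\mathbb P(V)$. For a line $\ell\subset V$ let $\Gamma\subseteq G$ be its stabilizer, $\epsilon:\Gamma\to k^\times$ the character by which $\Gamma$ acts on $\ell$, and $V_{\Gamma,\epsilon}=\{v\in V: v\cdot g=\epsilon(g)v \text{ for all } g\in\Gamma\}$. Let $X=\mathbb P(V)_{\bar{\mathcal L}}$ be the De Concini--Procesi model, i.e. the closure of the image of the complement of all $\mathbb P(V_{\Gamma,\epsilon})$ with $\Gamma\neq C$ in $\mathbb P(V)\times\prod_{(\Gamma,\epsilon),\,\Gamma\ne C}\mathbb P(V/V_{\Gamma,\epsilon})$. For an irreducible closed subvariety $F\subseteq X$ the generic stabilizer $H$ is the subgroup of $\bar G$ fixing $F$ pointwise; $F$ is a maximal stratum if no strictly larger irreducible closed subvariety has the same generic stabilizer. To a maximal stratum $F$ one attaches the symbol $(H, Y\mathrel{\reflectbox{$\righttoleftarrow$}}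 k(F),\beta_F)$, where $Y$ is the stabilizer of $F$ in $\bar G$ modulo $H$, and $\beta_F$ is the collection of weights of $H$ in the normal bundle of $F$ at its generic point. The class $$[\mathbb P(V)\righttoleftarrow \bar G]=\sum_F (H,Y\mathrel{\reflectbox{$\righttoleftarrow$}} k(F),\beta_F)\in \mathrm{Burn}_n(\bar G)$$ is the sum over representatives $F$ of the $\bar G$-orbits of maximal strata of $X$. Here $\mathrm{Burn}_n(\bar G)$ is the equivariant Burnside group: the abelian group generated by symbols $(H,Y\mathrel{\reflectbox{$\righttoleftarrow$}} K,\beta)$ ($H\subseteq\bar G$ abelian, $Y\subseteq Z_{\bar G}(H)/H$ acting faithfully on a finitely generated field $K/k$ of transcendence degree $d\le n$, $\beta$ a sequence of $n-d$ nontrivial characters generating $H^\vee$), modulo the reordering, conjugation, vanishing and blowup relations. Then there are only finitely many maximal strata, each of them defines a symbol in this sense, and every such symbol $(H,Y\mathrel{\reflectbox{$\righttoleftarrow$}} k(F),\beta_F)$ has the following shape: $F$ is $Y$-equivariantly birational to a product of projective spaces $\prod_j\mathbb P(W_j)$, on which $Y$ acts without permuting the factors and by projectively linear transformations on each factor $\mathbb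 P(W_j)$. Moreover, apart from the distinguished summand $(1,\bar G\mathrel{\reflectbox{$\righttoleftarrow$}} k(\mathbb P(V)),())$ given by the generic point, the class lies in $\mathrm{Burn}_n^{\mathrm{rc},\mathrm{H1}=0}(\bar G)$: $$[\mathbb P(V)\righttoleftarrow \bar G]-(1,\bar G\mathrel{\reflectbox{$\righttoleftarrow$}} k(\mathbb P(V)),())\in \mathrm{Burn}_n^{\mathrm{rc},\mathrm{H1}=0}(\bar G),$$ where the right side is the subgroup generated by the symbols $(H,Y\mathrel{\reflectbox{$\righttoleftarrow$}} k(F),\beta)$ with $H\ne 1$ and $F$ a smooth projective rationally connected variety with a regular action of $Y$ such that $\mathrm H^1(Y',\mathrm{Pic}(F))=0$ for all subgroups $Y'\subseteq Y$. -/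

import Mathlib

universe u v

noncomputable section

namespace Burnside

/-! ### Symbols, the symbols group and the equivariant Burnside group -/

/-- A symbol `(H, Y ⟲ K, β)` of dimension `n` for the group `G` over `k`.
The subgroup `Y ⊆ Z_G(H)/H` is recorded through its preimage `Z` in `G` (so `H ≤ Z ≤ Z_G(H)` and
`Y = Z/H`), and the faithful action of `Y` on the field `K` through a homomorphism
`Z → Aut(K/k)` with kernel `H`.  The characters `β = (b₁, …, b_{n-d})` form a multiset, i.e. a
sequence up to reordering, which is the reordering relation. The group of characters of `H` is
written multiplicatively. -/
structure Symb (k : Type u) [Field k] (G : Type v) [Group G] (n : ℕ) where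
  H : Subgroup G
  H_comm : ∀ a ∈ H, ∀ b ∈ H, a * b = b * a
  Z : Subgroup G
  H_le_Z : H ≤ Z
  Z_le : Z ≤ Subgroup.centralizer (H : Set G)
  K : Type u
  [field : Field K]
  [algebra : Algebra k K]
  fg : (⊤ : IntermediateField k K).FG
  act : Z →* (K ≃ₐ[k] K)
  act_eq_one : ∀ z : Z, act z = 1 ↔ (z : G) ∈ H
  β : Multiset (H →* kˣ)
  one_notMem : (1 : H →* kˣ) ∉ β
  generate : Subgroup.closure {b : H →* kˣ | b ∈ β} = ⊤
  dim : Algebra.trdeg k K + (Multiset.card β : Cardinal) = (n : Cardinal)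

attribute [instance] Symb.field Symb.algebra

namespace Symb

variable {k : Type u} [Field k] {G : Type v} [Group G] {n : ℕ}

/-- The conjugation relation **(C)** (for `g = 1` it identifies symbols with isomorphic fields). -/
def Conj (s s' : Symb k G n) : Prop :=
  ∃ (g : G) (cH : s'.H ≃* s.H) (cZ : s'.Z ≃* s.Z) (e : s.K ≃ₐ[k] s'.K),
    (∀ h, (cH h : G) = g⁻¹ * h * g) ∧ (∀ z, (cZ z : G) = g⁻¹ * z * g) ∧
    (∀ z x, e (s.act (cZ z) x) = s'.act z (e x)) ∧
    s'.β = s.β.map (fun b => b.comp cH.toMonoidHom)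

/-- The symbol with the same `H`, `Y ⟲ K` and with other characters. -/
def withChars (s : Symb k G n) (β' : Multiset (s.H →* kˣ)) (h₁ : (1 : s.H →* kˣ) ∉ β')
    (h₂ : Subgroup.closure {b : s.H →* kˣ | b ∈ β'} = ⊤)
    (h₃ : Multiset.card β' = Multiset.card s.β) : Symb k G n :=
  { s with
    β := β'
    one_notMem := h₁
    generate := h₂
    dim := by rw [h₃]; exact s.dim }

/-- The symbol `(H, Y ⟲ K, β₁)` with `β₁ = (b₁ - b₂, b₂, b₃, …)`, for `β = (b₁, b₂, b₃, …)` and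
`b₁ ≠ b₂`. -/
def sub (s : Symb k G n) (b₁ b₂ : s.H →* kˣ) (γ : Multiset (s.H →* kˣ))
    (hβ : s.β = b₁ ::ₘ b₂ ::ₘ γ) (hne : b₁ ≠ b₂) : Symb k G n :=
  s.withChars ((b₁ / b₂) ::ₘ b₂ ::ₘ γ)
    (by
      have h := s.one_notMem
      rw [hβ] at h
      simp only [Multiset.mem_cons, not_or] at h ⊢
      exact ⟨fun h' => hne (div_eq_one.mp h'.symm), h.2⟩)
    (by
      rw [eq_top_iff, ← s.generate, Subgroup.closure_le]
      intro b hb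
      have hb' : b ∈ b₁ ::ₘ b₂ ::ₘ γ := hβ ▸ hb
      have key : ∀ c ∈ (b₁ / b₂) ::ₘ b₂ ::ₘ γ,
          c ∈ Subgroup.closure {b : s.H →* kˣ | b ∈ (b₁ / b₂) ::ₘ b₂ ::ₘ γ} :=
        fun c hc => Subgroup.subset_closure hc
      rcases Multiset.mem_cons.mp hb' with rfl | hb'
      · have := mul_mem (key (b / b₂) (by simp)) (key b₂ (by simp))
        have e : b / b₂ * b₂ = b := by ext; simp
        rwa [e] at this
      · exact key b (Multiset.mem_cons_of_mem hb'))
    (by rw [hβ]; simp)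

open scoped Classical in
/-- The term `Θ₁` of the blowup relation. -/
def theta₁ (s : Symb k G n) (b₁ b₂ : s.H →* kˣ) (γ : Multiset (s.H →* kˣ))
    (hβ : s.β = b₁ ::ₘ b₂ ::ₘ γ) : FreeAbelianGroup (Symb k G n) :=
  if hne : b₁ = b₂ then 0
  else FreeAbelianGroup.of (s.sub b₁ b₂ γ hβ hne) +
    FreeAbelianGroup.of (s.sub b₂ b₁ γ (hβ.trans (Multiset.cons_swap _ _ _)) (Ne.symm hne))

/-- `s'` is the symbol `(H', Y' ⟲ K(x), β')`, where `H' = Ker(b₁ - b₂)`, `Y'` is the preimage of `Y`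
(so that `Y` and `Y'` have the same preimage in `G`), `β' = (b₂, b₃, …)` restricted to `H'`, and the
action on `K(x)` is given by the action construction: `Y'` acts on `K` through `Y`, and
`z · x = a(z) x` for a 1-cocycle `a` of the preimage of `Y` in `G` with values in `Kˣ` whose
restriction to `H` is the character `b₁ - b₂` (by Hilbert's Theorem 90 such a cocycle is unique up
to coboundaries). -/
def IsActionConstruction (s : Symb k G n) (b₁ b₂ : s.H →* kˣ) (γ : Multiset (s.H →* kˣ))
    (s' : Symb k G n) : Prop :=
  ∃ (a : s.Z → s.Kˣ) (j : s'.H →* s.H) (cZ : s'.Z ≃* s.Z) (e : RatFunc s.K ≃ₐ[k] s'.K),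
    (∀ z w, (a (z * w) : s.K) = s.act z (a w : s.K) * a z) ∧
    (∀ (h : s.H), (a ⟨h, s.H_le_Z h.2⟩ : s.K) = algebraMap k s.K ((b₁ / b₂) h : kˣ)) ∧
    (∀ g : G, g ∈ s'.H ↔ ∃ h : s.H, (h : G) = g ∧ b₁ h = b₂ h) ∧
    (∀ h, (j h : G) = h) ∧
    (∀ z, (cZ z : G) = z) ∧
    (∀ z y, s'.act z (e (RatFunc.C y)) = e (RatFunc.C (s.act (cZ z) y))) ∧
    (∀ z, s'.act z (e RatFunc.X) = e (RatFunc.C (a (cZ z) : s.K) * RatFunc.X)) ∧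
    s'.β = (b₂ ::ₘ γ).map (fun b => b.comp j)

/-- `T` is the term `Θ₂` of the blowup relation. -/
def IsTheta₂ (s : Symb k G n) (b₁ b₂ : s.H →* kˣ) (γ : Multiset (s.H →* kˣ))
    (T : FreeAbelianGroup (Symb k G n)) : Prop :=
  ((∃ b ∈ s.β, b ∈ Subgroup.zpowers (b₁ / b₂)) ∧ T = 0) ∨
  ((∀ b ∈ s.β, b ∉ Subgroup.zpowers (b₁ / b₂)) ∧
    ∃ s', s.IsActionConstruction b₁ b₂ γ s' ∧ T = FreeAbelianGroup.of s')

/-- The relators: conjugation **(C)**, vanishing **(V)** and blowup **(B)**. -/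
inductive Relator : FreeAbelianGroup (Symb k G n) → Prop
  | conj (s s' : Symb k G n) (h : s.Conj s') :
      Relator (FreeAbelianGroup.of s - FreeAbelianGroup.of s')
  | vanish (s : Symb k G n) (b₁ b₂ : s.H →* kˣ) (γ : Multiset (s.H →* kˣ))
      (hβ : s.β = b₁ ::ₘ b₂ ::ₘ γ) (h : b₁ * b₂ = 1) : Relator (FreeAbelianGroup.of s)
  | blowup (s : Symb k G n) (b₁ b₂ : s.H →* kˣ) (γ : Multiset (s.H →* kˣ))
      (hβ : s.β = b₁ ::ₘ b₂ ::ₘ γ) (T : FreeAbelianGroup (Symb k G n))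
      (hT : s.IsTheta₂ b₁ b₂ γ T) :
      Relator (FreeAbelianGroup.of s - (s.theta₁ b₁ b₂ γ hβ + T))

end Symb

/-- The equivariant Burnside group `Burn_n(G)`. -/
abbrev Burn (k : Type u) [Field k] (G : Type v) [Group G] (n : ℕ) : Type (max (u + 1) v) :=
  FreeAbelianGroup (Symb k G n) ⧸
    AddSubgroup.closure {r : FreeAbelianGroup (Symb k G n) | Symb.Relator r}

/-- The class of a symbol in `Burn_n(G)`. -/
def Symb.cls {k : Type u} [Field k] {G : Type v} [Group G] {n : ℕ} (s : Symb k G n) :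
    Burn k G n :=
  QuotientAddGroup.mk (FreeAbelianGroup.of s)

/-! ### Projective models of a function field -/

section Models

variable {k : Type u} [Field k] {K : Type u} [Field K] [Algebra k K]

/-- The local ring `A_p ⊆ K` of a `k`-subalgebra `A` of `K` at a prime ideal `p`. -/
def localRingAt (A : Subalgebra k K) (p : Ideal A) [hp : p.IsPrime] : Subalgebra k K where
  carrier := {x | ∃ a b : A, b ∉ p ∧ x * b = a}
  mul_mem' := by
    rintro x y ⟨a, b, hb, h⟩ ⟨c, d, hd, h'⟩
    refine ⟨a * c, b * d, fun hbd => (hp.mem_or_mem hbd).elim hb hd, ?_⟩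
    push_cast
    rw [← h, ← h']
    ring
  add_mem' := by
    rintro x y ⟨a, b, hb, h⟩ ⟨c, d, hd, h'⟩
    refine ⟨a * d + c * b, b * d, fun hbd => (hp.mem_or_mem hbd).elim hb hd, ?_⟩
    push_cast
    rw [← h, ← h']
    ring
  algebraMap_mem' := fun r =>
    ⟨algebraMap k A r, 1, fun h => hp.ne_top ((Ideal.eq_top_iff_one p).mpr h), by simp⟩

/-- The affine chart `k[t / sᵢ : i, t ∈ Sᵢ] ⊆ K`. -/
def chart {ι : Type*} (S : ι → Submodule k K) (s : ι → K) : Subalgebra k K :=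
  Algebra.adjoin k {y | ∃ i, ∃ t ∈ S i, y = t / s i}

/-- Let `Sᵢ` be linear subspaces of `K`. They define rational maps to the projective spaces of
`Sᵢ^∨`, and the closure `X` of the image of the generic point in their product is covered by the
affine charts with coordinate rings `chart S s`, where `0 ≠ sᵢ ∈ Sᵢ`. The projective variety `X` is
given in the manner of Zariski, as the set of the local rings in `K` of all its (scheme-theoretic)
points; the local ring of the generic point is the function field of `X`, and inclusion of local
rings is generization. -/
def projModel {ι : Type*} (S : ι → Submodule k K) : Set (Subalgebra k K) :=
  {O | ∃ s : ι → K, (∀ i, s i ∈ S i ∧ s i ≠ 0) ∧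
    ∃ (p : Ideal (chart S s)) (_ : p.IsPrime), O = localRingAt (chart S s) p}

/-- `M` is (the set of local rings of) a projective variety with function field `K`. -/
def IsProjectiveModel (M : Set (Subalgebra k K)) : Prop :=
  ∃ (m : ℕ) (S : Fin m → Submodule k K),
    (∀ i, S i ≠ ⊥ ∧ FiniteDimensional k (S i)) ∧
    IntermediateField.adjoin k {y | ∃ i, ∃ t ∈ S i, ∃ s ∈ S i, y = t / s} = ⊤ ∧
    M = projModel S

/-- `M` is smooth over `k`. -/
def IsSmoothModel (M : Set (Subalgebra k K)) : Prop :=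
  ∀ O ∈ M, Algebra.FormallySmooth k O

/-- The group `Y` of automorphisms of `K/k` acts regularly on `M`. -/
def ActsOn (Y : Subgroup (K ≃ₐ[k] K)) (M : Set (Subalgebra k K)) : Prop :=
  ∀ y ∈ Y, ∀ O ∈ M, O.map (y : K →ₐ[k] K) ∈ M

/-! ### The Picard group and its first cohomology -/

/-- The prime divisors on a smooth model: the points whose local ring is a discrete valuation
ring. -/
def PrimeDivisor (M : Set (Subalgebra k K)) : Type u :=
  {O : Subalgebra k K // O ∈ M ∧ IsDiscreteValuationRing O}

/-- `D` is the divisor of the rational function `f`. -/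
def IsDivisorOf (M : Set (Subalgebra k K)) (f : Kˣ) (D : PrimeDivisor M →₀ ℤ) : Prop :=
  ∀ (P : PrimeDivisor M) (ϖ : P.1), Irreducible ϖ →
    ∃ u : P.1ˣ, (f : K) = ((u : P.1) : K) * (ϖ : K) ^ (D P)

/-- The principal divisors. -/
def principal (M : Set (Subalgebra k K)) : Submodule ℤ (PrimeDivisor M →₀ ℤ) where
  carrier := {D | ∃ f : Kˣ, IsDivisorOf M f D}
  zero_mem' := ⟨1, fun _ _ _ => ⟨1, by simp⟩⟩
  add_mem' := by
    rintro D D' ⟨f, hf⟩ ⟨f', hf'⟩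
    refine ⟨f * f', fun P ϖ hϖ => ?_⟩
    obtain ⟨u, hu⟩ := hf P ϖ hϖ
    obtain ⟨u', hu'⟩ := hf' P ϖ hϖ
    have h0 : (ϖ : K) ≠ 0 := fun h => hϖ.ne_zero (Subtype.ext h)
    refine ⟨u * u', ?_⟩
    rw [Finsupp.add_apply, zpow_add₀ h0, Units.val_mul, hu, hu', Units.val_mul]
    push_cast
    ring
  smul_mem' := by
    rintro c D ⟨f, hf⟩
    refine ⟨f ^ c, fun P ϖ hϖ => ?_⟩
    obtain ⟨u, hu⟩ := hf P ϖ hϖ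
    have hval : (((u ^ c : P.1ˣ) : P.1) : K) = ((u : P.1) : K) ^ c := by
      have := congrArg Units.val (map_zpow (Units.map (P.1.val : P.1 →* K)) u c)
      rw [Units.val_zpow_eq_zpow_val] at this
      exact this
    refine ⟨u ^ c, ?_⟩
    rw [Finsupp.smul_apply, smul_eq_mul, hval, Units.val_zpow_eq_zpow_val, hu, mul_zpow,
      ← zpow_mul, mul_comm c]

/-- The Picard group of a smooth model, as the group of divisors modulo linear equivalence. -/
abbrev Pic (M : Set (Subalgebra k K)) : Type u :=
  (PrimeDivisor M →₀ ℤ) ⧸ principal M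

/-- The translate of a prime divisor by an automorphism of `K/k` that acts regularly. -/
def PrimeDivisor.move {M : Set (Subalgebra k K)} (y : K ≃ₐ[k] K)
    (hy : ∀ O ∈ M, O.map (y : K →ₐ[k] K) ∈ M) (P : PrimeDivisor M) : PrimeDivisor M :=
  ⟨P.1.map (y : K →ₐ[k] K), hy P.1 P.2.1, by
    have := P.2.2
    exact IsDiscreteValuationRing.RingEquivClass.isDiscreteValuationRing
      (P.1.equivMapOfInjective (y : K →ₐ[k] K) y.injective)⟩

theorem PrimeDivisor.move_injective {M : Set (Subalgebra k K)} (y : K ≃ₐ[k] K)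
    (hy : ∀ O ∈ M, O.map (y : K →ₐ[k] K) ∈ M) :
    Function.Injective (PrimeDivisor.move y hy) := by
  intro P Q h
  have h' : P.1.map (y : K →ₐ[k] K) = Q.1.map (y : K →ₐ[k] K) := congrArg Subtype.val h
  exact Subtype.ext (Subalgebra.map_injective y.injective h')

theorem principal_le_comap {M : Set (Subalgebra k K)} {Y : Subgroup (K ≃ₐ[k] K)}
    (hY : ActsOn Y M) (y : Y) :
    principal M ≤ (principal M).comap
      (Finsupp.lmapDomain ℤ ℤ (PrimeDivisor.move y.1 (hY y.1 y.2))) := by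
  rintro D ⟨f, hf⟩
  refine ⟨Units.map (y.1 : K →* K) f, fun P ϖ hϖ => ?_⟩
  obtain ⟨Q, rfl⟩ : ∃ Q, PrimeDivisor.move y.1 (hY y.1 y.2) Q = P := by
    refine ⟨PrimeDivisor.move y.1⁻¹ (hY _ (inv_mem y.2)) P, Subtype.ext ?_⟩
    ext x
    simp [PrimeDivisor.move]
  let e := Q.1.equivMapOfInjective (y.1 : K →ₐ[k] K) y.1.injective
  have he : ∀ x : Q.1, ((e x : Q.1.map (y.1 : K →ₐ[k] K)) : K) = y.1 x := fun x => rfl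
  obtain ⟨ϖ', rfl⟩ := e.surjective ϖ
  obtain ⟨u, hu⟩ := hf Q ϖ' ((MulEquiv.irreducible_iff e).mp hϖ)
  refine ⟨Units.map (e.toMulEquiv.toMonoidHom : Q.1 →* _) u, ?_⟩
  have h1 : (Finsupp.lmapDomain ℤ ℤ (PrimeDivisor.move y.1 (hY y.1 y.2)) D)
      (PrimeDivisor.move y.1 (hY y.1 y.2) Q) = D Q := by
    rw [Finsupp.lmapDomain_apply, Finsupp.mapDomain_apply (PrimeDivisor.move_injective _ _)]
  rw [h1]
  change y.1 (f : K) = y.1 ((u : Q.1) : K) * (y.1 (ϖ' : K)) ^ (D Q)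
  rw [hu, map_mul, map_zpow₀]

/-- The representation of `Y` on the Picard group. -/
def picRep {M : Set (Subalgebra k K)} {Y : Subgroup (K ≃ₐ[k] K)} (hY : ActsOn Y M) :
    Representation ℤ Y (Pic M) where
  toFun y := (principal M).mapQ (principal M)
    (Finsupp.lmapDomain ℤ ℤ (PrimeDivisor.move y.1 (hY y.1 y.2))) (principal_le_comap hY y)
  map_one' := by
    have h : PrimeDivisor.move (M := M) (1 : Y).1 (hY _ (1 : Y).2) = id := by
      funext P
      refine Subtype.ext ?_
      ext x
      simp [PrimeDivisor.move]
    ext x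
    have hx := congrFun h x
    simp only [OneMemClass.coe_one, id_eq] at hx
    simp [hx]
  map_mul' y z := by
    have h : PrimeDivisor.move (M := M) (y * z).1 (hY _ (y * z).2) =
        PrimeDivisor.move y.1 (hY y.1 y.2) ∘ PrimeDivisor.move z.1 (hY z.1 z.2) := by
      funext P
      refine Subtype.ext ?_
      ext x
      simp [PrimeDivisor.move]
    ext x
    have hx := congrFun h x
    simp only [Subgroup.coe_mul, Function.comp_apply] at hx
    simp [hx]

/-- The vanishing of `H¹(Y, A)`: every 1-cocycle is a coboundary. -/
def H1Vanishes {Y A : Type*} [Group Y] [AddCommGroup A] (ρ : Representation ℤ Y A) : Prop :=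
  ∀ f : Y → A, (∀ g h, f (g * h) = ρ g (f h) + f g) → ∃ a : A, ∀ g, f g = ρ g a - a

/-- The field `K` with the action of the group `Y` is `H¹`-trivial: it has a smooth projective
model `M` with a regular action of `Y` such that `H¹(Y', Pic(M)) = 0` for all subgroups `Y'` of
`Y`. -/
def IsH1Trivial (Y : Subgroup (K ≃ₐ[k] K)) : Prop :=
  ∃ (M : Set (Subalgebra k K)) (hY : ActsOn Y M), IsProjectiveModel M ∧ IsSmoothModel M ∧
    ∀ (Y' : Subgroup (K ≃ₐ[k] K)) (h : Y' ≤ Y),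
      H1Vanishes (picRep (M := M) (Y := Y') fun y hy => hY y (h hy))

end Models

/-- `K` is the function field of a rationally connected variety `F`: there are a variety `T` with
function field `L` and a rational map `T × ℙ¹ ⇢ F` (given by a homomorphism `φ : K → L(x)`, in
which one may substitute for `x` two independent variables `p`, `q`) such that the map
`T × ℙ¹ × ℙ¹ ⇢ F × F`, which joins the values at the two points `p` and `q`, is dominant. -/
def IsRationallyConnected (k : Type u) [Field k] (K : Type u) [Field K] [Algebra k K] : Prop :=
  ∃ (L : Type u) (_ : Field L) (_ : Algebra k L) (N : Type u) (_ : Field N) (_ : Algebra k N)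
    (_ : Algebra L N) (_ : IsScalarTower k L N)
    (φ : K →ₐ[k] RatFunc L) (σ τ : RatFunc L →ₐ[L] N),
    (⊤ : IntermediateField k L).FG ∧
    AlgebraicIndependent L ![σ RatFunc.X, τ RatFunc.X] ∧
    Function.Injective (Algebra.TensorProduct.productMap
      ((σ.restrictScalars k).comp φ) ((τ.restrictScalars k).comp φ))

/-- The subgroup of `Burn_n(G)` generated by the symbols with `H ≠ 1` whose field is the function
field of a rationally connected, `H¹`-trivial variety. -/
def burnRcH1 (k : Type u) [Field k] (G : Type v) [Group G] (n : ℕ) : AddSubgroup (Burn k G n) :=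
  AddSubgroup.closure {c | ∃ s : Symb k G n, s.H ≠ ⊥ ∧ IsRationallyConnected k s.K ∧
    IsH1Trivial s.act.range ∧ c = s.cls}

/-! ### Strata and the class of an action -/

section Strata

variable {k : Type u} [Field k] {K : Type u} [Field K] [Algebra k K] {Q : Type v} [Group Q]

/-- Let `Q` act on `K`. The generic stabilizer (inertia group) of the closure of the point with local
ring `O`: the elements of `Q` which preserve `O` and act trivially on its residue field. -/
def inertia (φ : Q →* (K ≃ₐ[k] K)) (O : Subalgebra k K) : Set Q :=
  {q | O.map (φ q : K →ₐ[k] K) = O ∧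
    ∀ x y : O, (y : K) = φ q x → y - x ∈ nonunits O}

/-- The (generic points of the) maximal strata: the points of `M` such that no proper generization
has the same generic stabilizer. -/
def strata (φ : Q →* (K ≃ₐ[k] K)) (M : Set (Subalgebra k K)) : Set (Subalgebra k K) :=
  {O | O ∈ M ∧ ∀ O' ∈ M, O < O' → inertia φ O' ≠ inertia φ O}

/-- `s` is the symbol `(H, Y ⟲ k(F), β_F)` of the stratum `F` whose generic point has the local ring
`O`: here `H` is the generic stabilizer of `F`, the preimage of `Y` in `Q` is the stabilizer of `F`,
`k(F)` is the residue field of `O`, and `β_F` consists of the weights of `H` in the normal bundle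
of `F` at the generic point, i.e. in `𝔪/𝔪²`, where `𝔪` is the maximal ideal of `O`
(a right action in the normal bundle and the left action on functions have the same weights). -/
def IsSymbolOf {n : ℕ} (φ : Q →* (K ≃ₐ[k] K)) (O : Subalgebra k K) (s : Symb k Q n) : Prop :=
  (s.H : Set Q) = inertia φ O ∧
  (∀ q, q ∈ s.Z ↔ O.map (φ q : K →ₐ[k] K) = O) ∧
  ∃ π : O →ₐ[k] s.K, Function.Surjective π ∧
    (∀ (z : s.Z) (x y : O), (y : K) = φ z x → π y = s.act z (π x)) ∧
    ∃ (r : ℕ) (e : Fin r → O) (b : Fin r → (s.H →* kˣ)),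
      Ideal.span (Set.range e) ⊔ RingHom.ker π ^ 2 = RingHom.ker π ∧
      (∀ c : Fin r → O, ∑ i, c i * e i ∈ RingHom.ker π ^ 2 → ∀ i, c i ∈ RingHom.ker π) ∧
      (∀ (h : s.H) (i : Fin r) (y : O), (y : K) = φ h (e i) →
        y - algebraMap k O (b i h : kˣ) * e i ∈ RingHom.ker π ^ 2) ∧
      s.β = Finset.univ.val.map b

open scoped Classical in
/-- The class in `Burn_n(Q)` of the symbol of the stratum with local ring `O`. -/
def strataClass (n : ℕ) (φ : Q →* (K ≃ₐ[k] K)) (O : Subalgebra k K) : Burn k Q n :=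
  if h : ∃ s : Symb k Q n, IsSymbolOf φ O s then h.choose.cls else 0

/-- Two strata are equivalent if they are in the same orbit. -/
def orbitSetoid (φ : Q →* (K ≃ₐ[k] K)) (M : Set (Subalgebra k K)) : Setoid (strata φ M) where
  r O O' := ∃ q, O'.1 = O.1.map (φ q : K →ₐ[k] K)
  iseqv :=
    { refl := fun O => ⟨1, by ext x; simp⟩
      symm := by
        rintro O O' ⟨q, h⟩
        refine ⟨q⁻¹, ?_⟩
        rw [h]
        ext x
        simp
      trans := by
        rintro O O' O'' ⟨q, h⟩ ⟨q', h'⟩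
        refine ⟨q' * q, ?_⟩
        rw [h', h]
        ext x
        simp }

/-- The class `∑_H ∑_F (H, Y ⟲ k(F), β_F)` computed on the model `M`: the sum of the symbols of one
representative of each orbit of maximal strata. -/
def burnClass (n : ℕ) (φ : Q →* (K ≃ₐ[k] K)) (M : Set (Subalgebra k K)) : Burn k Q n :=
  ∑ᶠ o : Quotient (orbitSetoid φ M), strataClass n φ o.out.1

end Strata

/-! ### Products of projective spaces -/

section Proj

variable {k : Type u} [Field k] {σ : Type} [Fintype σ]

/-- The field of fractions of the polynomial ring in the variables `x_a`, `a ∈ σ`. -/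
abbrev RatField (k : Type u) [Field k] (σ : Type) : Type u := FractionRing (MvPolynomial σ k)

/-- The variable `x_a`. -/
def coord (k : Type u) [Field k] {σ : Type} (a : σ) : RatField k σ :=
  algebraMap (MvPolynomial σ k) _ (MvPolynomial.X a)

/-- The linear form with given coefficients. -/
def linForm : (σ → k) →ₗ[k] RatField k σ :=
  Fintype.linearCombination k (coord k)

/-- The linear substitution `x_j ↦ ∑ᵢ A i j xᵢ`. -/
def linSubst (A : Matrix σ σ k) : MvPolynomial σ k →ₐ[k] MvPolynomial σ k :=
  MvPolynomial.aeval fun j => ∑ i, MvPolynomial.C (A i j) * MvPolynomial.X i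

theorem linSubst_mul (A B : Matrix σ σ k) :
    linSubst (A * B) = (linSubst A).comp (linSubst B) := by
  ext j : 1
  simp only [linSubst, MvPolynomial.aeval_X, AlgHom.comp_apply, map_sum, map_mul,
    MvPolynomial.algHom_C, MvPolynomial.algebraMap_eq, Matrix.mul_apply, Finset.sum_mul,
    Finset.mul_sum]
  rw [Finset.sum_comm]
  refine Finset.sum_congr rfl fun i _ => Finset.sum_congr rfl fun l _ => ?_
  ring

theorem linSubst_one [DecidableEq σ] : linSubst (1 : Matrix σ σ k) = AlgHom.id k _ := by
  ext j : 1
  simp [linSubst, Matrix.one_apply]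

/-- The action of the general linear group on polynomials by linear substitutions. -/
def linEquiv [DecidableEq σ] : GL σ k →* (MvPolynomial σ k ≃ₐ[k] MvPolynomial σ k) where
  toFun A := AlgEquiv.ofAlgHom (linSubst A.1) (linSubst A⁻¹.1)
    (by rw [← linSubst_mul, ← Units.val_mul, mul_inv_cancel, Units.val_one, linSubst_one])
    (by rw [← linSubst_mul, ← Units.val_mul, inv_mul_cancel, Units.val_one, linSubst_one])
  map_one' := by
    ext x : 1
    exact DFunLike.congr_fun linSubst_one x
  map_mul' A B := by
    ext x : 1
    exact DFunLike.congr_fun (linSubst_mul A.1 B.1) x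

/-- The action of the general linear group on rational functions by linear substitutions. -/
def linAut [DecidableEq σ] : GL σ k →* (RatField k σ ≃ₐ[k] RatField k σ) :=
  (IsFractionRing.fieldEquivOfAlgEquivHom k (RatField k σ)).comp linEquiv

theorem linAut_coord [DecidableEq σ] (A : GL σ k) (j : σ) :
    linAut A (coord k j) = ∑ i, A.1 i j • coord k i := by
  have h : linAut A (coord k j) =
      algebraMap (MvPolynomial σ k) (RatField k σ) (linSubst A.1 (MvPolynomial.X j)) :=
    IsFractionRing.fieldEquivOfAlgEquiv_algebraMap k (RatField k σ) (RatField k σ) (linEquiv A) _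
  rw [h]
  simp only [linSubst, MvPolynomial.aeval_X, map_sum, map_mul, Algebra.smul_def, coord]
  rfl

/-- Let the set `σ` be divided into blocks by the map `blk`. This is the function field of the
product of the projective spaces with homogeneous coordinates `x_a`, `blk a = j`, i.e. the field
generated by the quotients of homogeneous coordinates on the same factor. -/
def projField (k : Type u) [Field k] {σ ι : Type} (blk : σ → ι) :
    IntermediateField k (RatField k σ) :=
  IntermediateField.adjoin k {y | ∃ a b, blk a = blk b ∧ y = coord k a / coord k b}

/-- Let `Y` act on `K`. The field `K` is `Y`-equivariantly isomorphic to the function field of a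
product of projective spaces `ℙ(W_j)` on which every element of `Y` acts by an element of
`∏ PGL(W_j)`, i.e. through a tuple of invertible linear maps of the `W_j` (a block diagonal
matrix), and in particular without permuting the factors. -/
def IsProductOfProjLinear {K : Type u} [Field K] [Algebra k K] {Z : Type v} [Group Z]
    (act : Z →* (K ≃ₐ[k] K)) : Prop :=
  ∃ (m : ℕ) (d : Fin m → ℕ)
    (e : K ≃ₐ[k] projField k (Sigma.fst : (Σ j : Fin m, Fin (d j + 1)) → Fin m)),
    ∀ z : Z, ∃ A : GL (Σ j : Fin m, Fin (d j + 1)) k,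
      (∀ a b, a.1 ≠ b.1 → A.1 a b = 0) ∧
      ∀ y : K, ((e (act z y)) : RatField k _) = linAut A (e y)

end Proj

/-! ### Linear actions on projective space and the De Concini--Procesi model -/

section LinearAction

variable {k : Type u} [Field k] {n : ℕ} {G : Type v} [Group G]

/-- The function field of `ℙ(V)`, where `V = k^{n+1}`. -/
abbrev PField (k : Type u) [Field k] (n : ℕ) : IntermediateField k (RatField k (Fin (n + 1))) :=
  projField k (fun _ : Fin (n + 1) => ())

theorem linAut_mem (A : GL (Fin (n + 1)) k) {x : RatField k (Fin (n + 1))} (hx : x ∈ PField k n) :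
    linAut A x ∈ PField k n := by
  have hle : (PField k n).map (linAut A : _ →ₐ[k] RatField k (Fin (n + 1))) ≤ PField k n := by
    rw [PField, projField, IntermediateField.adjoin_map, IntermediateField.adjoin_le_iff]
    rintro _ ⟨_, ⟨a, b, -, rfl⟩, rfl⟩
    have hne : coord k b ≠ 0 := by
      rw [coord, Ne, FaithfulSMul.algebraMap_eq_zero_iff]
      exact MvPolynomial.X_ne_zero b
    have key : ∀ c, linAut A (coord k c) / coord k b ∈ PField k n := by
      intro c
      rw [linAut_coord, Finset.sum_div]
      refine sum_mem fun i _ => ?_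
      rw [smul_div_assoc]
      have hi : coord k i / coord k b ∈ PField k n :=
        IntermediateField.subset_adjoin k
          {y | ∃ a b, (fun _ : Fin (n + 1) => ()) a = (fun _ => ()) b ∧ y = coord k a / coord k b}
          ⟨i, b, rfl, rfl⟩
      exact IntermediateField.smul_mem _ hi
    have h := div_mem (key a) (key b)
    rw [div_div_div_cancel_right₀ hne] at h
    rw [← map_div₀] at h
    exact h
  exact hle ⟨x, hx, rfl⟩

/-- The action of the general linear group on `k(ℙ(V))`. -/
def projAut : GL (Fin (n + 1)) k →* (PField k n ≃ₐ[k] PField k n) where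
  toFun A := AlgEquiv.ofAlgHom
    (((linAut A).toAlgHom.comp (PField k n).val).codRestrict
      (PField k n).toSubalgebra fun x => linAut_mem A x.2)
    (((linAut A⁻¹).toAlgHom.comp (PField k n).val).codRestrict
      (PField k n).toSubalgebra fun x => linAut_mem A⁻¹ x.2)
    (by
      ext x
      change linAut A (linAut A⁻¹ x.1) = x.1
      rw [← AlgEquiv.mul_apply, ← map_mul, mul_inv_cancel, map_one, AlgEquiv.one_apply])
    (by
      ext x
      change linAut A⁻¹ (linAut A x.1) = x.1
      rw [← AlgEquiv.mul_apply, ← map_mul, inv_mul_cancel, map_one, AlgEquiv.one_apply])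
  map_one' := by
    ext x
    change linAut (1 : GL (Fin (n + 1)) k) x.1 = x.1
    rw [map_one, AlgEquiv.one_apply]
  map_mul' A B := by
    ext x
    change linAut (A * B) x.1 = linAut A (linAut B x.1)
    rw [map_mul, AlgEquiv.mul_apply]

/-- The subgroup `C` of the elements which act by scalar matrices (the matrices in the centre of the
general linear group). -/
def scalarSubgroup (ρ : G →* GL (Fin (n + 1)) k) : Subgroup G :=
  (Subgroup.center (GL (Fin (n + 1)) k)).comap ρ

instance (ρ : G →* GL (Fin (n + 1)) k) : (scalarSubgroup ρ).Normal := by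
  unfold scalarSubgroup
  infer_instance

theorem projAut_eq_one (A : GL (Fin (n + 1)) k) (hA : A ∈ Subgroup.center (GL (Fin (n + 1)) k)) :
    projAut A = 1 := by
  obtain ⟨c, hc⟩ := Matrix.GeneralLinearGroup.mem_center_iff_val_mem_range_scalar.mp hA
  have hcoord : ∀ j, linAut A (coord k j) = c • coord k j := by
    intro j
    rw [linAut_coord, ← hc]
    simp [Matrix.scalar_apply, Matrix.diagonal_apply]
  have hc0 : c ≠ 0 := by
    rintro rfl
    have h0 : A.1 = 0 := by rw [← hc]; simp
    exact A.ne_zero h0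
  ext x
  change linAut A x.1 = x.1
  obtain ⟨x, hx⟩ := x
  change linAut A x = x
  induction hx using IntermediateField.adjoin_induction with
  | mem x hx =>
    obtain ⟨a, b, -, rfl⟩ := hx
    rw [map_div₀, hcoord, hcoord, Algebra.smul_def, Algebra.smul_def, mul_div_mul_left]
    simpa using hc0
  | algebraMap c => exact AlgEquiv.commutes _ _
  | add x y _ _ hx hy => rw [map_add, hx, hy]
  | inv x _ hx => rw [map_inv₀, hx]
  | mul x y _ _ hx hy => rw [map_mul, hx, hy]

/-- The action of `G/C` on `k(ℙ(V))` defined by a representation `G → GL(V^∨)`, where the matrix of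
`g` is taken in the basis of `V^∨` given by the coordinate functions. -/
def projAction (ρ : G →* GL (Fin (n + 1)) k) :
    (G ⧸ scalarSubgroup ρ) →* (PField k n ≃ₐ[k] PField k n) :=
  QuotientGroup.lift (scalarSubgroup ρ) (projAut.comp ρ) fun g hg => projAut_eq_one (ρ g) hg

/-- The subspace `V_{Γ,ε} = {w | w · g = ε(g) w for all g ∈ Γ}`, where `Γ` is the stabilizer of the
line spanned by the vector `v` and `ε` is the character by which `Γ` acts on that line.
The group acts on `V` from the right, by `v · g = v ᵥ* ρ g`, dually to the action on `V^∨`. -/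
def eigenSubspace (ρ : G →* GL (Fin (n + 1)) k) (v : Fin (n + 1) → k) :
    Submodule k (Fin (n + 1) → k) where
  carrier := {w | ∀ (g : G) (c : k), Matrix.vecMul v (ρ g).1 = c • v →
    Matrix.vecMul w (ρ g).1 = c • w}
  zero_mem' := by intro g c _; simp
  add_mem' := by
    intro w w' hw hw' g c h
    rw [Matrix.add_vecMul, hw g c h, hw' g c h, smul_add]
  smul_mem' := by
    intro a w hw g c h
    rw [Matrix.smul_vecMul, hw g c h, smul_comm]

/-- The arrangement of the subspaces `V_{Γ,ε}` with `Γ ≠ C`, where `Γ` is the stabilizer of some line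
in `V` and `ε` is its character. -/
def arrangement (ρ : G →* GL (Fin (n + 1)) k) : Set (Submodule k (Fin (n + 1) → k)) :=
  {W | ∃ v : Fin (n + 1) → k, v ≠ 0 ∧
    {g : G | ∃ c : k, Matrix.vecMul v (ρ g).1 = c • v} ≠ scalarSubgroup ρ ∧
    W = eigenSubspace ρ v}

/-- The linear forms on `V/W`, divided by the first coordinate function (so that they are elements
of `k(ℙ(V))`; their quotients do not depend on the choice of the denominator). -/
def quotientForms (W : Submodule k (Fin (n + 1) → k)) : Submodule k (PField k n) where
  carrier := {y | ∃ a : Fin (n + 1) → k, (∀ w ∈ W, a ⬝ᵥ w = 0) ∧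
    (y : RatField k (Fin (n + 1))) = linForm a / coord k 0}
  zero_mem' := ⟨0, by simp, by simp⟩
  add_mem' := by
    rintro y y' ⟨a, ha, hy⟩ ⟨a', ha', hy'⟩
    refine ⟨a + a', fun w hw => by rw [add_dotProduct, ha w hw, ha' w hw, add_zero], ?_⟩
    rw [map_add, add_div, ← hy, ← hy']
    rfl
  smul_mem' := by
    rintro c y ⟨a, ha, hy⟩
    refine ⟨c • a, fun w hw => by rw [smul_dotProduct, ha w hw, smul_zero], ?_⟩
    rw [map_smul, smul_div_assoc, ← hy]
    rfl

/-- The De Concini--Procesi model of `ℙ(V)`: the closure of the image of `ℙ(V)°` in the product of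
`ℙ(V) = ℙ(V/0)` and of the `ℙ(V/W)`, for all `W` in the arrangement. -/
def dcpModel (ρ : G →* GL (Fin (n + 1)) k) : Set (Subalgebra k (PField k n)) :=
  projModel fun W : ↥(insert ⊥ (arrangement ρ)) => quotientForms W.1

end LinearAction

end Burnside

end

universe w

noncomputable section

namespace Burnside

/-! ### Local subrings of a field -/

section LocalSubrings

variable {k : Type u} [Field k] {K : Type u} [Field K] [Algebra k K]

/-! Let `U` be the space of linear forms and `arr` the finite collection of annihilators of `⊥` and
of the members of the arrangement. Over an infinite field, a subspace that contains V_{Γ,ε} for the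
stabilizer and character of each of its vectors is itself such a subspace
(`exists_eq_eigenSubspace`). Hence `arr` is stable under sums and under the group, and contains
every nonzero image of an operator `g - c`. `LinModel` records exactly these properties, and the De
Concini--Procesi model is the set of its points (`dcpModel_eq`).

At a point with local ring `O`, each `A` in `arr` has a form `s A` that divides all forms of `A`.
Stability under sums makes the orders of vanishing of these forms totally ordered (`IsPoint.total`).
The largest subspaces of the various orders form a flag, the levels, and the stabilizer of the point
preserves each level. An element of the generic stabilizer H multiplies the forms of a level by a
constant, up to forms of higher order (`exists_scalar`). A commutator of an element of the
stabilizer with one of H is therefore the identity on all levels up to higher order. Since the image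
of `g - 1` is zero or in `arr`, such a `g` is the identity (`ρ_eq_smul`). So H is abelian and is
centralized by the stabilizer (`IsPoint.commute`).

Choose a basis of H-eigenvectors adapted to the levels. Its members divided by the chosen form of
their level, together with the quotients of the chosen forms of consecutive levels, are n
coordinates. They generate the function field, `O` is a localization of their polynomial ring, and H
acts on them through characters. The locus where all coordinates with nontrivial character vanish
contains the given point. Its generic stabilizer contains H, and it is no larger, because generic
stabilizers grow under specialization (`inertia_anti`). Hence a maximal stratum is this locus
(`IsFrame.isPolyLoc`). This has several consequences. A stratum is determined by its levels, by H
and by finitely many choices, so there are finitely many strata. The normal weights are the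
nontrivial characters of the coordinates, and they generate the dual of H because the action is
faithful. The residue field is generated by the remaining coordinates; grouped by level, these are
affine coordinates on a product of projective spaces. The stabilizer acts linearly on each level,
hence on each factor (`IsFrame.exists_isProjFrame`).

A product of projective spaces is rational, hence rationally connected, and is a smooth projective
model of its function field. Its Picard group is generated by the hyperplanes at infinity and is
torsion-free (`mem_principal_of_smul_mem`). A group that does not permute the factors acts trivially
on it (`picRep_eq_one`), so 1-cocycles of a finite group are homomorphisms to a torsion-free group
and vanish. Finally, every stratum other than the generic point specializes it with a different
generic stabilizer, which is thus nontrivial (`burnClass_sub_mem`). -/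

/-- The maximal ideal of a local subalgebra `O` of `K`, as a subset of `K`. -/
def maxSet (O : Subalgebra k K) : Set K := {x | x ∈ O ∧ (x = 0 ∨ x⁻¹ ∉ O)}

theorem mem_nonunits_iff_mem_maxSet {O : Subalgebra k K} (x : O) :
    x ∈ nonunits O ↔ (x : K) ∈ maxSet O := by
  rw [mem_nonunits_iff, maxSet, Set.mem_ofPred_eq, ← not_iff_not, not_not]
  constructor
  · rintro ⟨u, rfl⟩ ⟨-, h⟩
    have h1 : ((u : O) : K) * ((u⁻¹ : Oˣ) : O) = 1 := by
      rw [← MulMemClass.coe_mul, Units.mul_inv]; rfl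
    rcases h with h | h
    · rw [h, zero_mul] at h1; exact zero_ne_one h1
    · rw [inv_eq_of_mul_eq_one_right h1] at h
      exact h (SetLike.coe_mem _)
  · intro h
    push Not at h
    obtain ⟨h0, h1⟩ := h x.2
    exact IsUnit.of_mul_eq_one ⟨(x : K)⁻¹, h1⟩ (Subtype.ext (mul_inv_cancel₀ h0))

theorem ne_zero_and_inv_mem_of_notMem_maxSet {O : Subalgebra k K} {x : K} (hx : x ∈ O)
    (h : x ∉ maxSet O) : x ≠ 0 ∧ x⁻¹ ∈ O := by
  by_contra h'
  exact h ⟨hx, by tauto⟩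

theorem zero_mem_maxSet (O : Subalgebra k K) : (0 : K) ∈ maxSet O := ⟨O.zero_mem, Or.inl rfl⟩

theorem one_notMem_maxSet (O : Subalgebra k K) : (1 : K) ∉ maxSet O := by
  rintro ⟨-, h | h⟩
  · exact one_ne_zero h
  · exact h (by simp [O.one_mem])

theorem notMem_maxSet_of_inv_mem {O : Subalgebra k K} {x : K} (h0 : x ≠ 0) (h : x⁻¹ ∈ O) :
    x ∉ maxSet O := fun hx => hx.2.elim h0 fun h' => h' h

theorem mul_mem_maxSet {O : Subalgebra k K} {a x : K} (ha : a ∈ O) (hx : x ∈ maxSet O) :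
    a * x ∈ maxSet O := by
  refine ⟨O.mul_mem ha hx.1, ?_⟩
  by_contra h
  push Not at h
  have ha0 : a ≠ 0 := left_ne_zero_of_mul h.1
  refine notMem_maxSet_of_inv_mem (right_ne_zero_of_mul h.1) ?_ hx
  have := O.mul_mem ha h.2
  rwa [mul_inv, mul_inv_cancel_left₀ ha0] at this

theorem mul_mem_maxSet' {O : Subalgebra k K} {a x : K} (ha : a ∈ O) (hx : x ∈ maxSet O) :
    x * a ∈ maxSet O := mul_comm a x ▸ mul_mem_maxSet ha hx

theorem add_mem_maxSet {O : Subalgebra k K} [IsLocalRing O] {x y : K} (hx : x ∈ maxSet O)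
    (hy : y ∈ maxSet O) : x + y ∈ maxSet O := by
  have := IsLocalRing.nonunits_add (R := O) (a := ⟨x, hx.1⟩) (b := ⟨y, hy.1⟩)
    ((mem_nonunits_iff_mem_maxSet _).2 hx) ((mem_nonunits_iff_mem_maxSet _).2 hy)
  exact (mem_nonunits_iff_mem_maxSet _).1 this

theorem neg_mem_maxSet {O : Subalgebra k K} {x : K} (hx : x ∈ maxSet O) : -x ∈ maxSet O := by
  rw [neg_eq_neg_one_mul]
  exact mul_mem_maxSet (O.neg_mem O.one_mem) hx

theorem sub_mem_maxSet {O : Subalgebra k K} [IsLocalRing O] {x y : K} (hx : x ∈ maxSet O)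
    (hy : y ∈ maxSet O) : x - y ∈ maxSet O := by
  rw [sub_eq_add_neg]
  exact add_mem_maxSet hx (neg_mem_maxSet hy)

theorem smul_mem_maxSet {O : Subalgebra k K} {x : K} (c : k) (hx : x ∈ maxSet O) :
    c • x ∈ maxSet O := by
  rw [Algebra.smul_def]
  exact mul_mem_maxSet (O.algebraMap_mem c) hx

theorem mem_maxSet_or_of_mul {O : Subalgebra k K} {x y : K} (hx : x ∈ O) (hy : y ∈ O)
    (h : x * y ∈ maxSet O) : x ∈ maxSet O ∨ y ∈ maxSet O := by
  by_contra h'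
  push Not at h'
  obtain ⟨hx0, hx1⟩ := ne_zero_and_inv_mem_of_notMem_maxSet hx h'.1
  obtain ⟨hy0, hy1⟩ := ne_zero_and_inv_mem_of_notMem_maxSet hy h'.2
  refine notMem_maxSet_of_inv_mem (mul_ne_zero hx0 hy0) ?_ h
  rw [mul_inv]
  exact O.mul_mem hx1 hy1

theorem maxSet_inter_subset {O O' : Subalgebra k K} (h : O ≤ O') {x : K} (hx : x ∈ O)
    (hx' : x ∈ maxSet O') : x ∈ maxSet O :=
  ⟨hx, hx'.2.imp_right fun h' h'' => h' (h h'')⟩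

/-- A scalar in the maximal ideal vanishes. -/
theorem algebraMap_mem_maxSet_iff {O : Subalgebra k K} {c : k} :
    algebraMap k K c ∈ maxSet O ↔ c = 0 := by
  constructor
  · intro h
    by_contra hc
    refine notMem_maxSet_of_inv_mem (O := O) (by simpa using hc) ?_ h
    rw [← map_inv₀]
    exact O.algebraMap_mem _
  · rintro rfl
    simpa using zero_mem_maxSet O

/-- `O` is the localization of the subalgebra `A` at a prime ideal. -/
def IsLocOf (A O : Subalgebra k K) : Prop :=
  A ≤ O ∧ IsLocalRing O ∧ ∀ x ∈ O, ∃ a ∈ A, ∃ b ∈ A, b ≠ 0 ∧ b⁻¹ ∈ O ∧ x = a / b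

/-- Together with `IsLocOf.exists_prime` this removes prime ideals from the discussion: a point is a
subring of `K`, and its prime is the trace of `maxSet`. -/
theorem isLocOf_localRingAt (A : Subalgebra k K) (p : Ideal A) [hp : p.IsPrime] :
    IsLocOf A (localRingAt A p) ∧ ∀ a : A, a ∈ p ↔ (a : K) ∈ maxSet (localRingAt A p) := by
  have hle : A ≤ localRingAt A p := fun a ha =>
    ⟨⟨a, ha⟩, 1, fun h => hp.ne_top ((Ideal.eq_top_iff_one p).mpr h), by simp⟩
  have hne : ∀ b : A, b ∉ p → (b : K) ≠ 0 := by
    intro b hb h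
    exact hb ((Subtype.ext h : b = 0) ▸ p.zero_mem)
  have hinv : ∀ b : A, b ∉ p → (b : K)⁻¹ ∈ localRingAt A p := fun b hb =>
    ⟨1, b, hb, by rw [inv_mul_cancel₀ (hne b hb)]; rfl⟩
  have hmax : ∀ a : A, a ∈ p ↔ (a : K) ∈ maxSet (localRingAt A p) := by
    intro a
    constructor
    · intro ha
      refine ⟨hle a.2, or_iff_not_imp_left.2 fun h0 => ?_⟩
      rintro ⟨c, d, hd, h⟩
      refine hd ?_
      have : d = a * c := Subtype.ext (by
        push_cast
        rw [← h, mul_inv_cancel_left₀ h0])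
      rw [this]
      exact p.mul_mem_right _ ha
    · intro h
      by_contra ha
      exact notMem_maxSet_of_inv_mem (hne a ha) (hinv a ha) h
  refine ⟨⟨hle, ?_, ?_⟩, hmax⟩
  · have : Nontrivial (localRingAt A p) := inferInstance
    refine IsLocalRing.of_nonunits_add ?_
    rintro ⟨x, hx⟩ ⟨y, hy⟩ h h'
    rw [mem_nonunits_iff_mem_maxSet] at h h' ⊢
    change x ∈ maxSet _ at h
    change y ∈ maxSet _ at h'
    change x + y ∈ maxSet _
    obtain ⟨a, b, hb, hab⟩ := hx
    obtain ⟨c, d, hd, hcd⟩ := hy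
    have hap : a ∈ p := (hmax a).2 (by rw [← hab]; exact mul_mem_maxSet' (hle b.2) h)
    have hcp : c ∈ p := (hmax c).2 (by rw [← hcd]; exact mul_mem_maxSet' (hle d.2) h')
    have : x + y = (b : K)⁻¹ * (d : K)⁻¹ * ((a * d + c * b : A) : K) := by
      push_cast
      rw [← hab, ← hcd]
      field_simp [hne b hb, hne d hd]
    rw [this]
    exact mul_mem_maxSet (Subalgebra.mul_mem _ (hinv b hb) (hinv d hd))
      ((hmax _).1 (p.add_mem (p.mul_mem_right _ hap) (p.mul_mem_right _ hcp)))
  · rintro x ⟨a, b, hb, hab⟩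
    refine ⟨a, a.2, b, b.2, hne b hb, hinv b hb, ?_⟩
    rw [← hab, mul_div_cancel_right₀ _ (hne b hb)]

/-- The prime ideal of `A` that defines the local ring `O`. -/
theorem IsLocOf.exists_prime {A O : Subalgebra k K} (h : IsLocOf A O) :
    ∃ (p : Ideal A) (_ : p.IsPrime), O = localRingAt A p ∧ ∀ a : A, a ∈ p ↔ (a : K) ∈ maxSet O := by
  obtain ⟨hle, hloc, hfrac⟩ := h
  let p : Ideal A :=
    { carrier := {a | (a : K) ∈ maxSet O}
      add_mem' := fun ha hb => add_mem_maxSet ha hb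
      zero_mem' := zero_mem_maxSet O
      smul_mem' := fun c x hx => mul_mem_maxSet (hle c.2) hx }
  have hp : p.IsPrime := by
    refine ⟨fun h1 => one_notMem_maxSet O ((Ideal.eq_top_iff_one p).1 h1), ?_⟩
    intro x y hxy
    exact mem_maxSet_or_of_mul (hle x.2) (hle y.2) hxy
  refine ⟨p, hp, ?_, fun a => Iff.rfl⟩
  ext x
  constructor
  · intro hx
    obtain ⟨a, ha, b, hb, hb0, hbi, rfl⟩ := hfrac x hx
    exact ⟨⟨a, ha⟩, ⟨b, hb⟩, notMem_maxSet_of_inv_mem hb0 hbi, div_mul_cancel₀ a hb0⟩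
  · rintro ⟨a, b, hb, hab⟩
    obtain ⟨hb0, hbi⟩ := ne_zero_and_inv_mem_of_notMem_maxSet (hle b.2) hb
    have : x = a * (b : K)⁻¹ := by rw [← hab, mul_inv_cancel_right₀ hb0]
    rw [this]
    exact O.mul_mem (hle a.2) hbi

theorem mem_projModel_iff {ι : Type*} {S : ι → Submodule k K} {O : Subalgebra k K} :
    O ∈ projModel S ↔
      ∃ s : ι → K, (∀ i, s i ∈ S i ∧ s i ≠ 0) ∧ IsLocOf (chart S s) O := by
  constructor
  · rintro ⟨s, hs, p, hp, rfl⟩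
    exact ⟨s, hs, (isLocOf_localRingAt _ p).1⟩
  · rintro ⟨s, hs, h⟩
    obtain ⟨p, hp, h, -⟩ := h.exists_prime
    exact ⟨s, hs, p, hp, h⟩

theorem IsLocOf.trans {A O O' : Subalgebra k K} (h : IsLocOf A O) (h' : IsLocOf O O') :
    IsLocOf A O' := by
  refine ⟨h.1.trans h'.1, h'.2.1, fun x hx => ?_⟩
  obtain ⟨a, ha, b, hb, hb0, hbi, rfl⟩ := h'.2.2 x hx
  obtain ⟨a₁, ha₁, a₂, ha₂, ha0, hai, rfl⟩ := h.2.2 a ha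
  obtain ⟨b₁, hb₁, b₂, hb₂, hb₂0, hb₂i, rfl⟩ := h.2.2 b hb
  have hb₁0 : b₁ ≠ 0 := fun h => hb0 (by simp [h])
  refine ⟨a₁ * b₂, A.mul_mem ha₁ hb₂, a₂ * b₁, A.mul_mem ha₂ hb₁, mul_ne_zero ha0 hb₁0, ?_, ?_⟩
  · have : (a₂ * b₁)⁻¹ = a₂⁻¹ * (b₂⁻¹ * (b₁ / b₂)⁻¹) := by field_simp
    rw [this]
    exact O'.mul_mem (h'.1 hai) (O'.mul_mem (h'.1 hb₂i) hbi)
  · field_simp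

theorem IsLocOf.of_le {A B O : Subalgebra k K} (h : IsLocOf A O) (hAB : A ≤ B) (hB : B ≤ O) :
    IsLocOf B O := by
  refine ⟨hB, h.2.1, fun x hx => ?_⟩
  obtain ⟨a, ha, b, hb, h⟩ := h.2.2 x hx
  exact ⟨a, hAB ha, b, hAB hb, h⟩

/-- The fractions of elements of `A` with denominators invertible in `O`. -/
def fractionsIn (A O : Subalgebra k K) : Subalgebra k K where
  carrier := {x | ∃ a ∈ A, ∃ b ∈ A, b ≠ 0 ∧ b⁻¹ ∈ O ∧ x = a / b}
  mul_mem' := by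
    rintro _ _ ⟨a, ha, b, hb, hb0, hbi, rfl⟩ ⟨c, hc, d, hd, hd0, hdi, rfl⟩
    refine ⟨a * c, A.mul_mem ha hc, b * d, A.mul_mem hb hd, mul_ne_zero hb0 hd0, ?_, ?_⟩
    · rw [mul_inv]; exact O.mul_mem hbi hdi
    · field_simp
  add_mem' := by
    rintro _ _ ⟨a, ha, b, hb, hb0, hbi, rfl⟩ ⟨c, hc, d, hd, hd0, hdi, rfl⟩
    refine ⟨a * d + c * b, A.add_mem (A.mul_mem ha hd) (A.mul_mem hc hb), b * d, A.mul_mem hb hd,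
      mul_ne_zero hb0 hd0, ?_, ?_⟩
    · rw [mul_inv]; exact O.mul_mem hbi hdi
    · field_simp
  algebraMap_mem' := fun r =>
    ⟨algebraMap k K r, A.algebraMap_mem r, 1, A.one_mem, one_ne_zero, by simp [O.one_mem], by simp⟩

/-- To see that `O` is a localization of `B`, it suffices to write the generators of another
algebra with this property as fractions. -/
theorem IsLocOf.of_generators {O B : Subalgebra k K} {s : Set K}
    (h : IsLocOf (Algebra.adjoin k s) O) (hB : B ≤ O)
    (hs : ∀ x ∈ s, ∃ a ∈ B, ∃ b ∈ B, b ≠ 0 ∧ b⁻¹ ∈ O ∧ x = a / b) : IsLocOf B O := by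
  have hle : Algebra.adjoin k s ≤ fractionsIn B O := Algebra.adjoin_le hs
  refine ⟨hB, h.2.1, fun x hx => ?_⟩
  obtain ⟨a, ha, b, hb, hb0, hbi, rfl⟩ := h.2.2 x hx
  obtain ⟨a₁, ha₁, a₂, ha₂, ha0, hai, rfl⟩ := hle ha
  obtain ⟨b₁, hb₁, b₂, hb₂, hb₂0, hb₂i, rfl⟩ := hle hb
  have hb₁0 : b₁ ≠ 0 := fun h => hb0 (by simp [h])
  refine ⟨a₁ * b₂, B.mul_mem ha₁ hb₂, a₂ * b₁, B.mul_mem ha₂ hb₁, mul_ne_zero ha0 hb₁0, ?_, ?_⟩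
  · have : (a₂ * b₁)⁻¹ = a₂⁻¹ * (b₂⁻¹ * (b₁ / b₂)⁻¹) := by field_simp
    rw [this]
    exact O.mul_mem hai (O.mul_mem hb₂i hbi)
  · field_simp

/-- Two local rings of the same algebra agree if their primes do. -/
theorem IsLocOf.eq_of_maxSet {A O O' : Subalgebra k K} (h : IsLocOf A O) (h' : IsLocOf A O')
    (hm : ∀ a ∈ A, a ∈ maxSet O ↔ a ∈ maxSet O') : O = O' := by
  obtain ⟨p, hp, rfl, hp'⟩ := h.exists_prime
  obtain ⟨q, hq, rfl, hq'⟩ := h'.exists_prime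
  have : p = q := by
    ext a
    rw [hp', hq', hm a a.2]
  subst this
  rfl

theorem isLocOf_top {A : Subalgebra k K} (hA : ∀ x : K, ∃ a ∈ A, ∃ b ∈ A, b ≠ 0 ∧ x = a / b) :
    IsLocOf A ⊤ := by
  refine ⟨le_top, ?_, fun x _ => ?_⟩
  · refine IsLocalRing.of_nonunits_add ?_
    have key : ∀ x : (⊤ : Subalgebra k K), x ∈ nonunits (⊤ : Subalgebra k K) → (x : K) = 0 := by
      intro x hx
      rw [mem_nonunits_iff_mem_maxSet] at hx
      exact hx.2.resolve_right fun h => h trivial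
    intro x y hx hy
    rw [mem_nonunits_iff_mem_maxSet]
    have : ((x + y : (⊤ : Subalgebra k K)) : K) = 0 := by
      push_cast
      rw [key x hx, key y hy, add_zero]
    rw [this]
    exact zero_mem_maxSet _
  · obtain ⟨a, ha, b, hb, hb0, rfl⟩ := hA x
    exact ⟨a, ha, b, hb, hb0, trivial, rfl⟩

/-- The image of a local ring under an automorphism. -/
theorem mem_maxSet_of_map_eq {O : Subalgebra k K} {f : K ≃ₐ[k] K}
    (h : O.map (f : K →ₐ[k] K) = O) {x : K} (hx : x ∈ maxSet O) : f x ∈ maxSet O := by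
  have key : ∀ y, f y ∈ O → y ∈ O := by
    intro y hy
    rw [← h] at hy
    obtain ⟨z, hz, hzy⟩ := hy
    rwa [← f.injective hzy]
  refine ⟨h ▸ ⟨x, hx.1, rfl⟩, hx.2.imp (fun h0 => by rw [h0, map_zero]) fun h' h'' => ?_⟩
  rw [← map_inv₀] at h''
  exact h' (key _ h'')

theorem mem_of_map_eq {O : Subalgebra k K} {f : K ≃ₐ[k] K}
    (h : O.map (f : K →ₐ[k] K) = O) {x : K} (hx : x ∈ O) : f x ∈ O := h ▸ ⟨x, hx, rfl⟩

end LocalSubrings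

/-! ### Generators of function fields -/

section Generators

variable {k : Type u} [Field k] {K : Type u} [Field K] [Algebra k K]

theorem exists_div_of_adjoin_eq_top {s : Set K} (h : IntermediateField.adjoin k s = ⊤) (x : K) :
    ∃ a ∈ Algebra.adjoin k s, ∃ b ∈ Algebra.adjoin k s, b ≠ 0 ∧ x = a / b := by
  have hx : x ∈ IntermediateField.adjoin k s := h ▸ trivial
  obtain ⟨a, ha, b, hb, rfl⟩ := IntermediateField.mem_adjoin_iff_div.1 hx
  by_cases hb0 : b = 0
  · exact ⟨0, Subalgebra.zero_mem _, 1, Subalgebra.one_mem _, one_ne_zero, by simp [hb0]⟩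
  · exact ⟨a, ha, b, hb, hb0, rfl⟩

theorem isAlgebraic_of_adjoin_eq_top {s : Set K} (h : IntermediateField.adjoin k s = ⊤) :
    Algebra.IsAlgebraic (Algebra.adjoin k s) K := by
  refine ⟨fun x => ?_⟩
  obtain ⟨a, ha, b, hb, -, rfl⟩ := exists_div_of_adjoin_eq_top h x
  rw [div_eq_mul_inv]
  exact (isAlgebraic_algebraMap (⟨a, ha⟩ : Algebra.adjoin k s)).mul
    (isAlgebraic_algebraMap (⟨b, hb⟩ : Algebra.adjoin k s)).inv

/-- A family of generators of a field, as many as the transcendence degree, is algebraically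
independent. -/
theorem algebraicIndependent_of_adjoin_eq_top {ι : Type*} [Fintype ι] {x : ι → K}
    (h : IntermediateField.adjoin k (Set.range x) = ⊤)
    (hd : (Fintype.card ι : Cardinal.{u}) ≤ Algebra.trdeg k K) : AlgebraicIndependent k x := by
  have := isAlgebraic_of_adjoin_eq_top h
  refine (Algebra.IsAlgebraic.isTranscendenceBasis_of_lift_le_trdeg_of_finite k x ?_).1
  rw [Cardinal.mk_fintype, Cardinal.lift_natCast, ← Cardinal.lift_natCast.{_, u}]
  exact Cardinal.lift_le.2 hd

theorem trdeg_eq_of_algebraicIndependent {ι : Type*} [Fintype ι] {x : ι → K}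
    (hx : AlgebraicIndependent k x) (h : IntermediateField.adjoin k (Set.range x) = ⊤) :
    Algebra.trdeg k K = Fintype.card ι := by
  have := isAlgebraic_of_adjoin_eq_top h
  have hb : IsTranscendenceBasis k x :=
    isTranscendenceBasis_iff_algebraicIndependent_isAlgebraic.2 ⟨hx, this⟩
  have := hb.lift_cardinalMk_eq_trdeg
  rw [Cardinal.mk_fintype, Cardinal.lift_natCast, ← Cardinal.lift_natCast.{_, u}] at this
  exact (Cardinal.lift_injective this).symm

end Generators

/-! ### Localizations of polynomial rings at ideals generated by variables -/

section PolyLoc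

variable {k : Type u} [Field k] {K : Type u} [Field K] [Algebra k K] {τ : Type*}

/-- The ideal generated by the variables in `P`. -/
abbrev varIdeal (k : Type u) [Field k] {τ : Type*} (P : Set τ) : Ideal (MvPolynomial τ k) :=
  Ideal.span (MvPolynomial.X '' P)

open scoped Classical in
/-- The substitution `x_v ↦ 0` for `v ∈ P`. -/
def killVars (k : Type u) [Field k] {τ : Type*} (P : Set τ) :
    MvPolynomial τ k →ₐ[k] MvPolynomial τ k :=
  MvPolynomial.aeval fun v => if v ∈ P then 0 else MvPolynomial.X v

/-- The substitution kills the generators and is the identity modulo the ideal. Membership thus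
becomes an equation in a domain, which also gives primality. -/
theorem mem_varIdeal_iff {P : Set τ} {f : MvPolynomial τ k} :
    f ∈ varIdeal k P ↔ killVars k P f = 0 := by
  classical
  constructor
  · intro hf
    have : varIdeal k P ≤ RingHom.ker (killVars k P) := by
      rw [Ideal.span_le]
      rintro _ ⟨v, hv, rfl⟩
      simp [killVars, hv]
    exact this hf
  · intro hf
    have h : (Ideal.Quotient.mkₐ k (varIdeal k P)).comp (killVars k P) =
        Ideal.Quotient.mkₐ k (varIdeal k P) := by
      ext v
      simp only [killVars, AlgHom.comp_apply, MvPolynomial.aeval_X]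
      split_ifs with hv
      · rw [map_zero]
        exact (Ideal.Quotient.eq_zero_iff_mem.2 (Ideal.subset_span (Set.mem_image_of_mem _ hv))).symm
      · rfl
    have := DFunLike.congr_fun h f
    rw [AlgHom.comp_apply, hf, map_zero] at this
    exact Ideal.Quotient.eq_zero_iff_mem.1 this.symm

theorem varIdeal_isPrime (P : Set τ) : (varIdeal k P).IsPrime := by
  have : varIdeal k P = RingHom.ker (killVars k P) := by
    ext f
    rw [mem_varIdeal_iff, RingHom.mem_ker]
  rw [this]
  exact RingHom.ker_isPrime _

/-- `O` is the localization of the polynomial ring `k[x]` at the ideal generated by the variables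
in `P`. -/
def IsPolyLoc (x : τ → K) (P : Set τ) (O : Subalgebra k K) : Prop :=
  IsLocOf (Algebra.adjoin k (Set.range x)) O ∧
    ∀ f : MvPolynomial τ k, MvPolynomial.aeval x f ∈ maxSet O ↔ f ∈ varIdeal k P

theorem exists_isPolyLoc {x : τ → K} (hx : AlgebraicIndependent k x) (P : Set τ) :
    ∃ O : Subalgebra k K, IsPolyLoc x P O := by
  have := varIdeal_isPrime (k := k) P
  let p := (varIdeal k P).comap (hx.repr : Algebra.adjoin k (Set.range x) →+* MvPolynomial τ k)
  have hp : p.IsPrime := Ideal.comap_isPrime _ _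
  obtain ⟨h, h'⟩ := isLocOf_localRingAt _ p
  refine ⟨_, h, fun f => ?_⟩
  have h1 := h' (hx.aevalEquiv f)
  have h2 : ((hx.aevalEquiv f : Algebra.adjoin k (Set.range x)) : K) = MvPolynomial.aeval x f :=
    hx.algebraMap_aevalEquiv f
  rw [h2] at h1
  rw [← h1, Ideal.mem_comap]
  have : hx.repr (hx.aevalEquiv f) = f := hx.aevalEquiv.symm_apply_apply f
  exact Iff.of_eq (congrArg (· ∈ varIdeal k P) this)

theorem exists_aeval_of_mem_adjoin {x : τ → K} {a : K} (ha : a ∈ Algebra.adjoin k (Set.range x)) :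
    ∃ f : MvPolynomial τ k, MvPolynomial.aeval x f = a := by
  rw [Algebra.adjoin_range_eq_range_aeval] at ha
  exact ha

theorem aeval_mem_adjoin (x : τ → K) (f : MvPolynomial τ k) :
    MvPolynomial.aeval x f ∈ Algebra.adjoin k (Set.range x) := by
  rw [Algebra.adjoin_range_eq_range_aeval]
  exact ⟨f, rfl⟩

theorem coe_aeval_subtype {x : τ → K} {O : Subalgebra k K} (hx : ∀ v, x v ∈ O)
    (f : MvPolynomial τ k) :
    ((MvPolynomial.aeval (fun v => (⟨x v, hx v⟩ : O)) f : O) : K) = MvPolynomial.aeval x f := by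
  change O.val _ = _
  rw [← AlgHom.comp_apply, MvPolynomial.comp_aeval]
  rfl

/-- The prime is prescribed by `P`, so coordinates and vanishing set determine the point. The
finiteness of the set of strata rests on this. -/
theorem IsPolyLoc.unique {x : τ → K} {P : Set τ} {O O' : Subalgebra k K} (h : IsPolyLoc x P O)
    (h' : IsPolyLoc x P O') : O = O' := by
  refine h.1.eq_of_maxSet h'.1 fun a ha => ?_
  obtain ⟨f, rfl⟩ := exists_aeval_of_mem_adjoin ha
  rw [h.2, h'.2]

namespace IsPolyLoc

variable {x : τ → K} {P : Set τ} {O : Subalgebra k K} (h : IsPolyLoc x P O)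

include h

theorem aeval_mem (f : MvPolynomial τ k) : MvPolynomial.aeval x f ∈ O :=
  h.1.1 (aeval_mem_adjoin x f)

theorem var_mem (v : τ) : x v ∈ O := h.1.1 (Algebra.subset_adjoin ⟨v, rfl⟩)

theorem var_mem_maxSet_iff (v : τ) : x v ∈ maxSet O ↔ v ∈ P := by
  have := h.2 (MvPolynomial.X v)
  rw [MvPolynomial.aeval_X] at this
  rw [this, mem_varIdeal_iff, killVars, MvPolynomial.aeval_X]
  split_ifs with hv <;> simp [hv]

theorem exists_frac (y : O) : ∃ f g : MvPolynomial τ k, g ∉ varIdeal k P ∧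
    (y : K) * MvPolynomial.aeval x g = MvPolynomial.aeval x f := by
  obtain ⟨a, ha, b, hb, hb0, hbi, hy⟩ := h.1.2.2 y y.2
  obtain ⟨f, rfl⟩ := exists_aeval_of_mem_adjoin ha
  obtain ⟨g, rfl⟩ := exists_aeval_of_mem_adjoin hb
  refine ⟨f, g, fun hg => notMem_maxSet_of_inv_mem hb0 hbi ((h.2 g).2 hg), ?_⟩
  rw [hy, div_mul_cancel₀ _ hb0]

end IsPolyLoc

/-- The kernel of a surjection from a local subring to a field. -/
theorem ker_eq_maxSet {O : Subalgebra k K} [IsLocalRing O] {κ : Type*} [Field κ] [Algebra k κ]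
    {π : O →ₐ[k] κ} (hπ : Function.Surjective π) (y : O) : π y = 0 ↔ (y : K) ∈ maxSet O := by
  rw [← mem_nonunits_iff_mem_maxSet, ← IsLocalRing.mem_maximalIdeal]
  have : (RingHom.ker π).IsMaximal := RingHom.ker_isMaximal_of_surjective π hπ
  rw [← IsLocalRing.eq_maximalIdeal this, RingHom.mem_ker]

namespace IsPolyLoc

variable {x : τ → K} {P : Set τ} {O : Subalgebra k K}
  {κ : Type*} [Field κ] [Algebra k κ] {π : O →ₐ[k] κ}

/-- A relation between the residues lifts to a polynomial in the variables outside `P` that lies in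
the ideal of `P`. Killing the variables of `P` does not change it, so it is zero. -/
theorem residue_algebraicIndependent (h : IsPolyLoc x P O) (hπ : Function.Surjective π) :
    AlgebraicIndependent k (fun v : ↥Pᶜ => π ⟨x v, h.var_mem v⟩) := by
  have := h.1.2.1
  rw [algebraicIndependent_iff]
  intro f hf
  have h1 : MvPolynomial.aeval (fun v : ↥Pᶜ => π ⟨x v, h.var_mem v⟩) f =
      π ⟨MvPolynomial.aeval x (MvPolynomial.rename Subtype.val f), h.aeval_mem _⟩ := by
    have h2 : (⟨MvPolynomial.aeval x (MvPolynomial.rename Subtype.val f), h.aeval_mem _⟩ : O) =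
        MvPolynomial.aeval (fun v : ↥Pᶜ => (⟨x v, h.var_mem v⟩ : O)) f := by
      apply Subtype.ext
      rw [coe_aeval_subtype (fun v : ↥Pᶜ => h.var_mem v)]
      exact MvPolynomial.aeval_rename _ _ _
    rw [h2, ← AlgHom.comp_apply, MvPolynomial.comp_aeval]
  rw [h1, ker_eq_maxSet hπ, h.2, mem_varIdeal_iff] at hf
  have h3 : killVars k P (MvPolynomial.rename Subtype.val f) =
      MvPolynomial.rename (Subtype.val : ↥Pᶜ → τ) f := by
    rw [killVars, MvPolynomial.aeval_rename, MvPolynomial.rename_eq_aeval]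
    congr 1
    congr 1
    funext v
    have hv : (v : τ) ∉ P := v.2
    simp [hv]
  rw [h3] at hf
  exact MvPolynomial.rename_injective _ Subtype.val_injective (by rw [hf, map_zero])

theorem residue_adjoin_eq_top (h : IsPolyLoc x P O) (hπ : Function.Surjective π) :
    IntermediateField.adjoin k (Set.range fun v : ↥Pᶜ => π ⟨x v, h.var_mem v⟩) = ⊤ := by
  have hloc := h.1.2.1
  have key : ∀ f : MvPolynomial τ k, π ⟨MvPolynomial.aeval x f, h.aeval_mem f⟩ ∈
      IntermediateField.adjoin k (Set.range fun v : ↥Pᶜ => π ⟨x v, h.var_mem v⟩) := by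
    intro f
    have h2 : (⟨MvPolynomial.aeval x f, h.aeval_mem f⟩ : O) =
        MvPolynomial.aeval (fun v => (⟨x v, h.var_mem v⟩ : O)) f :=
      Subtype.ext (coe_aeval_subtype h.var_mem f).symm
    rw [h2, ← AlgHom.comp_apply, MvPolynomial.comp_aeval]
    clear h2
    induction f using MvPolynomial.induction_on with
    | C a =>
      rw [MvPolynomial.aeval_C]
      exact IntermediateField.algebraMap_mem _ a
    | add p q hp hq =>
      rw [map_add]
      exact add_mem hp hq
    | mul_X p v hp =>
      rw [map_mul, MvPolynomial.aeval_X]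
      refine mul_mem hp ?_
      by_cases hv : v ∈ P
      · have : π ⟨x v, h.var_mem v⟩ = 0 := (ker_eq_maxSet hπ _).2 ((h.var_mem_maxSet_iff v).2 hv)
        rw [this]
        exact zero_mem _
      · exact IntermediateField.subset_adjoin _ _ ⟨⟨v, hv⟩, rfl⟩
  rw [eq_top_iff]
  rintro y -
  obtain ⟨y, rfl⟩ := hπ y
  obtain ⟨f, g, hg, hy⟩ := h.exists_frac y
  have h1 : y * ⟨MvPolynomial.aeval x g, h.aeval_mem g⟩ = ⟨MvPolynomial.aeval x f, h.aeval_mem f⟩ :=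
    Subtype.ext hy
  have h2 : π ⟨MvPolynomial.aeval x g, h.aeval_mem g⟩ ≠ 0 := by
    intro h0
    rw [ker_eq_maxSet hπ, h.2] at h0
    exact hg h0
  have h3 := congrArg π h1
  rw [map_mul] at h3
  rw [eq_div_of_mul_eq h2 h3]
  exact div_mem (key f) (key g)

/-- An element of the kernel is a fraction whose numerator lies in the ideal of the variables and
whose denominator is a unit of `O`. -/
theorem ker_residue (h : IsPolyLoc x P O) (hπ : Function.Surjective π) :
    Ideal.span (Set.range fun v : P => (⟨x v, h.var_mem v⟩ : O)) = RingHom.ker π := by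
  have hloc := h.1.2.1
  apply le_antisymm
  · rw [Ideal.span_le]
    rintro _ ⟨v, rfl⟩
    exact (ker_eq_maxSet hπ _).2 ((h.var_mem_maxSet_iff v).2 v.2)
  · intro y hy
    obtain ⟨f, g, hg, hfg⟩ := h.exists_frac y
    have hg' : MvPolynomial.aeval x g ∉ maxSet O := fun h' => hg ((h.2 g).1 h')
    obtain ⟨hg0, hgi⟩ := ne_zero_and_inv_mem_of_notMem_maxSet (h.aeval_mem g) hg'
    have hf : f ∈ varIdeal k P := by
      rw [← h.2, ← hfg]
      exact mul_mem_maxSet' (h.aeval_mem g) ((ker_eq_maxSet hπ _).1 hy)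
    have key : (⟨MvPolynomial.aeval x f, h.aeval_mem f⟩ : O) ∈
        Ideal.span (Set.range fun v : P => (⟨x v, h.var_mem v⟩ : O)) := by
      have h2 : ∀ f, (⟨MvPolynomial.aeval x f, h.aeval_mem f⟩ : O) =
          MvPolynomial.aeval (fun v => (⟨x v, h.var_mem v⟩ : O)) f := by
        exact fun f => Subtype.ext (coe_aeval_subtype h.var_mem f).symm
      rw [h2]
      have : varIdeal k P ≤ (Ideal.span (Set.range fun v : P => (⟨x v, h.var_mem v⟩ : O))).comap
          (MvPolynomial.aeval (R := k) fun v => (⟨x v, h.var_mem v⟩ : O)) := by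
        rw [Ideal.span_le]
        rintro _ ⟨v, hv, rfl⟩
        simp only [Ideal.coe_comap, Set.mem_preimage, MvPolynomial.aeval_X]
        exact Ideal.subset_span ⟨⟨v, hv⟩, rfl⟩
      exact this hf
    have : y = ⟨(MvPolynomial.aeval x g)⁻¹, hgi⟩ * ⟨MvPolynomial.aeval x f, h.aeval_mem f⟩ := by
      apply Subtype.ext
      change (y : K) = (MvPolynomial.aeval x g)⁻¹ * MvPolynomial.aeval x f
      rw [← hfg]
      field_simp
    rw [this]
    exact Ideal.mul_mem_left _ _ key

end IsPolyLoc

/-- The variables in `P` are independent modulo the square of the ideal that they generate. -/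
theorem mem_varIdeal_of_sum_mem_sq {P : Set τ} [Fintype P] {a : P → MvPolynomial τ k}
    (h : ∑ v, a v * MvPolynomial.X (v : τ) ∈ varIdeal k P ^ 2) (v : P) : a v ∈ varIdeal k P := by
  classical
  have hX : ∀ w : P, (MvPolynomial.X (w : τ) : MvPolynomial τ k) ∈ varIdeal k P := fun w =>
    Ideal.subset_span ⟨w, w.2, rfl⟩
  -- By the Leibniz rule a derivation maps the square of an ideal into the ideal; modulo the ideal,
  -- the partial derivative along `v` extracts the coefficient `a v`.
  have hd : ∀ f ∈ varIdeal k P ^ 2, MvPolynomial.pderiv (v : τ) f ∈ varIdeal k P := by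
    intro f hf
    rw [pow_two] at hf
    induction hf using Submodule.mul_induction_on' with
    | mem_mul_mem p hp q hq =>
      rw [Derivation.leibniz, smul_eq_mul, smul_eq_mul]
      exact add_mem (Ideal.mul_mem_right _ _ hp) (Ideal.mul_mem_right _ _ hq)
    | add p _ q _ hp hq =>
      rw [map_add]
      exact add_mem hp hq
  have h1 := hd _ h
  rw [map_sum] at h1
  simp only [Derivation.leibniz, smul_eq_mul, MvPolynomial.pderiv_X] at h1
  rw [Finset.sum_add_distrib] at h1
  have h2 : ∑ w : P, MvPolynomial.X (w : τ) * MvPolynomial.pderiv (v : τ) (a w) ∈ varIdeal k P :=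
    sum_mem fun w _ => Ideal.mul_mem_right _ _ (hX w)
  have h3 := (Submodule.add_mem_iff_left _ h2).1 h1
  rw [Finset.sum_eq_single v] at h3
  · simpa using h3
  · intro w _ hw
    have : (v : τ) ≠ w := fun h => hw (Subtype.ext h.symm)
    simp [this.symm]
  · simp

namespace IsPolyLoc

variable {x : τ → K} {P : Set τ} {O : Subalgebra k K}
  {κ : Type*} [Field κ] [Algebra k κ] {π : O →ₐ[k] κ}

theorem exists_frac_of_mem_ker_sq (h : IsPolyLoc x P O) (hπ : Function.Surjective π) {y : O}
    (hy : y ∈ RingHom.ker π ^ 2) : ∃ f ∈ varIdeal k P ^ 2, ∃ g ∉ varIdeal k P,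
      (y : K) * MvPolynomial.aeval x g = MvPolynomial.aeval x f := by
  have hloc := h.1.2.1
  have hprime := varIdeal_isPrime (k := k) P
  rw [pow_two] at hy
  induction hy using Submodule.mul_induction_on' with
  | mem_mul_mem p hp q hq =>
    obtain ⟨f, g, hg, hfg⟩ := h.exists_frac p
    obtain ⟨f', g', hg', hfg'⟩ := h.exists_frac q
    have hf : f ∈ varIdeal k P := by
      rw [← h.2, ← hfg]
      exact mul_mem_maxSet' (h.aeval_mem g) ((ker_eq_maxSet hπ _).1 hp)
    have hf' : f' ∈ varIdeal k P := by
      rw [← h.2, ← hfg']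
      exact mul_mem_maxSet' (h.aeval_mem g') ((ker_eq_maxSet hπ _).1 hq)
    refine ⟨f * f', by rw [pow_two]; exact Ideal.mul_mem_mul hf hf', g * g',
      fun h' => (hprime.mem_or_mem h').elim hg hg', ?_⟩
    rw [map_mul, map_mul, ← hfg, ← hfg']
    push_cast
    ring
  | add p _ q _ hp hq =>
    obtain ⟨f, hf, g, hg, hfg⟩ := hp
    obtain ⟨f', hf', g', hg', hfg'⟩ := hq
    refine ⟨f * g' + f' * g, add_mem (Ideal.mul_mem_right _ _ hf) (Ideal.mul_mem_right _ _ hf'),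
      g * g', fun h' => (hprime.mem_or_mem h').elim hg hg', ?_⟩
    rw [map_mul, map_add, map_mul, map_mul, ← hfg, ← hfg']
    push_cast
    ring

/-- Clearing all denominators turns the relation into one between polynomials, where
`mem_varIdeal_of_sum_mem_sq` applies. The denominators lie outside the prime ideal and can be
removed from the conclusion. -/
theorem mem_ker_of_sum_mem_sq (hx : AlgebraicIndependent k x) [Fintype P] (h : IsPolyLoc x P O)
    (hπ : Function.Surjective π) (c : P → O)
    (hc : ∑ v, c v * ⟨x v, h.var_mem v⟩ ∈ RingHom.ker π ^ 2) (v : P) : c v ∈ RingHom.ker π := by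
  classical
  have hloc := h.1.2.1
  have hprime := varIdeal_isPrime (k := k) P
  choose f g hg hfg using fun v => h.exists_frac (c v)
  obtain ⟨F, hF, G, hG, hFG⟩ := h.exists_frac_of_mem_ker_sq hπ hc
  let a : P → MvPolynomial τ k := fun v => f v * (∏ w ∈ Finset.univ.erase v, g w) * G
  have hprod : ∀ v, g v * ∏ w ∈ Finset.univ.erase v, g w = ∏ w, g w := fun v =>
    Finset.mul_prod_erase _ _ (Finset.mem_univ v)
  have hsum : ∑ v, a v * MvPolynomial.X (v : τ) = F * ∏ w, g w := by
    apply hx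
    rw [map_sum, map_mul, ← hFG]
    push_cast
    rw [Finset.sum_mul, Finset.sum_mul]
    refine Finset.sum_congr rfl fun v _ => ?_
    rw [← hprod v]
    simp only [a, map_mul, MvPolynomial.aeval_X, ← hfg]
    ring
  have hmem := mem_varIdeal_of_sum_mem_sq (a := a)
    (by rw [hsum]; exact Ideal.mul_mem_right _ _ hF) v
  have hf : f v ∈ varIdeal k P := by
    rcases hprime.mem_or_mem hmem with h1 | h1
    · rcases hprime.mem_or_mem h1 with h2 | h2
      · exact h2
      · obtain ⟨w, -, hw⟩ := (hprime.prod_mem_iff).1 h2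
        exact absurd hw (hg w)
    · exact absurd h1 hG
  rw [RingHom.mem_ker, ker_eq_maxSet hπ]
  rw [← h.2, ← hfg] at hf
  exact (mem_maxSet_or_of_mul (c v).2 (h.aeval_mem _) hf).resolve_right
    fun h' => hg v ((h.2 _).1 h')

end IsPolyLoc

end PolyLoc

/-! ### Linear systems with a group action and the points of their models -/

section Inertia

variable {k : Type u} [Field k] {K : Type u} [Field K] [Algebra k K] {Q : Type v} [Group Q]

theorem mem_inertia_iff {φ : Q →* (K ≃ₐ[k] K)} {O : Subalgebra k K} {q : Q} :
    q ∈ inertia φ O ↔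
      O.map (φ q : K →ₐ[k] K) = O ∧ ∀ x ∈ O, φ q x - x ∈ maxSet O := by
  refine and_congr_right fun h => ⟨fun h' x hx => ?_, fun h' x y hxy => ?_⟩
  · have := h' ⟨x, hx⟩ ⟨φ q x, mem_of_map_eq h hx⟩ rfl
    exact (mem_nonunits_iff_mem_maxSet _).1 this
  · rw [mem_nonunits_iff_mem_maxSet]
    push_cast
    rw [hxy]
    exact h' x x.2

theorem map_eq_inv {φ : Q →* (K ≃ₐ[k] K)} {O : Subalgebra k K} {q : Q}
    (h : O.map (φ q : K →ₐ[k] K) = O) : O.map (φ q⁻¹ : K →ₐ[k] K) = O := by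
  conv_lhs => rw [← h]
  ext x
  simp

theorem map_eq_mul {φ : Q →* (K ≃ₐ[k] K)} {O : Subalgebra k K} {q q' : Q}
    (h : O.map (φ q : K →ₐ[k] K) = O) (h' : O.map (φ q' : K →ₐ[k] K) = O) :
    O.map (φ (q * q') : K →ₐ[k] K) = O := by
  have : (O.map (φ q' : K →ₐ[k] K)).map (φ q : K →ₐ[k] K) = O := by rw [h', h]
  conv_rhs => rw [← this]
  ext x
  simp

/-- The stabilizer of the point with local ring `O`. -/
def stab (φ : Q →* (K ≃ₐ[k] K)) (O : Subalgebra k K) : Subgroup Q where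
  carrier := {q | O.map (φ q : K →ₐ[k] K) = O}
  mul_mem' := map_eq_mul
  one_mem' := by
    change O.map (φ 1 : K →ₐ[k] K) = O
    ext x
    simp
  inv_mem' := map_eq_inv

theorem mem_stab {φ : Q →* (K ≃ₐ[k] K)} {O : Subalgebra k K} {q : Q} :
    q ∈ stab φ O ↔ O.map (φ q : K →ₐ[k] K) = O := Iff.rfl

/-- The generic stabilizer as a subgroup. -/
def inertiaGroup (φ : Q →* (K ≃ₐ[k] K)) (O : Subalgebra k K) [IsLocalRing O] : Subgroup Q where
  carrier := inertia φ O
  mul_mem' := by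
    intro q q' hq hq'
    rw [mem_inertia_iff] at *
    refine ⟨map_eq_mul hq.1 hq'.1, fun x hx => ?_⟩
    have : φ (q * q') x - x = φ q (φ q' x - x) + (φ q x - x) := by
      rw [map_mul, AlgEquiv.mul_apply, map_sub]
      ring
    rw [this]
    exact add_mem_maxSet (mem_maxSet_of_map_eq hq.1 (hq'.2 x hx)) (hq.2 x hx)
  one_mem' := by
    rw [mem_inertia_iff]
    exact ⟨(stab φ O).one_mem, fun x _ => by simpa using zero_mem_maxSet O⟩
  inv_mem' := by
    intro q hq
    rw [mem_inertia_iff] at *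
    refine ⟨map_eq_inv hq.1, fun x hx => ?_⟩
    have hx' := mem_of_map_eq (map_eq_inv hq.1) hx
    have h1 : φ q (φ q⁻¹ x) = x := by
      rw [← AlgEquiv.mul_apply, ← map_mul, mul_inv_cancel, map_one, AlgEquiv.one_apply]
    have := neg_mem_maxSet (hq.2 _ hx')
    rwa [h1, neg_sub] at this

theorem inertiaGroup_le_stab {φ : Q →* (K ≃ₐ[k] K)} {O : Subalgebra k K} [IsLocalRing O] :
    inertiaGroup φ O ≤ stab φ O := fun _ hq => hq.1

/-- It suffices to check on an algebra, of which `O` is a localization, that an element lies in the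
generic stabilizer. -/
theorem mem_inertia_of_isLocOf {φ : Q →* (K ≃ₐ[k] K)} {A O : Subalgebra k K} (h : IsLocOf A O)
    {g : Q} (hg : ∀ x ∈ A, φ g x ∈ O ∧ φ g x - x ∈ maxSet O)
    (hg' : ∀ x ∈ A, φ g⁻¹ x ∈ O ∧ φ g⁻¹ x - x ∈ maxSet O) : g ∈ inertia φ O := by
  have hloc := h.2.1
  have key : ∀ g : Q, (∀ x ∈ A, φ g x ∈ O ∧ φ g x - x ∈ maxSet O) →
      ∀ x ∈ O, φ g x ∈ O ∧ φ g x - x ∈ maxSet O := by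
    intro g hR x hx
    obtain ⟨a, ha, b, hb, hb0, hbi, rfl⟩ := h.2.2 x hx
    have hbm : b ∉ maxSet O := notMem_maxSet_of_inv_mem hb0 hbi
    have hgb : φ g b ∉ maxSet O := fun h' => hbm (by
      have := sub_mem_maxSet h' (hR b hb).2
      rwa [sub_sub_cancel] at this)
    obtain ⟨hgb0, hgbi⟩ := ne_zero_and_inv_mem_of_notMem_maxSet (hR b hb).1 hgb
    rw [map_div₀]
    refine ⟨by rw [div_eq_mul_inv]; exact O.mul_mem (hR a ha).1 hgbi, ?_⟩
    have : φ g a / φ g b - a / b = (φ g b)⁻¹ * b⁻¹ * (b * (φ g a - a) - a * (φ g b - b)) := by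
      field_simp
      ring
    rw [this]
    exact mul_mem_maxSet (O.mul_mem hgbi hbi) (sub_mem_maxSet
      (mul_mem_maxSet (h.1 hb) (hR a ha).2) (mul_mem_maxSet (h.1 ha) (hR b hb).2))
  rw [mem_inertia_iff]
  -- The element `g` only yields an inclusion of its translate of `O` in `O`; equality needs the
  -- same information on `g⁻¹`.
  refine ⟨le_antisymm ?_ ?_, fun x hx => (key g hg x hx).2⟩
  · rintro _ ⟨x, hx, rfl⟩
    exact (key g hg x hx).1
  · intro x hx
    refine ⟨φ g⁻¹ x, (key g⁻¹ hg' x hx).1, ?_⟩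
    change φ g (φ g⁻¹ x) = x
    rw [← AlgEquiv.mul_apply, ← map_mul, mul_inv_cancel, map_one, AlgEquiv.one_apply]

end Inertia

/-! ### Roots of unity in residue fields -/

section Roots

variable {k : Type u} [Field k] {K : Type u} [Field K] [Algebra k K]

/-- A root of unity in the residue field of a local ring is a scalar. -/
theorem exists_sub_algebraMap_mem_maxSet [IsAlgClosed k] {O : Subalgebra k K} {x : K} (hx : x ∈ O)
    {N : ℕ} (hN : 0 < N) (h : x ^ N - 1 ∈ maxSet O) :
    ∃ c : k, x - algebraMap k K c ∈ maxSet O := by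
  -- The maximal ideal is prime, so a product of differences `x - c` in it has a factor in it. This
  -- is applied to the factorization of `X ^ N - 1` over `k`.
  have key : ∀ m : Multiset k, (m.map fun c => x - algebraMap k K c).prod ∈ maxSet O →
      ∃ c : k, x - algebraMap k K c ∈ maxSet O := by
    intro m
    induction m using Multiset.induction_on with
    | empty =>
      intro h
      simp only [Multiset.map_zero, Multiset.prod_zero] at h
      exact absurd h (one_notMem_maxSet O)
    | cons a m ih =>
      intro h
      rw [Multiset.map_cons, Multiset.prod_cons] at h
      have hm : (m.map fun c => x - algebraMap k K c).prod ∈ O := by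
        refine Subalgebra.multiset_prod_mem _ fun y hy => ?_
        obtain ⟨c, -, rfl⟩ := Multiset.mem_map.1 hy
        exact O.sub_mem hx (O.algebraMap_mem c)
      rcases mem_maxSet_or_of_mul (O.sub_mem hx (O.algebraMap_mem a)) hm h with h1 | h1
      · exact ⟨a, h1⟩
      · exact ih h1
  have hs : (Polynomial.X ^ N - 1 : Polynomial k) =
      ((Polynomial.X ^ N - 1 : Polynomial k).roots.map fun a => Polynomial.X - Polynomial.C a).prod := by
    exact (IsAlgClosed.splits _).eq_prod_roots_of_monic (by
      simpa using Polynomial.monic_X_pow_sub_C (1 : k) hN.ne')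
  refine key (Polynomial.X ^ N - 1 : Polynomial k).roots ?_
  have h2 := congrArg (Polynomial.aeval x) hs
  rw [map_multiset_prod, Multiset.map_map] at h2
  simp only [map_sub, map_pow, Polynomial.aeval_X, map_one, Function.comp_def,
    Polynomial.aeval_C] at h2
  rw [← h2]
  exact h

end Roots

/-- A linear system `ψ : U → K` on a variety with function field `K`, with a group `G` acting
linearly on `U` and compatibly on `K`, and a finite collection of subspaces of `U` which is stable
under sums and under the action and contains the images of all `g - c`. -/
structure LinModel (k : Type u) [Field k] (K : Type u) [Field K] [Algebra k K] (U : Type w)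
    [AddCommGroup U] [Module k U] (G : Type v) [Group G] where
  ψ : U →ₗ[k] K
  ψ_inj : Function.Injective ψ
  ρ : G →* (U ≃ₗ[k] U)
  φ : G →* (K ≃ₐ[k] K)
  compat : ∀ g a b, φ g (ψ a / ψ b) = ψ (ρ g a) / ψ (ρ g b)
  arr : Set (Submodule k U)
  arr_finite : arr.Finite
  top_mem : ⊤ ∈ arr
  bot_notMem : ⊥ ∉ arr
  sup_mem : ∀ A ∈ arr, ∀ B ∈ arr, A ⊔ B ∈ arr
  map_mem : ∀ g, ∀ A ∈ arr, A.map (ρ g).toLinearMap ∈ arr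
  range_mem : ∀ g (c : k), LinearMap.range ((ρ g).toLinearMap - c • LinearMap.id) = ⊥ ∨
    LinearMap.range ((ρ g).toLinearMap - c • LinearMap.id) ∈ arr

namespace LinModel

variable {k : Type u} [Field k] {K : Type u} [Field K] [Algebra k K] {U : Type w}
  [AddCommGroup U] [Module k U] {G : Type v} [Group G] (D : LinModel k K U G)

theorem ψ_ne_zero {a : U} (ha : a ≠ 0) : D.ψ a ≠ 0 := fun h => ha (D.ψ_inj (by rw [h, map_zero]))

theorem ne_zero_of_ψ {a : U} (ha : D.ψ a ≠ 0) : a ≠ 0 := fun h => ha (by rw [h, map_zero])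

theorem ρ_mul_apply (g h : G) (a : U) : D.ρ (g * h) a = D.ρ g (D.ρ h a) := by
  rw [map_mul]; rfl

theorem ρ_one_apply (a : U) : D.ρ 1 a = a := by
  rw [map_one]; rfl

theorem ρ_inv_apply (g : G) (a : U) : D.ρ g (D.ρ g⁻¹ a) = a := by
  rw [← ρ_mul_apply, mul_inv_cancel, ρ_one_apply]

theorem ρ_inv_apply' (g : G) (a : U) : D.ρ g⁻¹ (D.ρ g a) = a := by
  rw [← ρ_mul_apply, inv_mul_cancel, ρ_one_apply]

/-- `O` is a point of the model defined by the linear system and the collection of subspaces, and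
the `s A` are forms in `A` that do not vanish at this point. -/
structure IsPoint (O : Subalgebra k K) (s : Submodule k U → U) : Prop where
  mem : ∀ A ∈ D.arr, s A ∈ A
  ne : ∀ A ∈ D.arr, s A ≠ 0
  div : ∀ A ∈ D.arr, ∀ a ∈ A, D.ψ a / D.ψ (s A) ∈ O
  loc : IsLocOf (Algebra.adjoin k {y | ∃ A ∈ D.arr, ∃ a ∈ A, y = D.ψ a / D.ψ (s A)}) O

theorem div_trans {O : Subalgebra k K} {a b c : U} (hb : b ≠ 0) (h : D.ψ a / D.ψ b ∈ O)
    (h' : D.ψ b / D.ψ c ∈ O) : D.ψ a / D.ψ c ∈ O := by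
  have := O.mul_mem h h'
  rwa [div_mul_div_cancel₀ (D.ψ_ne_zero hb)] at this

theorem div_trans_left {O : Subalgebra k K} {a b c : U} (hb : b ≠ 0)
    (h : D.ψ a / D.ψ b ∈ maxSet O) (h' : D.ψ b / D.ψ c ∈ O) : D.ψ a / D.ψ c ∈ maxSet O := by
  have := mul_mem_maxSet' h' h
  rwa [div_mul_div_cancel₀ (D.ψ_ne_zero hb)] at this

theorem div_trans_right {O : Subalgebra k K} {a b c : U} (hb : b ≠ 0)
    (h : D.ψ a / D.ψ b ∈ O) (h' : D.ψ b / D.ψ c ∈ maxSet O) : D.ψ a / D.ψ c ∈ maxSet O := by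
  have := mul_mem_maxSet h h'
  rwa [div_mul_div_cancel₀ (D.ψ_ne_zero hb)] at this

/-- The levels of a point: the largest subspaces of the collection with forms of a given order of
vanishing. -/
def levels (O : Subalgebra k K) (s : Submodule k U → U) : Set (Submodule k U) :=
  {l | l ∈ D.arr ∧ ∀ A ∈ D.arr, D.ψ (s A) / D.ψ (s l) ∈ O → A ≤ l}

namespace IsPoint

variable {D} {O : Subalgebra k K} {s : Submodule k U → U} (h : D.IsPoint O s)

include h

theorem isLocalRing : IsLocalRing O := h.loc.2.1

theorem ψne {A : Submodule k U} (hA : A ∈ D.arr) : D.ψ (s A) ≠ 0 := D.ψ_ne_zero (h.ne A hA)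

theorem div_of_le {A B : Submodule k U} (hA : A ∈ D.arr) (hB : B ∈ D.arr) (hAB : A ≤ B) :
    D.ψ (s A) / D.ψ (s B) ∈ O := h.div B hB _ (hAB (h.mem A hA))

/-- Write `s (A ⊔ B) = a + b` with `a` in `A` and `b` in `B`. The quotients of `a` and `b` by this
form have sum 1, so one of them is a unit of the local ring; that summand has the same order as `s
(A ⊔ B)` and is divisible by the form chosen in its own subspace. -/
theorem sup_div {A B : Submodule k U} (hA : A ∈ D.arr) (hB : B ∈ D.arr) :
    D.ψ (s (A ⊔ B)) / D.ψ (s A) ∈ O ∨ D.ψ (s (A ⊔ B)) / D.ψ (s B) ∈ O := by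
  have := h.isLocalRing
  have hC := D.sup_mem A hA B hB
  obtain ⟨a, ha, b, hb, hab⟩ := Submodule.mem_sup.1 (h.mem _ hC)
  have key : ∀ X ∈ D.arr, ∀ x ∈ X, D.ψ x / D.ψ (s (A ⊔ B)) ∈ O →
      D.ψ x / D.ψ (s (A ⊔ B)) ∉ maxSet O → D.ψ (s (A ⊔ B)) / D.ψ (s X) ∈ O := by
    intro X hX x hx hxO hxm
    obtain ⟨h0, h1⟩ := ne_zero_and_inv_mem_of_notMem_maxSet hxO hxm
    rw [inv_div] at h1
    exact D.div_trans (D.ne_zero_of_ψ fun h' => h0 (by rw [h', zero_div])) h1 (h.div X hX x hx)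
  have hsum : D.ψ a / D.ψ (s (A ⊔ B)) + D.ψ b / D.ψ (s (A ⊔ B)) = 1 := by
    rw [← add_div, ← map_add, hab, div_self (h.ψne hC)]
  have haO := h.div _ hC a (Submodule.mem_sup_left ha)
  have hbO := h.div _ hC b (Submodule.mem_sup_right hb)
  by_cases ham : D.ψ a / D.ψ (s (A ⊔ B)) ∈ maxSet O
  · right
    refine key B hB b hb hbO fun hbm => one_notMem_maxSet O ?_
    rw [← hsum]
    exact add_mem_maxSet ham hbm
  · exact Or.inl (key A hA a ha haO ham)

/-- Both forms are divisible by `s (A ⊔ B)`, which in turn is divisible by one of them. This is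
where stability under sums linearly orders the orders of vanishing. -/
theorem total {A B : Submodule k U} (hA : A ∈ D.arr) (hB : B ∈ D.arr) :
    D.ψ (s A) / D.ψ (s B) ∈ O ∨ D.ψ (s B) / D.ψ (s A) ∈ O := by
  have hC := D.sup_mem A hA B hB
  rcases h.sup_div hA hB with h1 | h1
  · exact Or.inr (D.div_trans (h.ne _ hC) (h.div_of_le hB hC le_sup_right) h1)
  · exact Or.inl (D.div_trans (h.ne _ hC) (h.div_of_le hA hC le_sup_left) h1)

/-- Take a maximal member above `A` whose chosen form is still divisible by `s A`. By `sup_div`,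
adding a subspace of at least this order preserves the condition, so the maximal member absorbs all
of them. -/
theorem exists_level {A : Submodule k U} (hA : A ∈ D.arr) : ∃ l ∈ D.levels O s, A ≤ l ∧
    D.ψ (s A) / D.ψ (s l) ∈ O ∧ D.ψ (s l) / D.ψ (s A) ∈ O := by
  let F : Set (Submodule k U) := {B | B ∈ D.arr ∧ D.ψ (s B) / D.ψ (s A) ∈ O}
  have hF : F.Finite := D.arr_finite.subset fun B hB => hB.1
  obtain ⟨l, hAl, hl⟩ := hF.exists_le_maximal (a := A)
    ⟨hA, by rw [div_self (h.ψne hA)]; exact O.one_mem⟩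
  refine ⟨l, ⟨hl.1.1, fun B hB hBl => ?_⟩, hAl, h.div_of_le hA hl.1.1 hAl, hl.1.2⟩
  have hC := D.sup_mem B hB l hl.1.1
  have h1 : D.ψ (s (B ⊔ l)) / D.ψ (s l) ∈ O :=
    (h.sup_div hB hl.1.1).elim (fun h' => D.div_trans (h.ne B hB) h' hBl) id
  exact le_sup_left.trans
    (hl.2 ⟨hC, D.div_trans (h.ne l hl.1.1) h1 hl.1.2⟩ le_sup_right)

theorem levels_total {l l' : Submodule k U} (hl : l ∈ D.levels O s) (hl' : l' ∈ D.levels O s) :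
    l ≤ l' ∨ l' ≤ l :=
  (h.total hl.1 hl'.1).imp (hl'.2 l hl.1) (hl.2 l' hl'.1)

omit h in
theorem top_mem_levels : ⊤ ∈ D.levels O s := ⟨D.top_mem, fun _ _ _ => le_top⟩

theorem div_mem_maxSet_of_lt {l l' : Submodule k U} (hl : l ∈ D.levels O s)
    (hl' : l' ∈ D.levels O s) (hlt : l < l') : D.ψ (s l) / D.ψ (s l') ∈ maxSet O := by
  refine ⟨h.div_of_le hl.1 hl'.1 hlt.le, Or.inr fun h' => ?_⟩
  rw [inv_div] at h'
  exact absurd (hl.2 l' hl'.1 h') (not_le_of_gt hlt)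

omit h in
theorem levels_finite : (D.levels O s).Finite := D.arr_finite.subset fun _ hl => hl.1

/-- A level `l` is the largest subspace all of whose forms vanish to higher order than those of
the next level `l'`. -/
theorem le_of_forall_mem_maxSet {l l' : Submodule k U}
    (hl' : l' ∈ D.levels O s) (hnext : ∀ m ∈ D.levels O s, m < l' → m ≤ l) {A : Submodule k U}
    (hA : A ∈ D.arr) (hAm : ∀ a ∈ A, D.ψ a / D.ψ (s l') ∈ maxSet O) : A ≤ l := by
  obtain ⟨m, hm, hAm', h1, h2⟩ := h.exists_level hA
  refine hAm'.trans (hnext m hm ?_)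
  have h3 := hAm _ (h.mem A hA)
  have hml : m ≤ l' := hl'.2 m hm.1 (D.div_trans (h.ne A hA) h2 h3.1)
  refine lt_of_le_of_ne hml ?_
  rintro rfl
  refine notMem_maxSet_of_inv_mem (div_ne_zero (h.ψne hA) (h.ψne hm.1)) ?_ h3
  rw [inv_div]
  exact h2

/-- Another choice of the nonvanishing forms. -/
theorem isUnit_div {A : Submodule k U} (hA : A ∈ D.arr) {a : U} (ha : a ∈ A)
    (ham : D.ψ a / D.ψ (s A) ∉ maxSet O) : a ≠ 0 ∧ D.ψ (s A) / D.ψ a ∈ O := by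
  obtain ⟨h0, h1⟩ := ne_zero_and_inv_mem_of_notMem_maxSet (h.div A hA a ha) ham
  rw [inv_div] at h1
  exact ⟨D.ne_zero_of_ψ fun h' => h0 (by rw [h', zero_div]), h1⟩

/-! #### The action of the stabilizer and of the generic stabilizer -/

/-- A form dividing all forms of a subspace is unique up to units of `O`, and an element of the
stabilizer transports such a form to one for the image subspace. -/
theorem map_s_div {g : G} (hg : O.map (D.φ g : K →ₐ[k] K) = O) {A : Submodule k U}
    (hA : A ∈ D.arr) : D.ψ (D.ρ g (s A)) / D.ψ (s (A.map (D.ρ g).toLinearMap)) ∈ O ∧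
      D.ψ (s (A.map (D.ρ g).toLinearMap)) / D.ψ (D.ρ g (s A)) ∈ O := by
  have hB := D.map_mem g A hA
  refine ⟨h.div _ hB _ ⟨_, h.mem A hA, rfl⟩, ?_⟩
  obtain ⟨a, ha, hab⟩ := h.mem _ hB
  rw [← hab]
  change D.ψ (D.ρ g a) / _ ∈ O
  rw [← D.compat]
  exact mem_of_map_eq hg (h.div A hA a ha)

theorem map_mem_levels {g : G} (hg : O.map (D.φ g : K →ₐ[k] K) = O) {l : Submodule k U}
    (hl : l ∈ D.levels O s) : l.map (D.ρ g).toLinearMap ∈ D.levels O s := by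
  refine ⟨D.map_mem g l hl.1, fun A hA hAl => ?_⟩
  have hA' := D.map_mem g⁻¹ A hA
  have key : A.map (D.ρ g⁻¹).toLinearMap ≤ l := by
    refine hl.2 _ hA' ?_
    have h1 := D.div_trans (h.ne _ (D.map_mem g l hl.1)) hAl (h.map_s_div hg hl.1).2
    have h2 := mem_of_map_eq (map_eq_inv hg) h1
    rw [D.compat, D.ρ_inv_apply'] at h2
    have hne : D.ρ g⁻¹ (s A) ≠ 0 := by simpa using h.ne A hA
    exact D.div_trans hne (h.map_s_div (map_eq_inv hg) hA).2 h2
  intro a ha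
  exact ⟨D.ρ g⁻¹ a, key ⟨a, ha, rfl⟩, D.ρ_inv_apply g a⟩

omit h in
theorem map_eq_of_le [FiniteDimensional k U] {g : G} {l : Submodule k U}
    (hle : l.map (D.ρ g).toLinearMap ≤ l) : l.map (D.ρ g).toLinearMap = l :=
  Submodule.eq_of_le_of_finrank_eq hle (LinearEquiv.finrank_map_eq _ _)

/-- The image of a level is again a level. Levels form a chain, and two members of a chain of equal
dimension coincide. -/
theorem map_level_eq [FiniteDimensional k U] {g : G} (hg : O.map (D.φ g : K →ₐ[k] K) = O)
    {l : Submodule k U} (hl : l ∈ D.levels O s) : l.map (D.ρ g).toLinearMap = l := by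
  have h1 : Module.finrank k (l.map (D.ρ g).toLinearMap) = Module.finrank k l :=
    LinearEquiv.finrank_map_eq _ _
  rcases h.levels_total (h.map_mem_levels hg hl) hl with h2 | h2
  · exact Submodule.eq_of_le_of_finrank_eq h2 h1
  · exact (Submodule.eq_of_le_of_finrank_eq h2 h1.symm).symm

end IsPoint

/-- An element of the generic stabilizer acts on forms by a scalar, up to forms vanishing to higher
order. -/
theorem exists_scalar [IsAlgClosed k] [Finite G] {O : Subalgebra k K} [IsLocalRing O] {g : G}
    (hg : g ∈ inertia D.φ O) {A : Submodule k U} (hgA : A.map (D.ρ g).toLinearMap = A) {t : U}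
    (ht : t ∈ A) (ht0 : t ≠ 0) (hA : ∀ a ∈ A, D.ψ a / D.ψ t ∈ O) :
    ∃ c : k, c ≠ 0 ∧ ∀ a ∈ A, D.ψ (D.ρ g a - c • a) / D.ψ t ∈ maxSet O := by
  rw [mem_inertia_iff] at hg
  have hψ := D.ψ_ne_zero ht0
  have hmem : ∀ a ∈ A, D.ρ g a ∈ A := fun a ha => by rw [← hgA]; exact ⟨a, ha, rfl⟩
  have hgt0 : D.ρ g t ≠ 0 := by simpa using ht0
  have hψg := D.ψ_ne_zero hgt0
  have huO : D.ψ (D.ρ g t) / D.ψ t ∈ O := hA _ (hmem t ht)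
  -- Let `u` be the quotient of `g t` by `t`. Since `g` is trivial on the residue field, `u ^ i` and
  -- the quotient of `g ^ i t` by `t` have the same residue. For `i` the order of the group this is
  -- 1, so the residue of `u` is a root of unity, hence a constant `c`.
  have hpow : ∀ i : ℕ, D.ρ (g ^ i) t ≠ 0 ∧ D.ρ (g ^ i) t ∈ A ∧
      (D.ψ (D.ρ g t) / D.ψ t) ^ i - D.ψ (D.ρ (g ^ i) t) / D.ψ t ∈ maxSet O := by
    intro i
    induction i with
    | zero =>
      rw [pow_zero, pow_zero, D.ρ_one_apply, div_self hψ, sub_self]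
      exact ⟨ht0, ht, zero_mem_maxSet O⟩
    | succ i ih =>
      obtain ⟨h1, h2, h3⟩ := ih
      rw [pow_succ' g, D.ρ_mul_apply]
      refine ⟨by simpa using h1, hmem _ h2, ?_⟩
      have h4 := hg.2 _ (hA _ h2)
      rw [D.compat] at h4
      have h5 : D.ψ (D.ρ g (D.ρ (g ^ i) t)) / D.ψ t =
          D.ψ (D.ρ g (D.ρ (g ^ i) t)) / D.ψ (D.ρ g t) * (D.ψ (D.ρ g t) / D.ψ t) := by
        rw [div_mul_div_cancel₀ hψg]
      rw [h5, pow_succ]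
      have h6 := mul_mem_maxSet' huO (sub_mem_maxSet h3 h4)
      convert h6 using 1
      ring
  obtain ⟨-, -, h1⟩ := hpow (Nat.card G)
  rw [pow_card_eq_one', D.ρ_one_apply, div_self hψ] at h1
  obtain ⟨c, hc⟩ := exists_sub_algebraMap_mem_maxSet huO Nat.card_pos h1
  have key : ∀ a ∈ A, D.ψ (D.ρ g a - c • a) / D.ψ t ∈ maxSet O := by
    intro a ha
    have h2 := hg.2 _ (hA a ha)
    rw [D.compat] at h2
    have h3 : D.ψ (D.ρ g a - c • a) / D.ψ t =
        (D.ψ (D.ρ g t) / D.ψ t) * (D.ψ (D.ρ g a) / D.ψ (D.ρ g t) - D.ψ a / D.ψ t) +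
        (D.ψ a / D.ψ t) * (D.ψ (D.ρ g t) / D.ψ t - algebraMap k K c) := by
      rw [map_sub, map_smul, Algebra.smul_def]
      field_simp
      ring
    rw [h3]
    exact add_mem_maxSet (mul_mem_maxSet huO h2) (mul_mem_maxSet (hA a ha) hc)
  refine ⟨c, ?_, key⟩
  -- With `c = 0` all forms of `g A = A`, among them `t`, would vanish to higher order than `t`.
  rintro rfl
  obtain ⟨a, ha, hat⟩ : t ∈ A.map (D.ρ g).toLinearMap := by rw [hgA]; exact ht
  have := key a ha
  rw [zero_smul, sub_zero] at this
  change D.ρ g a = t at hat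
  rw [hat, div_self hψ] at this
  exact one_notMem_maxSet O this

end LinModel

/-! ### Eigenvectors and bases adapted to flags -/

section Eigen

variable {k : Type u} [Field k] {U : Type w} [AddCommGroup U] [Module k U] {G : Type v} [Group G]

/-- Orthogonality of characters. -/
theorem sum_monoidHom_apply [IsAlgClosed k] [CharZero k] (S : Type*) [CommGroup S] [Finite S]
    [Fintype (S →* kˣ)] {h : S} (hh : h ≠ 1) : ∑ χ : S →* kˣ, ((χ h : kˣ) : k) = 0 := by
  have : NeZero (Monoid.exponent S) := ⟨Monoid.exponent_ne_zero_of_finite⟩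
  have : NeZero ((Monoid.exponent S : ℕ) : k) := ⟨by
    exact_mod_cast Monoid.exponent_ne_zero_of_finite⟩
  obtain ⟨χ₀, hχ⟩ := CommGroup.exists_apply_ne_one_of_hasEnoughRootsOfUnity S k hh
  have h1 : ((χ₀ h : kˣ) : k) * ∑ χ : S →* kˣ, ((χ h : kˣ) : k) =
      ∑ χ : S →* kˣ, ((χ h : kˣ) : k) := by
    rw [Finset.mul_sum]
    refine Fintype.sum_equiv (Equiv.mulLeft χ₀) _ _ fun χ => ?_
    simp
  have h2 : (((χ₀ h : kˣ) : k) - 1) * ∑ χ : S →* kˣ, ((χ h : kˣ) : k) = 0 := by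
    rw [sub_mul, h1, one_mul, sub_self]
  refine (mul_eq_zero.1 h2).resolve_left fun h3 => hχ ?_
  exact Units.ext (sub_eq_zero.1 h3)

/-- The common eigenvectors of `S` with characters. -/
def eigenvectors (ρ : G →* (U ≃ₗ[k] U)) (S : Subgroup G) : Set U :=
  {e | ∃ χ : S →* kˣ, ∀ g : S, ρ g e = (χ g : kˣ) • e}

/-- Averaging against the characters of the finite abelian group `S` gives eigenvectors inside the
stable subspace. By orthogonality of characters their sum is a nonzero multiple of the given vector.
-/
theorem le_span_eigenvectors [IsAlgClosed k] [CharZero k] [Finite G] (ρ : G →* (U ≃ₗ[k] U))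
    (S : Subgroup G) (hS : ∀ a ∈ S, ∀ b ∈ S, a * b = b * a) {A : Submodule k U}
    (hA : ∀ g ∈ S, ∀ a ∈ A, ρ g a ∈ A) : A ≤ Submodule.span k (eigenvectors ρ S ∩ A) := by
  let _ : CommGroup S :=
    { (inferInstance : Group S) with mul_comm := fun a b => Subtype.ext (hS a a.2 b b.2) }
  have : NeZero (Monoid.exponent S) := ⟨Monoid.exponent_ne_zero_of_finite⟩
  have : NeZero ((Monoid.exponent S : ℕ) : k) := ⟨by
    exact_mod_cast Monoid.exponent_ne_zero_of_finite⟩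
  have hfin : Finite (S →* kˣ) := by
    refine Nat.finite_of_card_ne_zero ?_
    rw [CommGroup.card_monoidHom_of_hasEnoughRootsOfUnity S k]
    exact Nat.card_pos.ne'
  have := Fintype.ofFinite (S →* kˣ)
  have := Fintype.ofFinite S
  intro a ha
  let e : (S →* kˣ) → U := fun χ => ∑ h : S, ((χ h⁻¹ : kˣ) : k) • ρ h a
  have he : ∀ χ, e χ ∈ eigenvectors ρ S ∩ A := by
    intro χ
    refine ⟨⟨χ, fun g => ?_⟩, sum_mem fun h _ => A.smul_mem _ (hA h h.2 a ha)⟩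
    simp only [e, map_sum, Finset.smul_sum]
    refine Fintype.sum_equiv (Equiv.mulLeft g) _ _ fun h => ?_
    rw [Equiv.coe_mulLeft, map_smul, Units.smul_def, smul_smul, ← Units.val_mul, ← map_mul,
      mul_inv_rev, mul_comm h⁻¹ g⁻¹, mul_inv_cancel_left, Subgroup.coe_mul, map_mul]
    rfl
  have hsum : ∑ χ, e χ = (Fintype.card (S →* kˣ) : k) • a := by
    simp only [e]
    rw [Finset.sum_comm, Finset.sum_eq_single 1]
    · simp [Nat.cast_smul_eq_nsmul]
    · intro h _ hh
      rw [← Finset.sum_smul, sum_monoidHom_apply S (inv_ne_one.2 hh), zero_smul]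
    · simp
  have hcard : (Fintype.card (S →* kˣ) : k) ≠ 0 := by
    exact_mod_cast Fintype.card_ne_zero
  rw [← inv_smul_smul₀ hcard a, ← hsum]
  exact Submodule.smul_mem _ _ (sum_mem fun χ _ => Submodule.subset_span (he χ))

/-- A basis adapted to a flag, consisting of vectors in a given set. -/
theorem exists_adapted_basis [FiniteDimensional k U] {T : Set (Submodule k U)} (hT : T.Finite)
    (hchain : ∀ l ∈ T, ∀ l' ∈ T, l ≤ l' ∨ l' ≤ l) (htop : ⊤ ∈ T) {E : Set U}
    (hE : ∀ l ∈ T, l ≤ Submodule.span k (E ∩ l)) :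
    ∃ b ⊆ E, LinearIndepOn k id b ∧ ∀ l ∈ T, l ≤ Submodule.span k (b ∩ l) := by
  have key : ∀ l : Submodule k U, l ∈ T → ∃ b ⊆ E ∩ l, LinearIndepOn k id b ∧
      ∀ m ∈ T, m ≤ l → m ≤ Submodule.span k (b ∩ m) := by
    intro l
    induction l using WellFoundedLT.induction with
    | ind l ih =>
      intro hl
      obtain ⟨b₀, hb₀E, hb₀, hb₀m⟩ : ∃ b ⊆ E ∩ l, LinearIndepOn k id b ∧
          ∀ m ∈ T, m < l → m ≤ Submodule.span k (b ∩ m) := by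
        -- The members below `l` have a largest one; a basis adapted to it serves all of them and
        -- only has to be extended to `l`.
        by_cases hne : {m | m ∈ T ∧ m < l}.Nonempty
        · obtain ⟨m, hm⟩ := (hT.subset fun m (hm : m ∈ {m | m ∈ T ∧ m < l}) => hm.1).exists_maximal hne
          obtain ⟨b, hbE, hb, hbm⟩ := ih m hm.1.2 hm.1.1
          refine ⟨b, fun x hx => ⟨(hbE hx).1, hm.1.2.le (hbE hx).2⟩, hb, fun m' hm' hlt => ?_⟩
          refine hbm m' hm' ?_
          exact (hchain m' hm' m hm.1.1).elim id fun h => hm.2 ⟨hm', hlt⟩ h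
        · refine ⟨∅, Set.empty_subset _, linearIndepOn_empty _ _, fun m hm hlt => ?_⟩
          exact absurd ⟨m, hm, hlt⟩ hne
      obtain ⟨b, hbE, hb₀b, hspan, hb⟩ := exists_linearIndepOn_id_extension hb₀ hb₀E
      refine ⟨b, hbE, hb, fun m hm hle => ?_⟩
      rcases hle.lt_or_eq with hlt | rfl
      · exact (hb₀m m hm hlt).trans (Submodule.span_mono (Set.inter_subset_inter_left _ hb₀b))
      · rw [Set.inter_eq_left.2 fun x hx => (hbE hx).2]
        exact (hE m hm).trans (Submodule.span_le.2 hspan)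
  obtain ⟨b, hbE, hb, h⟩ := key ⊤ htop
  exact ⟨b, fun x hx => (hbE hx).1, hb, fun l hl => h l hl le_top⟩

end Eigen

/-! ### Specialization of generic stabilizers and commutation with the stabilizer -/

namespace LinModel

variable {k : Type u} [Field k] {K : Type u} [Field K] [Algebra k K] {U : Type w}
  [AddCommGroup U] [Module k U] {G : Type v} [Group G] {D : LinModel k K U G}

theorem exists_next {T : Set (Submodule k U)} (hT : T.Finite)
    (hchain : ∀ l ∈ T, ∀ l' ∈ T, l ≤ l' ∨ l' ≤ l) (htop : ⊤ ∈ T) {l : Submodule k U}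
    (hl : l ∈ T) (hne : l ≠ ⊤) : ∃ l' ∈ T, l < l' ∧ ∀ m ∈ T, m < l' → m ≤ l := by
  obtain ⟨l', hl'⟩ := (hT.subset fun m (hm : m ∈ {m | m ∈ T ∧ l < m}) => hm.1).exists_minimal
    ⟨⊤, htop, lt_top_iff_ne_top.2 hne⟩
  refine ⟨l', hl'.1.1, hl'.1.2, fun m hm hlt => ?_⟩
  by_contra h
  have hlm : l < m := lt_of_le_not_ge ((hchain m hm l hl).resolve_left h) h
  exact absurd (hl'.2 ⟨hm, hlm⟩ hlt.le) (not_le_of_gt hlt)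

namespace IsPoint

variable {O : Subalgebra k K} {s : Submodule k U → U}

/-- Each member of the collection lies in a level whose chosen form differs from its own by a unit,
so only the levels contribute to the local ring. -/
theorem loc_levels (h : D.IsPoint O s) :
    IsLocOf (Algebra.adjoin k {y | ∃ l ∈ D.levels O s, ∃ a ∈ l, y = D.ψ a / D.ψ (s l)}) O := by
  refine h.loc.of_generators (Algebra.adjoin_le ?_) ?_
  · rintro _ ⟨l, hl, a, ha, rfl⟩
    exact h.div l hl.1 a ha
  · rintro _ ⟨A, hA, a, ha, rfl⟩
    obtain ⟨l, hl, hAl, h1, h2⟩ := h.exists_level hA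
    refine ⟨D.ψ a / D.ψ (s l), Algebra.subset_adjoin ⟨l, hl, a, hAl ha, rfl⟩,
      D.ψ (s A) / D.ψ (s l), Algebra.subset_adjoin ⟨l, hl, s A, hAl (h.mem A hA), rfl⟩,
      div_ne_zero (h.ψne hA) (h.ψne hl.1), by rwa [inv_div], ?_⟩
    rw [div_div_div_cancel_right₀ (h.ψne hl.1)]

/-- Generic stabilizers grow under specialization. -/
theorem inertia_anti [IsAlgClosed k] [Finite G] [FiniteDimensional k U] (h : D.IsPoint O s)
    {O' : Subalgebra k K} [IsLocalRing O'] (hle : O ≤ O') :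
    inertia D.φ O' ⊆ inertia D.φ O := by
  have hloc := h.isLocalRing
  -- A priori `g` does not preserve `O`, so the levels are treated by descending induction from `⊤`.
  -- On the next larger level `l'`, already stable, `g` is a constant up to forms of higher order at
  -- `O'`, hence also at `O`. So all forms of `g l` have higher order than `s l'`, and the
  -- maximality in the definition of levels puts `g l` inside `l`.
  have hstable : ∀ g ∈ inertia D.φ O', ∀ l ∈ D.levels O s, l.map (D.ρ g).toLinearMap = l := by
    intro g hg l
    induction l using WellFoundedGT.induction with
    | ind l ih =>
      intro hl
      by_cases hne : l = ⊤
      · rw [hne, Submodule.map_top, LinearEquiv.range]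
      obtain ⟨l', hl', hlt, hnext⟩ := exists_next levels_finite (fun _ h₁ _ h₂ => h.levels_total h₁ h₂)
        top_mem_levels hl hne
      have hgl' := ih l' hlt hl'
      obtain ⟨c, -, hc⟩ := D.exists_scalar hg hgl' (h.mem l' hl'.1) (h.ne l' hl'.1)
        fun a ha => hle (h.div l' hl'.1 a ha)
      refine map_eq_of_le (h.le_of_forall_mem_maxSet hl' hnext (D.map_mem g l hl.1) ?_)
      rintro _ ⟨a, ha, rfl⟩
      change D.ψ (D.ρ g a) / _ ∈ _
      have h1 : D.ψ (D.ρ g a - c • a) / D.ψ (s l') ∈ maxSet O := by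
        refine maxSet_inter_subset hle (h.div l' hl'.1 _ ?_) (hc a (hlt.le ha))
        refine l'.sub_mem ?_ (l'.smul_mem _ (hlt.le ha))
        rw [← hgl']
        exact ⟨a, hlt.le ha, rfl⟩
      have h2 : D.ψ a / D.ψ (s l') ∈ maxSet O := D.div_trans_right (h.ne l hl.1)
        (h.div l hl.1 a ha) (h.div_mem_maxSet_of_lt hl hl' hlt)
      have h3 := add_mem_maxSet h1 (smul_mem_maxSet c h2)
      convert h3 using 1
      rw [map_sub, map_smul, ← smul_div_assoc, ← add_div, sub_add_cancel]
  -- On a stable level `g` multiplies numerator and denominator of a generator by the same nonzero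
  -- constant up to higher order, so the constant cancels in the quotient.
  have hgen : ∀ g ∈ inertia D.φ O',
      ∀ x ∈ Algebra.adjoin k {y | ∃ l ∈ D.levels O s, ∃ a ∈ l, y = D.ψ a / D.ψ (s l)},
        D.φ g x ∈ O ∧ D.φ g x - x ∈ maxSet O := by
    intro g hg x hx
    induction hx using Algebra.adjoin_induction with
    | mem x hx =>
      obtain ⟨l, hl, a, ha, rfl⟩ := hx
      have hgl := hstable g hg l hl
      have hgmem : ∀ a ∈ l, D.ρ g a ∈ l := fun a ha => by rw [← hgl]; exact ⟨a, ha, rfl⟩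
      obtain ⟨c, hc0, hc⟩ := D.exists_scalar hg hgl (h.mem l hl.1) (h.ne l hl.1)
        fun a ha => hle (h.div l hl.1 a ha)
      have hc' : ∀ a ∈ l, D.ψ (D.ρ g a - c • a) / D.ψ (s l) ∈ maxSet O := fun a ha =>
        maxSet_inter_subset hle (h.div l hl.1 _ (l.sub_mem (hgmem a ha) (l.smul_mem _ ha)))
          (hc a ha)
      have hψ := h.ψne hl.1
      have hgs : D.ψ (D.ρ g (s l)) ≠ 0 :=
        D.ψ_ne_zero (by simpa using h.ne l hl.1)
      have hu : D.ψ (D.ρ g (s l)) / D.ψ (s l) ∉ maxSet O := by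
        intro hu
        have h1 := sub_mem_maxSet hu (hc' _ (h.mem l hl.1))
        rw [map_sub, ← sub_div, sub_sub_cancel, map_smul, smul_div_assoc, div_self hψ,
          Algebra.smul_def, mul_one, algebraMap_mem_maxSet_iff] at h1
        exact hc0 h1
      obtain ⟨-, hui⟩ := ne_zero_and_inv_mem_of_notMem_maxSet
        (h.div l hl.1 _ (hgmem _ (h.mem l hl.1))) hu
      rw [D.compat]
      have h2 : D.ψ (D.ρ g a) / D.ψ (D.ρ g (s l)) =
          D.ψ (D.ρ g a) / D.ψ (s l) * (D.ψ (D.ρ g (s l)) / D.ψ (s l))⁻¹ := by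
        field_simp
      refine ⟨?_, ?_⟩
      · rw [h2]
        exact O.mul_mem (h.div l hl.1 _ (hgmem a ha)) hui
      · have h3 : D.ψ (D.ρ g a) / D.ψ (D.ρ g (s l)) - D.ψ a / D.ψ (s l) =
            (D.ψ (D.ρ g (s l)) / D.ψ (s l))⁻¹ * (D.ψ (D.ρ g a - c • a) / D.ψ (s l) -
              D.ψ a / D.ψ (s l) * (D.ψ (D.ρ g (s l) - c • s l) / D.ψ (s l))) := by
          simp only [map_sub, map_smul, Algebra.smul_def]
          field_simp
          ring
        rw [h3]
        exact mul_mem_maxSet hui (sub_mem_maxSet (hc' a ha)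
          (mul_mem_maxSet (h.div l hl.1 a ha) (hc' _ (h.mem l hl.1))))
    | algebraMap r =>
      rw [AlgEquiv.commutes, sub_self]
      exact ⟨O.algebraMap_mem r, zero_mem_maxSet O⟩
    | add x y _ _ hx hy =>
      rw [map_add, add_sub_add_comm]
      exact ⟨O.add_mem hx.1 hy.1, add_mem_maxSet hx.2 hy.2⟩
    | mul x y hx' hy' hx hy =>
      rw [map_mul]
      refine ⟨O.mul_mem hx.1 hy.1, ?_⟩
      have : D.φ g x * D.φ g y - x * y = D.φ g x * (D.φ g y - y) + y * (D.φ g x - x) := by ring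
      rw [this]
      exact add_mem_maxSet (mul_mem_maxSet hx.1 hy.2)
        (mul_mem_maxSet (h.loc_levels.1 hy') hx.2)
  intro g hg
  exact mem_inertia_of_isLocOf h.loc_levels (hgen g hg)
    (hgen g⁻¹ ((inertiaGroup D.φ O').inv_mem hg))

/-- An element of the group that acts by the same scalar on forms of all orders is a scalar. -/
theorem ρ_eq_smul [IsAlgClosed k] [CharZero k] [Finite G] [FiniteDimensional k U]
    (h : D.IsPoint O s) {g : G} {c : k}
    (hc : ∀ l ∈ D.levels O s, ∀ a ∈ l, D.ψ (D.ρ g a - c • a) / D.ψ (s l) ∈ maxSet O) (a : U) :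
    D.ρ g a = c • a := by
  have hloc := h.isLocalRing
  rcases D.range_mem g c with h0 | hA
  · have h1 : (D.ρ g).toLinearMap a - c • a ∈ (⊥ : Submodule k U) := by
      rw [← h0]
      exact ⟨a, rfl⟩
    exact sub_eq_zero.1 ((Submodule.mem_bot k).1 h1)
  · exfalso
    set A := LinearMap.range ((D.ρ g).toLinearMap - c • LinearMap.id) with hAdef
    obtain ⟨l, hl, hAl, h1, h2⟩ := h.exists_level hA
    -- The cyclic group generated by `g` is finite and abelian, so `g` is diagonalizable on `U`.
    have hcomm : ∀ a ∈ Subgroup.zpowers g, ∀ b ∈ Subgroup.zpowers g, a * b = b * a := by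
      rintro _ ⟨i, rfl⟩ _ ⟨j, rfl⟩
      exact (Commute.refl g).zpow_zpow i j
    have htop := le_span_eigenvectors D.ρ (Subgroup.zpowers g) hcomm (A := ⊤)
      fun _ _ _ _ => trivial
    rw [Submodule.top_coe, Set.inter_univ] at htop
    -- An eigenvector with eigenvalue other than `c` lies in the image `A`, hence in the level `l`
    -- of `A`; only then does the hypothesis bound the order of `(g - c) e` relative to `s l`. So
    -- every form of `A` has higher order than `s l`, although `s A` has the same order.
    have hm : ∀ a ∈ A, D.ψ a / D.ψ (s l) ∈ maxSet O := by
      rintro _ ⟨a, rfl⟩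
      have ha := htop (Submodule.mem_top (x := a))
      induction ha using Submodule.span_induction with
      | mem e he =>
        obtain ⟨χ, hχ⟩ := he
        have h3 : D.ρ g e = (χ ⟨g, Subgroup.mem_zpowers g⟩ : kˣ) • e := hχ ⟨g, _⟩
        have h4 : ((D.ρ g).toLinearMap - c • LinearMap.id : U →ₗ[k] U) e =
            (((χ ⟨g, Subgroup.mem_zpowers g⟩ : kˣ) : k) - c) • e := by
          change D.ρ g e - c • e = _
          rw [h3, sub_smul]
          rfl
        by_cases h5 : ((χ ⟨g, Subgroup.mem_zpowers g⟩ : kˣ) : k) - c = 0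
        · rw [h4, h5, zero_smul, map_zero, zero_div]
          exact zero_mem_maxSet O
        · have heA : e ∈ A := by
            have : ((D.ρ g).toLinearMap - c • LinearMap.id : U →ₗ[k] U) e ∈ A := ⟨e, rfl⟩
            rw [h4] at this
            exact (Submodule.smul_mem_iff _ h5).1 this
          exact hc l hl e (hAl heA)
      | zero =>
        rw [map_zero, map_zero, zero_div]
        exact zero_mem_maxSet O
      | add x y _ _ hx hy =>
        rw [map_add, map_add, add_div]
        exact add_mem_maxSet hx hy
      | smul r x _ hx =>
        rw [map_smul, map_smul, smul_div_assoc]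
        exact smul_mem_maxSet r hx
    refine notMem_maxSet_of_inv_mem (div_ne_zero (h.ψne hA) (h.ψne hl.1)) ?_ (hm _ (h.mem A hA))
    rwa [inv_div]

/-- The stabilizer of a point centralizes its generic stabilizer. -/
theorem commute [IsAlgClosed k] [CharZero k] [Finite G] [FiniteDimensional k U]
    (hρ : Function.Injective D.ρ) (h : D.IsPoint O s) {q g : G} (hq : q ∈ stab D.φ O)
    (hg : g ∈ inertia D.φ O) : q * g = g * q := by
  have hloc := h.isLocalRing
  -- By `ρ_eq_smul` it suffices that the commutator is the identity on every level up to forms of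
  -- higher order.
  have hc : q * g * q⁻¹ * g⁻¹ = 1 := by
    apply hρ
    rw [map_one]
    ext x
    change D.ρ (q * g * q⁻¹ * g⁻¹) x = x
    rw [h.ρ_eq_smul (c := 1), one_smul]
    intro l hl x hx
    have hgO : g ∈ stab D.φ O := hg.1
    have hmem : ∀ q ∈ stab D.φ O, ∀ a ∈ l, D.ρ q a ∈ l := fun q hq a ha => by
      rw [← h.map_level_eq hq hl]
      exact ⟨a, ha, rfl⟩
    obtain ⟨c, -, hc⟩ := D.exists_scalar hg (h.map_level_eq hgO hl) (h.mem l hl.1)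
      (h.ne l hl.1) fun a ha => h.div l hl.1 a ha
    -- The conjugate acts with the same constant as `g`: `q` preserves the level and the order of
    -- vanishing, and it fixes constants.
    have h1 : ∀ x ∈ l, D.ψ (D.ρ (q * g * q⁻¹) x - c • x) / D.ψ (s l) ∈ maxSet O := by
      intro x hx
      have h2 := hc _ (hmem q⁻¹ ((stab D.φ O).inv_mem hq) x hx)
      have h3 := mem_maxSet_of_map_eq hq h2
      rw [D.compat, map_sub, map_smul, D.ρ_inv_apply] at h3
      rw [D.ρ_mul_apply, D.ρ_mul_apply]
      exact D.div_trans_left (by simpa using h.ne l hl.1) h3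
        (h.div l hl.1 _ (hmem q hq _ (h.mem l hl.1)))
    have hx' := hmem g⁻¹ ((stab D.φ O).inv_mem hgO) x hx
    have h4 := sub_mem_maxSet (h1 _ hx') (hc _ hx')
    rw [← sub_div, ← map_sub, sub_sub_sub_cancel_right, D.ρ_inv_apply] at h4
    rwa [one_smul, D.ρ_mul_apply]
  rw [mul_inv_eq_one, mul_inv_eq_iff_eq_mul] at hc
  exact hc

end IsPoint

end LinModel

namespace LinModel

/-! ### Coordinates at a point -/

variable {k : Type u} [Field k] {K : Type u} [Field K] [Algebra k K] {U : Type w}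
  [AddCommGroup U] [Module k U] {G : Type v} [Group G] {D : LinModel k K U G}

/-- The smallest member of a flag that contains a given vector. -/
def lev (T : Set (Submodule k U)) (e : U) : Submodule k U := sInf {l | l ∈ T ∧ e ∈ l}

/-- The next larger member of a flag. -/
def next (T : Set (Submodule k U)) (l : Submodule k U) : Submodule k U := sInf {m | m ∈ T ∧ l < m}

theorem sInf_mem_of_chain {T F : Set (Submodule k U)} (hT : T.Finite)
    (hchain : ∀ l ∈ T, ∀ l' ∈ T, l ≤ l' ∨ l' ≤ l) (hF : F ⊆ T) (hne : F.Nonempty) :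
    sInf F ∈ F := by
  obtain ⟨m, hm⟩ := (hT.subset hF).exists_minimal hne
  have : sInf F = m := le_antisymm (sInf_le hm.1) (le_sInf fun x hx =>
    (hchain x (hF hx) m (hF hm.1)).elim (fun h => hm.2 hx h) id)
  rw [this]
  exact hm.1

open scoped Classical in
/-- The denominator of the coordinate defined by the basis vector `e`. -/
def par (T : Set (Submodule k U)) (s : Submodule k U → U) (e : U) : U :=
  if e = s (lev T e) then s (next T (lev T e)) else s (lev T e)

/-- The coordinates defined by a basis adapted to the flag `T`. -/
def coordAt (D : LinModel k K U G) (T : Set (Submodule k U)) (s : Submodule k U → U) (b : Set U)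
    (e : ↥(b \ {s ⊤})) : K :=
  D.ψ e / D.ψ (par T s e)

namespace IsPoint

variable {O : Subalgebra k K} {s : Submodule k U → U}

theorem chain (h : D.IsPoint O s) : ∀ l ∈ D.levels O s, ∀ l' ∈ D.levels O s, l ≤ l' ∨ l' ≤ l :=
  fun _ h₁ _ h₂ => h.levels_total h₁ h₂

theorem lev_spec (h : D.IsPoint O s) (e : U) :
    lev (D.levels O s) e ∈ D.levels O s ∧ e ∈ lev (D.levels O s) e :=
  sInf_mem_of_chain (F := {l | l ∈ D.levels O s ∧ e ∈ l}) levels_finite h.chain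
    (fun _ hl => hl.1) ⟨⊤, top_mem_levels, trivial⟩

theorem lev_le {e : U} {l : Submodule k U} (hl : l ∈ D.levels O s) (he : e ∈ l) :
    lev (D.levels O s) e ≤ l := sInf_le ⟨hl, he⟩

theorem next_spec (h : D.IsPoint O s) {l : Submodule k U} (hne : l ≠ ⊤) :
    next (D.levels O s) l ∈ D.levels O s ∧ l < next (D.levels O s) l :=
  sInf_mem_of_chain (F := {m | m ∈ D.levels O s ∧ l < m}) levels_finite h.chain
    (fun _ hl => hl.1) ⟨⊤, top_mem_levels, lt_top_iff_ne_top.2 hne⟩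

theorem next_le {l m : Submodule k U} (hm : m ∈ D.levels O s) (hlt : l < m) :
    next (D.levels O s) l ≤ m := sInf_le ⟨hm, hlt⟩

theorem lev_eq_of_notMem_maxSet (h : D.IsPoint O s) {l : Submodule k U} (hl : l ∈ D.levels O s)
    {e : U} (he : e ∈ l) (hem : D.ψ e / D.ψ (s l) ∉ maxSet O) : lev (D.levels O s) e = l := by
  by_contra hne
  obtain ⟨h1, h2⟩ := h.lev_spec e
  exact hem (D.div_trans_right (h.ne _ h1.1) (h.div _ h1.1 e h2)
    (h.div_mem_maxSet_of_lt h1 hl (lt_of_le_of_ne (lev_le hl he) hne)))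

theorem lev_s (h : D.IsPoint O s) {l : Submodule k U} (hl : l ∈ D.levels O s) :
    lev (D.levels O s) (s l) = l :=
  h.lev_eq_of_notMem_maxSet hl (h.mem l hl.1)
    (by rw [div_self (h.ψne hl.1)]; exact one_notMem_maxSet O)

/-- Change of the nonvanishing forms. -/
theorem change (h : D.IsPoint O s) {s' : Submodule k U → U}
    (hs' : ∀ A ∈ D.arr, s' A ∈ A ∧ s' A ≠ 0 ∧ D.ψ (s A) / D.ψ (s' A) ∈ O) :
    D.IsPoint O s' ∧ D.levels O s' = D.levels O s := by
  have h2 : ∀ A ∈ D.arr, D.ψ (s' A) / D.ψ (s A) ∈ O := fun A hA => h.div A hA _ (hs' A hA).1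
  have h3 : ∀ A ∈ D.arr, ∀ a ∈ A, D.ψ a / D.ψ (s' A) ∈ O := fun A hA a ha =>
    D.div_trans (h.ne A hA) (h.div A hA a ha) (hs' A hA).2.2
  refine ⟨⟨fun A hA => (hs' A hA).1, fun A hA => (hs' A hA).2.1, h3, ?_⟩, ?_⟩
  · refine h.loc.of_generators (Algebra.adjoin_le ?_) ?_
    · rintro _ ⟨A, hA, a, ha, rfl⟩
      exact h3 A hA a ha
    · rintro _ ⟨A, hA, a, ha, rfl⟩
      have h4 := D.ψ_ne_zero (hs' A hA).2.1
      refine ⟨D.ψ a / D.ψ (s' A), Algebra.subset_adjoin ⟨A, hA, a, ha, rfl⟩,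
        D.ψ (s A) / D.ψ (s' A), Algebra.subset_adjoin ⟨A, hA, _, h.mem A hA, rfl⟩,
        div_ne_zero (h.ψne hA) h4, by rw [inv_div]; exact h2 A hA, ?_⟩
      rw [div_div_div_cancel_right₀ h4]
  · ext l
    refine and_congr_right fun hl => forall₂_congr fun A hA => imp_congr_left ⟨fun h5 => ?_,
      fun h5 => ?_⟩
    · exact D.div_trans (hs' A hA).2.1 (hs' A hA).2.2
        (D.div_trans (hs' l hl).2.1 h5 (h2 l hl))
    · exact D.div_trans (h.ne A hA) (h2 A hA) (D.div_trans (h.ne l hl) h5 (hs' l hl).2.2)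

theorem of_isLocOf (h : D.IsPoint O s) {O' : Subalgebra k K} (hO' : IsLocOf O O') :
    D.IsPoint O' s :=
  ⟨h.mem, h.ne, fun A hA a ha => hO'.1 (h.div A hA a ha), h.loc.trans hO'⟩

end IsPoint

/-- A basis `b` of common eigenvectors of `S`, adapted to the levels of a point and containing the
nonvanishing forms. -/
structure IsFrame (D : LinModel k K U G) (O : Subalgebra k K) (s : Submodule k U → U) (b : Set U)
    (S : Subgroup G) : Prop where
  point : D.IsPoint O s
  indep : LinearIndepOn k id b
  span : ∀ l ∈ D.levels O s, l ≤ Submodule.span k (b ∩ l)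
  s_mem : ∀ l ∈ D.levels O s, s l ∈ b
  eigen : b ⊆ eigenvectors D.ρ S

/-- The basis vectors in a level span it, so not all of them have higher order than its chosen form.
One of the lowest order can replace that form without changing the levels. -/
theorem IsPoint.exists_frame {O : Subalgebra k K} {s : Submodule k U → U} (h : D.IsPoint O s)
    {b : Set U} {S : Subgroup G} (hb : LinearIndepOn k id b)
    (hspan : ∀ l ∈ D.levels O s, l ≤ Submodule.span k (b ∩ l)) (he : b ⊆ eigenvectors D.ρ S) :
    ∃ s', D.IsFrame O s' b S ∧ D.levels O s' = D.levels O s := by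
  classical
  have hloc := h.isLocalRing
  have hex : ∀ l ∈ D.levels O s, ∃ e ∈ b ∩ l, D.ψ e / D.ψ (s l) ∉ maxSet O := by
    intro l hl
    by_contra! hall
    have hm : ∀ a ∈ Submodule.span k (b ∩ l), D.ψ a / D.ψ (s l) ∈ maxSet O := by
      intro a ha
      induction ha using Submodule.span_induction with
      | mem e he => exact hall e he
      | zero => rw [map_zero, zero_div]; exact zero_mem_maxSet O
      | add x y _ _ hx hy => rw [map_add, add_div]; exact add_mem_maxSet hx hy
      | smul r x _ hx => rw [map_smul, smul_div_assoc]; exact smul_mem_maxSet r hx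
    have := hm _ (hspan l hl (h.mem l hl.1))
    rw [div_self (h.ψne hl.1)] at this
    exact one_notMem_maxSet O this
  choose! r hr hrm using hex
  let s' : Submodule k U → U := fun A => if A ∈ D.levels O s then r A else s A
  have hs' : ∀ A ∈ D.arr, s' A ∈ A ∧ s' A ≠ 0 ∧ D.ψ (s A) / D.ψ (s' A) ∈ O := by
    intro A hA
    by_cases hAl : A ∈ D.levels O s
    · simp only [s', hAl, if_true]
      exact ⟨(hr A hAl).2, h.isUnit_div hA (hr A hAl).2 (hrm A hAl)⟩
    · simp only [s', hAl, if_false]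
      refine ⟨h.mem A hA, h.ne A hA, ?_⟩
      rw [div_self (h.ψne hA)]
      exact O.one_mem
  obtain ⟨h1, h2⟩ := h.change hs'
  refine ⟨s', ⟨h1, hb, by rwa [h2], fun l hl => ?_, he⟩, h2⟩
  rw [h2] at hl
  simp only [s', hl, if_true]
  exact (hr l hl).1

theorem IsPoint.exists_adapted [IsAlgClosed k] [CharZero k] [Finite G] [FiniteDimensional k U]
    {O : Subalgebra k K} {s : Submodule k U → U} (h : D.IsPoint O s) {S : Subgroup G}
    (hS : ∀ a ∈ S, ∀ b ∈ S, a * b = b * a) (hSO : S ≤ stab D.φ O) :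
    ∃ b, LinearIndepOn k id b ∧ (∀ l ∈ D.levels O s, l ≤ Submodule.span k (b ∩ l)) ∧
      b ⊆ eigenvectors D.ρ S := by
  obtain ⟨b, hbE, hb, hl⟩ := exists_adapted_basis (E := eigenvectors D.ρ S)
    (T := D.levels O s) IsPoint.levels_finite h.chain IsPoint.top_mem_levels
    fun l hl => le_span_eigenvectors D.ρ S hS fun g hg a ha => by
      rw [← h.map_level_eq (hSO hg) hl]
      exact ⟨a, ha, rfl⟩
  exact ⟨b, hb, hl, hbE⟩

namespace IsFrame

variable {O : Subalgebra k K} {s : Submodule k U → U} {b : Set U} {S : Subgroup G}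

theorem ne_zero (h : D.IsFrame O s b S) {e : U} (he : e ∈ b) : e ≠ 0 :=
  h.indep.ne_zero he

theorem par_spec (h : D.IsFrame O s b S) (e : ↥(b \ {s ⊤})) :
    ∃ l ∈ D.levels O s, par (D.levels O s) s e = s l ∧ (e : U) ∈ l := by
  obtain ⟨h1, h2⟩ := h.point.lev_spec e
  rw [par]
  split_ifs with he
  · have hne : lev (D.levels O s) (e : U) ≠ ⊤ := fun ht => e.2.2 (by rw [ht] at he; exact he)
    obtain ⟨h3, h4⟩ := h.point.next_spec hne
    exact ⟨_, h3, rfl, h4.le h2⟩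
  · exact ⟨_, h1, rfl, h2⟩

theorem coordAt_mem (h : D.IsFrame O s b S) (e : ↥(b \ {s ⊤})) :
    D.coordAt (D.levels O s) s b e ∈ O := by
  obtain ⟨l, hl, hp, he⟩ := h.par_spec e
  rw [coordAt, hp]
  exact h.point.div l hl.1 _ he

theorem s_ne_s_top (h : D.IsFrame O s b S) {l : Submodule k U} (hl : l ∈ D.levels O s)
    (hne : l ≠ ⊤) : s l ≠ s ⊤ := by
  intro h'
  have := h.point.lev_s hl
  rw [h', h.point.lev_s IsPoint.top_mem_levels] at this
  exact hne this.symm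

/-- Divided by itself, the chosen form of a level would give the useless coordinate 1, so it is
compared with the next level instead. The resulting coordinates vanish at the point. -/
theorem coordAt_s (h : D.IsFrame O s b S) {l : Submodule k U} (hl : l ∈ D.levels O s)
    (hne : l ≠ ⊤) : D.coordAt (D.levels O s) s b ⟨s l, h.s_mem l hl, h.s_ne_s_top hl hne⟩ =
      D.ψ (s l) / D.ψ (s (next (D.levels O s) l)) := by
  simp only [coordAt, par, h.point.lev_s hl, if_true]

theorem coordAt_s_mem_maxSet (h : D.IsFrame O s b S) {l : Submodule k U} (hl : l ∈ D.levels O s)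
    (hne : l ≠ ⊤) :
    D.coordAt (D.levels O s) s b ⟨s l, h.s_mem l hl, h.s_ne_s_top hl hne⟩ ∈ maxSet O := by
  rw [h.coordAt_s hl hne]
  obtain ⟨h3, h4⟩ := h.point.next_spec hne
  exact h.point.div_mem_maxSet_of_lt hl h3 h4

/-- The coordinate algebra of the frame. -/
abbrev coordAlg (D : LinModel k K U G) (O : Subalgebra k K) (s : Submodule k U → U) (b : Set U) :
    Subalgebra k K := Algebra.adjoin k (Set.range (D.coordAt (D.levels O s) s b))

/-- The quotient telescopes into a product of quotients of consecutive levels, which are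
coordinates. -/
theorem s_div_mem (h : D.IsFrame O s b S) [FiniteDimensional k U] {m l : Submodule k U}
    (hm : m ∈ D.levels O s) (hl : l ∈ D.levels O s) (hle : m ≤ l) :
    D.ψ (s m) / D.ψ (s l) ∈ coordAlg D O s b := by
  induction m using WellFoundedGT.induction with
  | ind m ih =>
    rcases hle.eq_or_lt with rfl | hlt
    · rw [div_self (h.point.ψne hm.1)]
      exact Subalgebra.one_mem _
    · have hne : m ≠ ⊤ := fun h' => absurd (h' ▸ hlt) not_top_lt
      obtain ⟨h3, h4⟩ := h.point.next_spec hne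
      have h5 := ih _ h4 h3 (IsPoint.next_le hl hlt)
      refine D.div_trans (h.point.ne _ h3.1) ?_ h5
      rw [← h.coordAt_s hm hne]
      exact Algebra.subset_adjoin ⟨_, rfl⟩

theorem basis_div_lev_mem (h : D.IsFrame O s b S) {e : U} (he : e ∈ b) :
    D.ψ e / D.ψ (s (lev (D.levels O s) e)) ∈ coordAlg D O s b := by
  by_cases hes : e = s (lev (D.levels O s) e)
  · rw [← hes, div_self (D.ψ_ne_zero (h.ne_zero he))]
    exact Subalgebra.one_mem _
  · have hne : e ≠ s ⊤ := by
      intro h'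
      apply hes
      rw [h', h.point.lev_s IsPoint.top_mem_levels]
    have : D.coordAt (D.levels O s) s b ⟨e, he, hne⟩ =
        D.ψ e / D.ψ (s (lev (D.levels O s) e)) := by
      simp only [coordAt, par, if_neg hes]
    rw [← this]
    exact Algebra.subset_adjoin ⟨_, rfl⟩

theorem div_mem_coordAlg (h : D.IsFrame O s b S) [FiniteDimensional k U] {l : Submodule k U}
    (hl : l ∈ D.levels O s) {a : U} (ha : a ∈ l) : D.ψ a / D.ψ (s l) ∈ coordAlg D O s b := by
  have ha' := h.span l hl ha
  induction ha' using Submodule.span_induction with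
  | mem e he =>
    exact D.div_trans (h.point.ne _ (h.point.lev_spec e).1.1) (h.basis_div_lev_mem he.1)
      (h.s_div_mem (h.point.lev_spec e).1 hl (IsPoint.lev_le hl he.2))
  | zero => rw [map_zero, zero_div]; exact Subalgebra.zero_mem _
  | add x y hx' hy' hx hy =>
    rw [map_add, add_div]
    exact Subalgebra.add_mem _
      (hx (Submodule.span_le.2 Set.inter_subset_right hx'))
      (hy (Submodule.span_le.2 Set.inter_subset_right hy'))
  | smul r x hx' hx =>
    rw [map_smul, smul_div_assoc]
    exact Subalgebra.smul_mem _ (hx (Submodule.span_le.2 Set.inter_subset_right hx')) r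

theorem isLocOf (h : D.IsFrame O s b S) [FiniteDimensional k U] : IsLocOf (coordAlg D O s b) O := by
  refine h.point.loc_levels.of_le (Algebra.adjoin_le ?_) (Algebra.adjoin_le ?_)
  · rintro _ ⟨l, hl, a, ha, rfl⟩
    exact h.div_mem_coordAlg hl ha
  · rintro _ ⟨e, rfl⟩
    exact h.coordAt_mem e

theorem finite (h : D.IsFrame O s b S) [FiniteDimensional k U] : b.Finite :=
  h.indep.finite

theorem adjoin_eq_top (h : D.IsFrame O s b S) [FiniteDimensional k U]
    (hgen : IntermediateField.adjoin k {y | ∃ a c, y = D.ψ a / D.ψ c} = ⊤) :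
    IntermediateField.adjoin k (Set.range (D.coordAt (D.levels O s) s b)) = ⊤ := by
  rw [eq_top_iff, ← hgen, IntermediateField.adjoin_le_iff]
  rintro _ ⟨a, c, rfl⟩
  have key : ∀ a, D.ψ a / D.ψ (s ⊤) ∈
      IntermediateField.adjoin k (Set.range (D.coordAt (D.levels O s) s b)) := fun a =>
    IntermediateField.algebra_adjoin_le_adjoin k _
      (h.div_mem_coordAlg IsPoint.top_mem_levels (Submodule.mem_top (x := a)))
  have := div_mem (key a) (key c)
  rwa [div_div_div_cancel_right₀ (h.point.ψne D.top_mem)] at this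

theorem card_add_one (h : D.IsFrame O s b S) [FiniteDimensional k U] :
    Nat.card ↥(b \ {s ⊤}) + 1 = Module.finrank k U := by
  have hspan : ⊤ ≤ Submodule.span k (Set.range (fun e : b => (e : U))) := by
    rw [Subtype.range_coe]
    exact (h.span ⊤ IsPoint.top_mem_levels).trans (Submodule.span_mono Set.inter_subset_left)
  let B := Module.Basis.mk (v := fun e : b => (e : U)) h.indep hspan
  have := h.finite.fintype
  rw [Module.finrank_eq_nat_card_basis B, Nat.card_coe_set_eq, Nat.card_coe_set_eq,
    Set.ncard_sdiff_singleton_add_one (h.s_mem ⊤ IsPoint.top_mem_levels) h.finite]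

/-- Removing `s ⊤`, which has no larger level to be compared with, leaves as many coordinates as the
transcendence degree; since they generate the field, they are independent. -/
theorem algebraicIndependent (h : D.IsFrame O s b S) [FiniteDimensional k U]
    (hgen : IntermediateField.adjoin k {y | ∃ a c, y = D.ψ a / D.ψ c} = ⊤)
    (hdim : Algebra.trdeg k K + 1 = (Module.finrank k U : Cardinal)) :
    AlgebraicIndependent k (D.coordAt (D.levels O s) s b) := by
  have := (h.finite.subset (Set.sdiff_subset (t := {s ⊤}))).fintype
  refine algebraicIndependent_of_adjoin_eq_top (h.adjoin_eq_top hgen) ?_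
  rw [← h.card_add_one, Nat.card_eq_fintype_card] at hdim
  push_cast at hdim
  exact (Cardinal.add_right_inj_of_lt_aleph0 (Cardinal.one_lt_aleph0)).1 hdim |>.ge

/-- The characters of `S` in the coordinates. -/
theorem exists_char (h : D.IsFrame O s b S) (e : ↥(b \ {s ⊤})) : ∃ χ : S →* kˣ, ∀ g : S,
    D.φ g (D.coordAt (D.levels O s) s b e) =
      ((χ g : kˣ) : k) • D.coordAt (D.levels O s) s b e := by
  obtain ⟨l, hl, hp, -⟩ := h.par_spec e
  obtain ⟨χ, hχ⟩ := h.eigen e.2.1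
  obtain ⟨χ', hχ'⟩ := h.eigen (h.s_mem l hl)
  refine ⟨χ / χ', fun g => ?_⟩
  rw [coordAt, hp, D.compat, hχ, hχ', Units.smul_def, Units.smul_def, map_smul, map_smul,
    MonoidHom.div_apply, Units.val_div_eq_div_val, Algebra.smul_def, Algebra.smul_def,
    Algebra.smul_def, map_div₀, mul_div_mul_comm]

end IsFrame

end LinModel

/-! ### Maximal strata -/

section Generization

variable {k : Type u} [Field k] {K : Type u} [Field K] [Algebra k K] {Q : Type v} [Group Q]

/-- If the generic stabilizer acts diagonally on coordinates at a point, then it is also contained in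
the generic stabilizer of the generization defined by the vanishing of the coordinates with
nontrivial characters. -/
theorem exists_isPolyLoc_generization {φ : Q →* (K ≃ₐ[k] K)} {O : Subalgebra k K} {τ : Type*}
    {x : τ → K} (hx : AlgebraicIndependent k x) (hO : IsLocOf (Algebra.adjoin k (Set.range x)) O)
    {S : Subgroup Q} (hS : (S : Set Q) = inertia φ O) {η : τ → S →* kˣ}
    (hη : ∀ v (g : S), φ g (x v) = ((η v g : kˣ) : k) • x v) :
    ∃ O', IsPolyLoc x {v | η v ≠ 1} O' ∧ IsLocOf O O' ∧ inertia φ O ⊆ inertia φ O' := by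
  have hloc := hO.2.1
  obtain ⟨O', hO'⟩ := exists_isPolyLoc hx {v | η v ≠ 1}
  have hloc' := hO'.1.2.1
  -- For `g` with nontrivial value of the character, `g x - x` is a nonzero multiple of `x`, and it
  -- lies in the maximal ideal because `g` is in the generic stabilizer.
  have hvar : ∀ v, η v ≠ 1 → x v ∈ maxSet O := by
    intro v hv
    obtain ⟨g, hg⟩ : ∃ g, η v g ≠ 1 := by
      by_contra! h
      exact hv (MonoidHom.ext h)
    have hgO : (g : Q) ∈ inertia φ O := by rw [← hS]; exact g.2
    rw [mem_inertia_iff] at hgO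
    have hxO : x v ∈ O := hO.1 (Algebra.subset_adjoin ⟨v, rfl⟩)
    have h1 := hgO.2 _ hxO
    have hc : ((η v g : kˣ) : k) - 1 ≠ 0 := fun h => hg (Units.ext (sub_eq_zero.1 h))
    have h2 : φ g (x v) - x v = (((η v g : kˣ) : k) - 1) • x v := by
      rw [hη, sub_smul, one_smul]
    rw [h2] at h1
    have := smul_mem_maxSet (((η v g : kˣ) : k) - 1)⁻¹ h1
    rwa [inv_smul_smul₀ hc] at this
  have hideal : ∀ f ∈ varIdeal k {v | η v ≠ 1}, MvPolynomial.aeval x f ∈ maxSet O := by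
    intro f hf
    induction hf using Submodule.span_induction with
    | mem f hf =>
      obtain ⟨v, hv, rfl⟩ := hf
      rw [MvPolynomial.aeval_X]
      exact hvar v hv
    | zero => rw [map_zero]; exact zero_mem_maxSet O
    | add f g _ _ hf hg => rw [map_add]; exact add_mem_maxSet hf hg
    | smul a f _ hf =>
      rw [smul_eq_mul, map_mul]
      exact mul_mem_maxSet (hO.1 (aeval_mem_adjoin x a)) hf
  -- The ideal defining `O'` consists of non-units of `O`, so a denominator invertible in `O` is
  -- also invertible in `O'`.
  have hle : O ≤ O' := by
    intro y hy
    obtain ⟨a, ha, c, hc, hc0, hci, rfl⟩ := hO.2.2 y hy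
    obtain ⟨f, rfl⟩ := exists_aeval_of_mem_adjoin hc
    have hf : MvPolynomial.aeval x f ∉ maxSet O' := fun h' =>
      notMem_maxSet_of_inv_mem hc0 hci (hideal f ((hO'.2 f).1 h'))
    rw [div_eq_mul_inv]
    exact O'.mul_mem (hO'.1.1 ha)
      (ne_zero_and_inv_mem_of_notMem_maxSet (hO'.1.1 hc) hf).2
  refine ⟨O', hO', hO'.1.of_le hO.1 hle, fun g hg => ?_⟩
  have key : ∀ g : S, ∀ a ∈ Algebra.adjoin k (Set.range x),
      φ g a ∈ O' ∧ φ g a - a ∈ maxSet O' := by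
    intro g a ha
    obtain ⟨f, rfl⟩ := exists_aeval_of_mem_adjoin ha
    let θ : MvPolynomial τ k →ₐ[k] MvPolynomial τ k :=
      MvPolynomial.aeval fun v => MvPolynomial.C ((η v g : kˣ) : k) * MvPolynomial.X v
    have h1 : φ g (MvPolynomial.aeval x f) = MvPolynomial.aeval x (θ f) := by
      have : ((φ g : K ≃ₐ[k] K) : K →ₐ[k] K).comp (MvPolynomial.aeval x) =
          (MvPolynomial.aeval x).comp θ := by
        ext v
        simp only [AlgHom.comp_apply, MvPolynomial.aeval_X, θ, map_mul, MvPolynomial.aeval_C]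
        rw [← Algebra.smul_def]
        exact hη v g
      exact DFunLike.congr_fun this f
    -- The diagonal substitution fixes the variables with trivial character, and the others are zero
    -- in the quotient; so it induces the identity there.
    have h2 : (Ideal.Quotient.mkₐ k (varIdeal k {v | η v ≠ 1})).comp θ =
        Ideal.Quotient.mkₐ k (varIdeal k {v | η v ≠ 1}) := by
      ext v
      simp only [AlgHom.comp_apply, MvPolynomial.aeval_X, θ]
      by_cases hv : η v = 1
      · rw [hv, MonoidHom.one_apply, Units.val_one, map_one, one_mul]
      · have h3 : (MvPolynomial.X v : MvPolynomial τ k) ∈ varIdeal k {v | η v ≠ 1} :=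
          Ideal.subset_span (Set.mem_image_of_mem _ hv)
        have h4 : Ideal.Quotient.mkₐ k (varIdeal k {v | η v ≠ 1}) (MvPolynomial.X v) = 0 :=
          Ideal.Quotient.eq_zero_iff_mem.2 h3
        rw [map_mul, h4, mul_zero]
    rw [h1]
    refine ⟨hO'.aeval_mem _, ?_⟩
    rw [← map_sub, hO'.2]
    exact (Ideal.Quotient.eq).1 (DFunLike.congr_fun h2 f)
  have hgS : g ∈ S := by rw [← SetLike.mem_coe, hS]; exact hg
  exact mem_inertia_of_isLocOf hO'.1 (key ⟨g, hgS⟩) (key ⟨g⁻¹, S.inv_mem hgS⟩)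

end Generization

namespace LinModel

variable {k : Type u} [Field k] {K : Type u} [Field K] [Algebra k K] {U : Type w}
  [AddCommGroup U] [Module k U] {G : Type v} [Group G] {D : LinModel k K U G}

/-- The model defined by the collection of subspaces. -/
def model (D : LinModel k K U G) : Set (Subalgebra k K) := {O | ∃ s, D.IsPoint O s}

/-- The coordinates of a frame on which `S` acts nontrivially. -/
def movedCoords (D : LinModel k K U G) (S : Subgroup G) {τ : Type*} (x : τ → K) : Set τ :=
  {v | ∃ g ∈ S, D.φ g (x v) ≠ x v}

variable [IsAlgClosed k] [Finite G] [FiniteDimensional k U]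

/-- The generization cut out by the moved coordinates has generic stabilizer at least that of `O`,
and at most that of `O` by `inertia_anti`. A maximal stratum admits no proper generization of this
kind. -/
theorem IsFrame.isPolyLoc {O : Subalgebra k K} {s : Submodule k U → U} {b : Set U}
    {S : Subgroup G} (h : D.IsFrame O s b S)
    (hgen : IntermediateField.adjoin k {y | ∃ a c, y = D.ψ a / D.ψ c} = ⊤)
    (hdim : Algebra.trdeg k K + 1 = (Module.finrank k U : Cardinal))
    (hO : O ∈ strata D.φ D.model) (hS : (S : Set G) = inertia D.φ O) :
    IsPolyLoc (D.coordAt (D.levels O s) s b)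
      (D.movedCoords S (D.coordAt (D.levels O s) s b)) O := by
  have hx := h.algebraicIndependent hgen hdim
  choose η hη using h.exists_char
  obtain ⟨O', hO', hloc, hin⟩ := exists_isPolyLoc_generization hx h.isLocOf hS hη
  have hset : {v | η v ≠ 1} = D.movedCoords S (D.coordAt (D.levels O s) s b) := by
    ext v
    have hv0 : D.coordAt (D.levels O s) s b v ≠ 0 := hx.ne_zero v
    constructor
    · intro hv
      obtain ⟨g, hg⟩ : ∃ g, η v g ≠ 1 := by
        by_contra! h'
        exact hv (MonoidHom.ext h')
      refine ⟨g, g.2, fun h' => hg ?_⟩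
      rw [hη] at h'
      have : (((η v g : kˣ) : k) - 1) • D.coordAt (D.levels O s) s b v = 0 := by
        rw [sub_smul, h', one_smul, sub_self]
      exact Units.ext (sub_eq_zero.1 ((smul_eq_zero.1 this).resolve_right hv0))
    · rintro ⟨g, hg, h'⟩ h1
      refine h' ?_
      rw [hη v ⟨g, hg⟩, h1, MonoidHom.one_apply, Units.val_one, one_smul]
  rw [hset] at hO'
  have heq : O = O' := by
    by_contra hne
    have hloc' := hloc.2.1
    exact hO.2 O' ⟨s, h.point.of_isLocOf hloc⟩ (lt_of_le_of_ne hloc.1 hne)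
      (Set.Subset.antisymm (h.point.inertia_anti hloc.1) hin)
  rw [heq] at hO' ⊢
  convert hO' using 0

-- The coordinates involve `s` only through its values on the flag. The index type of the
-- coordinates contains `s ⊤`, however, so agreement on the flag has to be transported along an
-- equality of types.
omit [IsAlgClosed k] [Finite G] [FiniteDimensional k U] in
theorem isPolyLoc_congr {T : Set (Submodule k U)} (hT : T.Finite)
    (hchain : ∀ l ∈ T, ∀ l' ∈ T, l ≤ l' ∨ l' ≤ l) (htop : ⊤ ∈ T) {s s' : Submodule k U → U}
    (hs : ∀ l ∈ T, s l = s' l) {b : Set U} {S : Subgroup G} {O : Subalgebra k K}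
    (h : IsPolyLoc (D.coordAt T s b) (D.movedCoords S (D.coordAt T s b)) O) :
    IsPolyLoc (D.coordAt T s' b) (D.movedCoords S (D.coordAt T s' b)) O := by
  have key : ∀ (o o' : U) (f f' : U → K), o = o' → (∀ e ∈ b \ {o}, f e = f' e) →
      IsPolyLoc (fun e : ↥(b \ {o}) => f e) (D.movedCoords S fun e : ↥(b \ {o}) => f e) O →
      IsPolyLoc (fun e : ↥(b \ {o'}) => f' e) (D.movedCoords S fun e : ↥(b \ {o'}) => f' e) O := by
    rintro o _ f f' rfl hf h
    have : (fun e : ↥(b \ {o}) => f e) = fun e : ↥(b \ {o}) => f' e := funext fun e => hf e e.2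
    rwa [this] at h
  refine key _ _ (fun e => D.ψ e / D.ψ (par T s e)) (fun e => D.ψ e / D.ψ (par T s' e))
    (hs ⊤ htop) (fun e he => ?_) h
  have h1 : lev T e ∈ T := (sInf_mem_of_chain (F := {l | l ∈ T ∧ e ∈ l}) hT hchain
    (fun _ hl => hl.1) ⟨⊤, htop, trivial⟩).1
  have : par T s e = par T s' e := by
    rw [par, par, ← hs _ h1]
    split_ifs with h2
    · have hne : lev T e ≠ ⊤ := fun h' => he.2 (by rw [h'] at h2; exact h2)
      have h3 : next T (lev T e) ∈ T := (sInf_mem_of_chain (F := {m | m ∈ T ∧ lev T e < m}) hT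
        hchain (fun _ hl => hl.1) ⟨⊤, htop, lt_top_iff_ne_top.2 hne⟩).1
      exact hs _ h3
    · rfl
  simp only [this]

theorem inertia_commute [CharZero k] (hρ : Function.Injective D.ρ) {O : Subalgebra k K}
    (hO : O ∈ D.model) {S : Subgroup G} (hS : (S : Set G) = inertia D.φ O) :
    (∀ a ∈ S, ∀ b ∈ S, a * b = b * a) ∧ S ≤ stab D.φ O := by
  obtain ⟨s, hs⟩ := hO
  have hmem : ∀ a ∈ S, a ∈ inertia D.φ O := fun a ha => by rw [← hS]; exact ha
  exact ⟨fun a ha b hb => hs.commute hρ (hmem a ha).1 (hmem b hb), fun a ha => (hmem a ha).1⟩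

/-- There are only finitely many maximal strata. -/
theorem strata_finite [CharZero k] (hρ : Function.Injective D.ρ)
    (hgen : IntermediateField.adjoin k {y | ∃ a c, y = D.ψ a / D.ψ c} = ⊤)
    (hdim : Algebra.trdeg k K + 1 = (Module.finrank k U : Cardinal)) :
    (strata D.φ D.model).Finite := by
  classical
  let ok : Set (Submodule k U) → Subgroup G → Set U → Prop := fun T S b =>
    LinearIndepOn k id b ∧ (∀ l ∈ T, l ≤ Submodule.span k (b ∩ l)) ∧ b ⊆ eigenvectors D.ρ S
  -- One eigenbasis is fixed for each flag and subgroup, independently of the stratum. Otherwise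
  -- there would be infinitely many bases to consider.
  let β : Set (Submodule k U) → Subgroup G → Set U := fun T S =>
    if h : ∃ b, ok T S b then h.choose else ∅
  have hβ : ∀ T S, (∃ b, ok T S b) → ok T S (β T S) := by
    intro T S h
    simp only [β, dif_pos h]
    exact h.choose_spec
  have hfin : ∀ T S, (β T S).Finite := by
    intro T S
    by_cases h : ∃ b, ok T S b
    · exact (hβ T S h).1.finite
    · simp only [β, dif_neg h]
      exact Set.finite_empty
  -- The value 0 off the flag is arbitrary, since the coordinates do not involve it.
  let ex : (T : Set (Submodule k U)) → (T → U) → Submodule k U → U := fun T s A =>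
    if h : A ∈ T then s ⟨A, h⟩ else 0
  -- For a given flag and subgroup there are finitely many choices of denominators in the fixed
  -- basis, and each choice admits at most one point.
  let C : Set (Submodule k U) → Subgroup G → Set (Subalgebra k K) := fun T S =>
    ⋃ s ∈ Set.pi Set.univ fun _ : T => β T S, {O | IsPolyLoc (D.coordAt T (ex T s) (β T S))
      (D.movedCoords S (D.coordAt T (ex T s) (β T S))) O}
  have hC : ∀ T ∈ D.arr.powerset, ∀ S, (C T S).Finite := by
    intro T hT S
    have : Finite T := (D.arr_finite.subset hT).to_subtype
    refine Set.Finite.biUnion (Set.Finite.pi fun _ => hfin T S) fun s _ => ?_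
    exact Set.Subsingleton.finite fun O hO O' hO' => IsPolyLoc.unique hO hO'
  refine (Set.Finite.biUnion D.arr_finite.powerset fun T hT =>
    Set.finite_iUnion fun S => hC T hT S).subset ?_
  intro O hO
  obtain ⟨s, hs⟩ := hO.1
  have hloc := hs.isLocalRing
  have hS : ((inertiaGroup D.φ O : Subgroup G) : Set G) = inertia D.φ O := rfl
  obtain ⟨hcomm, hle⟩ := inertia_commute hρ hO.1 hS
  have hok := hβ (D.levels O s) (inertiaGroup D.φ O) (hs.exists_adapted hcomm hle)
  obtain ⟨s', hf, hT⟩ := hs.exists_frame hok.1 hok.2.1 hok.2.2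
  simp only [Set.mem_iUnion]
  refine ⟨D.levels O s, fun l hl => hl.1, inertiaGroup D.φ O, ?_⟩
  refine Set.mem_iUnion₂.2 ⟨fun l => s' l, fun l _ => hf.s_mem l (by rw [hT]; exact l.2), ?_⟩
  have h1 := hf.isPolyLoc hgen hdim hO hS
  rw [hT] at h1
  refine isPolyLoc_congr IsPoint.levels_finite hs.chain IsPoint.top_mem_levels (fun l hl => ?_) h1
  simp only [ex, dif_pos hl]

end LinModel

/-! ### Function fields of products of projective spaces -/

section ProjFrame

variable {k : Type u} [Field k] {κ : Type u} [Field κ] [Algebra k κ]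

/-- The elements `y_{j,c}` of `κ` with `y_{j,0} = 1` are the affine coordinates on a product of
projective spaces with function field `κ`. -/
structure IsProjFrame (k : Type u) [Field k] {κ : Type u} [Field κ] [Algebra k κ] {m : ℕ}
    {d : Fin m → ℕ} (y : (Σ j : Fin m, Fin (d j + 1)) → κ) : Prop where
  zero : ∀ j, y ⟨j, 0⟩ = 1
  indep : AlgebraicIndependent k
    (fun a : {a : Σ j : Fin m, Fin (d j + 1) // a.2 ≠ 0} => y a.1)
  adjoin : IntermediateField.adjoin k (Set.range y) = ⊤

/-- The automorphism `f` acts by projectively linear transformations on each factor. -/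
def IsFrameAction {m : ℕ} {d : Fin m → ℕ} (y : (Σ j : Fin m, Fin (d j + 1)) → κ)
    (f : κ ≃ₐ[k] κ) : Prop :=
  ∀ j, ∃ w : κ, w ≠ 0 ∧ ∀ c, w * f (y ⟨j, c⟩) ∈ Submodule.span k (Set.range fun c => y ⟨j, c⟩)

/-- Numbering of the elements of a finite set with a map to a finite set and a section. -/
theorem exists_sigma_equiv {T B : Type*} [Finite T] [Finite B] (lev : B → T) (s : T → B)
    (hs : ∀ l, lev (s l) = l) : ∃ (m : ℕ) (d : Fin m → ℕ) (e : Fin m ≃ T)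
      (E : (Σ j : Fin m, Fin (d j + 1)) ≃ B), (∀ a, lev (E a) = e a.1) ∧
      ∀ j, E ⟨j, 0⟩ = s (e j) := by
  classical
  obtain ⟨m, ⟨e⟩⟩ := Finite.exists_equiv_fin T
  have hcard : ∀ j : Fin m, ∃ d : ℕ, Nonempty ({x : B // e (lev x) = j} ≃ Fin (d + 1)) := by
    intro j
    obtain ⟨r, ⟨E⟩⟩ := Finite.exists_equiv_fin {x : B // e (lev x) = j}
    cases r with
    | zero => exact (E ⟨s (e.symm j), by simp [hs]⟩).elim0
    | succ r => exact ⟨r, ⟨E⟩⟩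
  choose d hd using hcard
  let pt : ∀ j : Fin m, {x : B // e (lev x) = j} := fun j => ⟨s (e.symm j), by simp [hs]⟩
  -- The transposition gives the value of the section the number 0, the index of the denominator on
  -- each factor.
  let E : ∀ j : Fin m, {x : B // e (lev x) = j} ≃ Fin (d j + 1) := fun j =>
    (hd j).some.trans (Equiv.swap ((hd j).some (pt j)) 0)
  have hE : ∀ j, E j (pt j) = 0 := fun j => by simp [E]
  refine ⟨m, d, e.symm, (Equiv.sigmaCongrRight E).symm.trans (Equiv.sigmaFiberEquiv fun x => e (lev x)),
    ?_, ?_⟩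
  · rintro ⟨j, c⟩
    rw [Equiv.eq_symm_apply]
    exact ((E j).symm c).2
  · intro j
    have : (E j).symm 0 = pt j := by rw [Equiv.symm_apply_eq, hE]
    change (((E j).symm 0 : {x : B // e (lev x) = j}) : B) = _
    rw [this]

theorem exists_isProjFrame {T B : Type*} [Finite T] [Finite B] (lev : B → T) (s : T → B)
    (hs : ∀ l, lev (s l) = l) (y : B → κ) (h1 : ∀ l, y (s l) = 1)
    (h2 : AlgebraicIndependent k (fun e : {e : B // e ≠ s (lev e)} => y e))
    (h3 : IntermediateField.adjoin k (Set.range y) = ⊤) :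
    ∃ (m : ℕ) (d : Fin m → ℕ) (z : (Σ j : Fin m, Fin (d j + 1)) → κ), IsProjFrame k z ∧
      ∀ f : κ ≃ₐ[k] κ, (∀ l, ∃ w : κ, w ≠ 0 ∧ ∀ e, lev e = l →
        w * f (y e) ∈ Submodule.span k (y '' {e | lev e = l})) → IsFrameAction z f := by
  obtain ⟨m, d, e, E, hE, hE0⟩ := exists_sigma_equiv lev s hs
  refine ⟨m, d, y ∘ E, ⟨fun j => ?_, ?_, ?_⟩, fun f hf j => ?_⟩
  · rw [Function.comp_apply, hE0, h1]
  · have hne : ∀ a : {a : Σ j : Fin m, Fin (d j + 1) // a.2 ≠ 0}, E a.1 ≠ s (lev (E a.1)) := by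
      rintro ⟨⟨j, c⟩, hc⟩ h
      rw [hE, ← hE0] at h
      have := E.injective h
      simp only [Sigma.mk.injEq, heq_eq_eq, true_and] at this
      exact hc this
    have := h2.comp (fun a : {a : Σ j : Fin m, Fin (d j + 1) // a.2 ≠ 0} =>
      (⟨E a.1, hne a⟩ : {e : B // e ≠ s (lev e)})) fun a b hab =>
        Subtype.ext (E.injective (congrArg (fun x : {e : B // e ≠ s (lev e)} => (x : B)) hab))
    exact this
  · rw [E.surjective.range_comp]
    exact h3
  · obtain ⟨w, hw, h⟩ := hf (e j)
    refine ⟨w, hw, fun c => ?_⟩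
    refine Submodule.span_mono ?_ (h (E ⟨j, c⟩) (hE _))
    rintro _ ⟨b, hb, rfl⟩
    obtain ⟨⟨j', c'⟩, rfl⟩ := E.surjective b
    have : j' = j := e.injective (by rw [← hb, hE])
    subst this
    exact ⟨c', rfl⟩

end ProjFrame

/-! ### Residue fields of maximal strata -/

namespace LinModel

variable {k : Type u} [Field k] {K : Type u} [Field K] [Algebra k K] {U : Type w}
  [AddCommGroup U] [Module k U] {G : Type v} [Group G] {D : LinModel k K U G}

/-- The residue field of a maximal stratum is the function field of a product of projective
spaces. -/
theorem IsFrame.exists_isProjFrame [FiniteDimensional k U]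
    {O : Subalgebra k K} {s : Submodule k U → U} {b : Set U}
    {S : Subgroup G} (h : D.IsFrame O s b S) {P : Set ↥(b \ {s ⊤})}
    (hP : IsPolyLoc (D.coordAt (D.levels O s) s b) P O) {κ : Type u} [Field κ] [Algebra k κ]
    {π : O →ₐ[k] κ} (hπ : Function.Surjective π) :
    ∃ (m : ℕ) (d : Fin m → ℕ) (y : (Σ j : Fin m, Fin (d j + 1)) → κ), IsProjFrame k y ∧
      ∀ (f : κ ≃ₐ[k] κ), (∃ z ∈ stab D.φ O, ∀ x y : O, (y : K) = D.φ z x → π y = f (π x)) →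
        IsFrameAction y f := by
  have hloc := h.point.isLocalRing
  let T := D.levels O s
  -- These basis vectors have exactly the order of their level and become the homogeneous
  -- coordinates; the others, divided by the chosen form of their level, have residue zero.
  let B : Set U := {e | e ∈ b ∧ D.ψ e / D.ψ (s (lev T e)) ∉ maxSet O}
  have hTfin : Finite T := IsPoint.levels_finite.to_subtype
  have hBfin : Finite B := (h.finite.subset fun e he => he.1).to_subtype
  have hdiv : ∀ e : U, D.ψ e / D.ψ (s (lev T e)) ∈ O := fun e =>
    h.point.div _ (h.point.lev_spec e).1.1 e (h.point.lev_spec e).2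
  have hlevs : ∀ l : T, lev T (s l) = l := fun l => h.point.lev_s l.2
  let sB : T → B := fun l => ⟨s l, h.s_mem l l.2, by
    rw [hlevs, div_self (h.point.ψne l.2.1)]
    exact one_notMem_maxSet O⟩
  let levB : B → T := fun e => ⟨lev T e, (h.point.lev_spec e).1⟩
  let y : B → κ := fun e => π ⟨D.ψ e / D.ψ (s (lev T e)), hdiv e⟩
  have hcoord : ∀ (e : U) (he : e ∈ b) (hne : e ≠ s (lev T e)), ∃ hne' : e ≠ s ⊤,
      D.coordAt T s b ⟨e, he, hne'⟩ = D.ψ e / D.ψ (s (lev T e)) := by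
    intro e he hne
    refine ⟨fun h' => hne ?_, ?_⟩
    · rw [h']
      exact congrArg s (h.point.lev_s IsPoint.top_mem_levels).symm
    · simp only [coordAt, par, if_neg hne]
  have hy1 : ∀ l, y (sB l) = 1 := by
    intro l
    have : (⟨D.ψ (s l) / D.ψ (s (lev T (s l))), hdiv (s l)⟩ : O) = 1 := by
      apply Subtype.ext
      change D.ψ (s l) / D.ψ (s (lev T (s l))) = 1
      rw [hlevs, div_self (h.point.ψne l.2.1)]
    change π _ = 1
    rw [this, map_one]
  have hy2 : AlgebraicIndependent k (fun e : {e : B // e ≠ sB (levB e)} => y e) := by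
    have hmap : ∀ e : {e : B // e ≠ sB (levB e)}, ∃ v : ↥Pᶜ, ((v : ↥(b \ {s ⊤})) : U) = e.1 ∧
        π ⟨D.coordAt T s b v, hP.var_mem v⟩ = y e.1 := by
      rintro ⟨e, he⟩
      obtain ⟨hne, hc⟩ := hcoord e e.2.1 fun h' => he (Subtype.ext h')
      refine ⟨⟨⟨e, e.2.1, hne⟩, fun hvP => e.2.2 ?_⟩, rfl, ?_⟩
      · rw [← hc]
        exact (hP.var_mem_maxSet_iff _).2 hvP
      · simp only [hc, y]
    choose v hv hv' using hmap
    have := (hP.residue_algebraicIndependent hπ).comp v fun e e' hee => by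
      apply Subtype.ext
      apply Subtype.ext
      rw [← hv e, ← hv e', hee]
    convert this using 1
    funext e
    exact (hv' e).symm
  -- A coordinate outside `P` does not vanish at the point, so it is not a quotient of the chosen
  -- forms of consecutive levels and comes from an element of `B`.
  have hy3 : IntermediateField.adjoin k (Set.range y) = ⊤ := by
    rw [eq_top_iff, ← hP.residue_adjoin_eq_top hπ]
    apply IntermediateField.adjoin.mono
    rintro _ ⟨v, rfl⟩
    have hvm : D.coordAt T s b v ∉ maxSet O := fun h' => v.2 ((hP.var_mem_maxSet_iff _).1 h')
    have hne : ((v : ↥(b \ {s ⊤})) : U) ≠ s (lev T (v : ↥(b \ {s ⊤}))) := by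
      intro h'
      have hl := (h.point.lev_spec (v : ↥(b \ {s ⊤})).1).1
      have hlne : lev T ((v : ↥(b \ {s ⊤})) : U) ≠ ⊤ := fun ht => v.1.2.2 (by
        rw [ht] at h'
        exact h')
      refine hvm ?_
      convert h.coordAt_s_mem_maxSet hl hlne using 2
      exact Subtype.ext h'
    obtain ⟨hne', hc⟩ := hcoord _ v.1.2.1 hne
    change D.coordAt T s b v.1 = _ at hc
    refine ⟨⟨v.1, v.1.2.1, by rw [← hc]; exact hvm⟩, ?_⟩
    simp only [y, ← hc]
    rfl
  obtain ⟨m, d, z, hz, hact⟩ := Burnside.exists_isProjFrame (k := k) levB sB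
    (fun l => Subtype.ext (hlevs l)) y hy1 hy2 hy3
  refine ⟨m, d, z, hz, fun f hf => hact f ?_⟩
  obtain ⟨q, hq, hf⟩ := hf
  intro l
  have hmem : ∀ q ∈ stab D.φ O, ∀ a ∈ (l : Submodule k U), D.ρ q a ∈ (l : Submodule k U) := by
    intro q hq a ha
    rw [← h.point.map_level_eq hq l.2]
    exact ⟨a, ha, rfl⟩
  have hdivl : ∀ a ∈ (l : Submodule k U), D.ψ a / D.ψ (s l) ∈ O := h.point.div l l.2.1
  have hspan : ∀ a (ha : a ∈ (l : Submodule k U)), π ⟨D.ψ a / D.ψ (s l), hdivl a ha⟩ ∈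
      Submodule.span k (y '' {e | levB e = l}) := by
    intro a ha
    have ha' := h.span l l.2 ha
    induction ha' using Submodule.span_induction with
    | mem e he =>
      by_cases hem : D.ψ e / D.ψ (s l) ∈ maxSet O
      · rw [(ker_eq_maxSet hπ ⟨_, hdivl e ha⟩).2 hem]
        exact zero_mem _
      · have hle : lev T e = l := h.point.lev_eq_of_notMem_maxSet l.2 he.2 hem
        refine Submodule.subset_span ⟨⟨e, he.1, by rw [hle]; exact hem⟩, Subtype.ext hle, ?_⟩
        simp only [y, hle]
    | zero =>
      have : (⟨D.ψ 0 / D.ψ (s l), hdivl 0 ha⟩ : O) = 0 := Subtype.ext (by simp)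
      rw [this, map_zero]
      exact zero_mem _
    | add x y hx' hy' hx hy =>
      have hxl := Submodule.span_le.2 Set.inter_subset_right hx'
      have hyl := Submodule.span_le.2 Set.inter_subset_right hy'
      have : (⟨D.ψ (x + y) / D.ψ (s l), hdivl _ ha⟩ : O) =
          ⟨D.ψ x / D.ψ (s l), hdivl x hxl⟩ + ⟨D.ψ y / D.ψ (s l), hdivl y hyl⟩ :=
        Subtype.ext (by simp [add_div])
      rw [this, map_add]
      exact add_mem (hx hxl) (hy hyl)
    | smul r x hx' hx =>
      have hxl := Submodule.span_le.2 Set.inter_subset_right hx'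
      have : (⟨D.ψ (r • x) / D.ψ (s l), hdivl _ ha⟩ : O) =
          r • ⟨D.ψ x / D.ψ (s l), hdivl x hxl⟩ :=
        Subtype.ext (by simp [smul_div_assoc])
      rw [this, map_smul]
      exact Submodule.smul_mem _ _ (hx hxl)
  have hsl := h.point.mem l l.2.1
  have hqs0 : D.ρ q (s l) ≠ 0 := by simpa using h.point.ne l l.2.1
  have hψs := h.point.ψne l.2.1
  have hψqs := D.ψ_ne_zero hqs0
  -- This multiplier restores the denominator `s l` after `q` has replaced it by `q (s l)`. It is a
  -- unit because its inverse is the image under `q` of the quotient of `q⁻¹ (s l)` by `s l`, which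
  -- is in `O`.
  refine ⟨π ⟨D.ψ (D.ρ q (s l)) / D.ψ (s l), hdivl _ (hmem q hq _ hsl)⟩, fun h0 => ?_, ?_⟩
  · rw [ker_eq_maxSet hπ] at h0
    refine notMem_maxSet_of_inv_mem (div_ne_zero hψqs hψs) ?_ h0
    rw [inv_div]
    have := mem_of_map_eq hq (hdivl _ (hmem q⁻¹ ((stab D.φ O).inv_mem hq) _ hsl))
    rwa [D.compat, D.ρ_inv_apply] at this
  · intro e he
    have hle : lev T e = l := congrArg Subtype.val he
    have hel : (e : U) ∈ (l : Submodule k U) := by rw [← hle]; exact (h.point.lev_spec e).2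
    have hye : y e = π ⟨D.ψ e / D.ψ (s l), hdivl e hel⟩ := by simp only [y, hle]
    have h1 : D.ψ (D.ρ q e) / D.ψ (D.ρ q (s l)) ∈ O := by
      rw [← D.compat]
      exact mem_of_map_eq hq (hdivl e hel)
    rw [hye, ← hf ⟨_, hdivl e hel⟩ ⟨_, h1⟩ (D.compat _ _ _).symm, ← map_mul]
    convert hspan (D.ρ q e) (hmem q hq _ hel) using 2
    apply Subtype.ext
    change D.ψ (D.ρ q (s l)) / D.ψ (s l) * (D.ψ (D.ρ q e) / D.ψ (D.ρ q (s l))) = _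
    field_simp

end LinModel

/-! ### Isomorphism with the function field of a product of projective spaces -/

section Coord

variable {k : Type u} [Field k]

theorem algebraicIndependent_coord {σ : Type} : AlgebraicIndependent k (coord k : σ → RatField k σ) :=
  (MvPolynomial.algebraicIndependent_X σ k).map'
    (f := Algebra.algHom k (MvPolynomial σ k) (RatField k σ))
    (FaithfulSMul.algebraMap_injective (MvPolynomial σ k) (RatField k σ))

theorem coord_ne_zero {σ : Type} (a : σ) : coord k a ≠ 0 := algebraicIndependent_coord.ne_zero a

theorem coord_div_mul {σ : Type} (a b : σ) : coord k a / coord k b * coord k b = coord k a :=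
  div_mul_cancel₀ _ (coord_ne_zero b)

theorem adjoin_coord {σ : Type} : IntermediateField.adjoin k (Set.range (coord k : σ → RatField k σ)) = ⊤ := by
  have hA : ∀ f : MvPolynomial σ k, algebraMap _ (RatField k σ) f ∈
      IntermediateField.adjoin k (Set.range (coord k : σ → RatField k σ)) := by
    intro f
    induction f using MvPolynomial.induction_on with
    | C c => exact IntermediateField.algebraMap_mem _ c
    | add f g hf hg => rw [map_add]; exact add_mem hf hg
    | mul_X f a hf =>
      rw [map_mul]
      exact mul_mem hf (IntermediateField.subset_adjoin _ _ ⟨a, rfl⟩)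
  rw [eq_top_iff]
  intro x _
  obtain ⟨a, b, -, rfl⟩ := IsFractionRing.div_surjective (A := MvPolynomial σ k) x
  exact div_mem (hA a) (hA b)

theorem trdeg_ratField {σ : Type} [Fintype σ] : Algebra.trdeg k (RatField k σ) = Fintype.card σ :=
  trdeg_eq_of_algebraicIndependent algebraicIndependent_coord adjoin_coord

theorem algHom_ext_of_adjoin_eq_top {K L : Type*} [Field K] [Algebra k K] [Field L] [Algebra k L]
    {s : Set K} (hs : IntermediateField.adjoin k s = ⊤) {f g : K →ₐ[k] L}
    (h : ∀ x ∈ s, f x = g x) : f = g := by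
  ext x
  have hx : x ∈ IntermediateField.adjoin k s := hs ▸ trivial
  induction hx using IntermediateField.adjoin_induction with
  | mem x hx => exact h x hx
  | algebraMap c => rw [AlgHom.commutes, AlgHom.commutes]
  | add x y _ _ hx hy => rw [map_add, map_add, hx, hy]
  | inv x _ hx => rw [map_inv₀, map_inv₀, hx]
  | mul x y _ _ hx hy => rw [map_mul, map_mul, hx, hy]

theorem exists_algEquiv_adjoin {K L : Type*} [Field K] [Algebra k K] [Field L] [Algebra k L]
    {ι : Type*} {x : ι → K} (hx : AlgebraicIndependent k x)
    (hgen : IntermediateField.adjoin k (Set.range x) = ⊤) {y : ι → L}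
    (hy : AlgebraicIndependent k y) :
    ∃ e : K ≃ₐ[k] IntermediateField.adjoin k (Set.range y), ∀ i, (e (x i) : L) = y i := by
  let e₀ : K ≃ₐ[k] IntermediateField.adjoin k (Set.range x) :=
    IntermediateField.topEquiv.symm.trans (IntermediateField.equivOfEq hgen.symm)
  refine ⟨(e₀.trans hx.aevalEquivField.symm).trans hy.aevalEquivField, fun i => ?_⟩
  have h1 : hx.aevalEquivField (algebraMap (MvPolynomial ι k) _ (MvPolynomial.X i)) = e₀ (x i) := by
    apply Subtype.ext
    rw [hx.aevalEquivField_algebraMap_apply_coe, MvPolynomial.aeval_X]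
    rfl
  rw [AlgEquiv.trans_apply, AlgEquiv.trans_apply, ← h1, AlgEquiv.symm_apply_apply,
    hy.aevalEquivField_algebraMap_apply_coe, MvPolynomial.aeval_X]

end Coord

section ProjLinear

variable {k : Type u} [Field k] {m : ℕ} {d : Fin m → ℕ}

/-- The affine coordinates on a product of projective spaces. -/
def affCoord (k : Type u) [Field k] {m : ℕ} {d : Fin m → ℕ} (a : Σ j : Fin m, Fin (d j + 1)) :
    RatField k (Σ j : Fin m, Fin (d j + 1)) := coord k a / coord k ⟨a.1, 0⟩

theorem algebraicIndependent_affCoord : AlgebraicIndependent k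
    (fun a : {a : Σ j : Fin m, Fin (d j + 1) // a.2 ≠ 0} => affCoord k a.1) := by
  -- With the denominators put back there are as many generators of the full field as variables, so
  -- independence follows by counting.
  let z : (Σ j : Fin m, Fin (d j + 1)) → RatField k (Σ j : Fin m, Fin (d j + 1)) :=
    fun a => if a.2 = 0 then coord k a else affCoord k a
  have hz : IntermediateField.adjoin k (Set.range z) = ⊤ := by
    rw [eq_top_iff, ← adjoin_coord, IntermediateField.adjoin_le_iff]
    rintro _ ⟨⟨j, c⟩, rfl⟩
    have h0 : coord k ⟨j, 0⟩ ∈ IntermediateField.adjoin k (Set.range z) :=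
      IntermediateField.subset_adjoin _ _ ⟨⟨j, 0⟩, by simp [z]⟩
    by_cases hc : c = 0
    · rw [hc]
      exact h0
    · have h1 : coord k ⟨j, c⟩ / coord k ⟨j, 0⟩ ∈ IntermediateField.adjoin k (Set.range z) :=
        IntermediateField.subset_adjoin _ _ ⟨⟨j, c⟩, by simp [z, hc, affCoord]⟩
      have := mul_mem h1 h0
      rwa [div_mul_cancel₀ _ (coord_ne_zero _)] at this
  have h := algebraicIndependent_of_adjoin_eq_top hz trdeg_ratField.ge
  have := h.comp (fun a : {a : Σ j : Fin m, Fin (d j + 1) // a.2 ≠ 0} => a.1) Subtype.val_injective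
  have hf : (fun a : {a : Σ j : Fin m, Fin (d j + 1) // a.2 ≠ 0} => affCoord k a.1) =
      z ∘ fun a => a.1 := by
    funext a
    simp [z, a.2]
  rw [hf]
  exact this

theorem adjoin_affCoord : IntermediateField.adjoin k (Set.range
    (fun a : {a : Σ j : Fin m, Fin (d j + 1) // a.2 ≠ 0} => affCoord k a.1)) =
      projField k (Sigma.fst : (Σ j : Fin m, Fin (d j + 1)) → Fin m) := by
  apply le_antisymm
  · rw [IntermediateField.adjoin_le_iff]
    rintro _ ⟨a, rfl⟩
    exact IntermediateField.subset_adjoin _ _ ⟨a.1, ⟨a.1.1, 0⟩, rfl, rfl⟩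
  · rw [projField, IntermediateField.adjoin_le_iff]
    have key : ∀ j c, affCoord k ⟨j, c⟩ ∈ IntermediateField.adjoin k (Set.range
        (fun a : {a : Σ j : Fin m, Fin (d j + 1) // a.2 ≠ 0} => affCoord k a.1)) := by
      intro j c
      by_cases hc : c = 0
      · rw [affCoord, hc, div_self (coord_ne_zero _)]
        exact one_mem _
      · exact IntermediateField.subset_adjoin _ _ ⟨⟨⟨j, c⟩, hc⟩, rfl⟩
    rintro _ ⟨⟨j, c⟩, ⟨j', c'⟩, h, rfl⟩
    obtain rfl : j = j' := h
    have := div_mem (key j c) (key j c')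
    rwa [affCoord, affCoord, div_div_div_cancel_right₀ (coord_ne_zero _)] at this

variable {κ : Type u} [Field κ] [Algebra k κ]

theorem IsProjFrame.adjoin_ne_zero {y : (Σ j : Fin m, Fin (d j + 1)) → κ} (h : IsProjFrame k y) :
    IntermediateField.adjoin k (Set.range
      (fun a : {a : Σ j : Fin m, Fin (d j + 1) // a.2 ≠ 0} => y a.1)) = ⊤ := by
  rw [eq_top_iff, ← h.adjoin, IntermediateField.adjoin_le_iff]
  rintro _ ⟨⟨j, c⟩, rfl⟩
  by_cases hc : c = 0
  · rw [hc, h.zero]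
    exact one_mem _
  · exact IntermediateField.subset_adjoin _ _ ⟨⟨⟨j, c⟩, hc⟩, rfl⟩

theorem IsProjFrame.exists_algEquiv {y : (Σ j : Fin m, Fin (d j + 1)) → κ} (h : IsProjFrame k y) :
    ∃ e : κ ≃ₐ[k] projField k (Sigma.fst : (Σ j : Fin m, Fin (d j + 1)) → Fin m),
      ∀ a, (e (y a) : RatField k _) = affCoord k a := by
  obtain ⟨e, he⟩ := exists_algEquiv_adjoin h.indep h.adjoin_ne_zero
    (algebraicIndependent_affCoord (k := k) (d := d))
  refine ⟨e.trans (IntermediateField.equivOfEq adjoin_affCoord), fun ⟨j, c⟩ => ?_⟩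
  by_cases hc : c = 0
  · rw [hc, h.zero, map_one, affCoord, div_self (coord_ne_zero _)]
    rfl
  · exact he ⟨⟨j, c⟩, hc⟩

theorem IsProjFrame.linearIndependent {y : (Σ j : Fin m, Fin (d j + 1)) → κ} (h : IsProjFrame k y)
    (j : Fin m) : LinearIndependent k fun c => y ⟨j, c⟩ := by
  obtain ⟨e, he⟩ := h.exists_algEquiv
  rw [Fintype.linearIndependent_iff]
  intro g hg
  have h1 : ∑ c, g c • coord k (⟨j, c⟩ : Σ j : Fin m, Fin (d j + 1)) = 0 := by
    have := congrArg (fun x => (e x : RatField k (Σ j : Fin m, Fin (d j + 1))) *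
      coord k ⟨j, 0⟩) hg
    simp only [map_sum, map_smul, IntermediateField.coe_sum, IntermediateField.coe_smul, he,
      map_zero, ZeroMemClass.coe_zero, zero_mul, Finset.sum_mul, affCoord, smul_mul_assoc] at this
    simpa only [coord_div_mul] using this
  exact Fintype.linearIndependent_iff.1
    ((algebraicIndependent_coord (k := k)).linearIndependent.comp
      (fun c => (⟨j, c⟩ : Σ j : Fin m, Fin (d j + 1))) fun c c' h => by simpa using h) g h1

/-- After multiplication by `w j` the automorphism is linear on the forms of the factor `j`. These
linear maps are the blocks of the matrix, and the multipliers disappear in quotients of coordinates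
on the same factor. -/
theorem IsProjFrame.isProductOfProjLinear {y : (Σ j : Fin m, Fin (d j + 1)) → κ}
    (h : IsProjFrame k y) {Z : Type v} [Group Z] (act : Z →* (κ ≃ₐ[k] κ))
    (hact : ∀ z, IsFrameAction y (act z)) : IsProductOfProjLinear act := by
  obtain ⟨e, he⟩ := h.exists_algEquiv
  refine ⟨m, d, e, fun z => ?_⟩
  choose w hw0 hw using hact z
  simp only [Submodule.mem_span_range_iff_exists_fun] at hw
  choose M hM using hw
  obtain ⟨A, hAdef⟩ : ∃ A : Matrix (Σ j : Fin m, Fin (d j + 1)) (Σ j : Fin m, Fin (d j + 1)) k,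
    A = Matrix.blockDiagonal' fun j => Matrix.of fun c' c => M j c c' := ⟨_, rfl⟩
  -- The kernel of a block consists of linear relations among the images of the coordinates under
  -- the injective map `w j * act z`; the coordinates of a factor are linearly independent.
  have hMinj : ∀ j, IsUnit (Matrix.of fun c' c => M j c c' : Matrix (Fin (d j + 1)) _ k) := by
    intro j
    rw [← Matrix.mulVec_injective_iff_isUnit]
    refine (injective_iff_map_eq_zero
      ((Matrix.of fun c' c => M j c c' : Matrix (Fin (d j + 1)) _ k).mulVecLin)).2 fun v hv => ?_
    have h1 : ∑ c, v c • (w j * act z (y ⟨j, c⟩)) = 0 := by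
      simp only [← hM, Finset.smul_sum, smul_smul]
      rw [Finset.sum_comm]
      simp only [← Finset.sum_smul]
      refine Finset.sum_eq_zero fun c' _ => ?_
      have := congrFun hv c'
      simp only [Matrix.mulVecLin_apply, Matrix.mulVec, dotProduct, Matrix.of_apply,
        Pi.zero_apply] at this
      simp only [mul_comm (v _), this, zero_smul]
    have h2 : w j * act z (∑ c, v c • y ⟨j, c⟩) = 0 := by
      rw [map_sum, Finset.mul_sum, ← h1]
      refine Finset.sum_congr rfl fun c _ => ?_
      rw [map_smul, mul_smul_comm]
    have h3 : ∑ c, v c • y ⟨j, c⟩ = 0 := by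
      have := (mul_eq_zero.1 h2).resolve_left (hw0 j)
      exact (map_eq_zero_iff _ (act z).injective).1 this
    funext c
    exact Fintype.linearIndependent_iff.1 (h.linearIndependent j) v h3 c
  have hA : IsUnit A := by
    rw [hAdef]
    choose N hN using fun j => isUnit_iff_exists.1 (hMinj j)
    refine isUnit_iff_exists.2 ⟨Matrix.blockDiagonal' N, ?_, ?_⟩
    · rw [← Matrix.blockDiagonal'_mul]
      simp only [fun j => (hN j).1]
      exact Matrix.blockDiagonal'_one
    · rw [← Matrix.blockDiagonal'_mul]
      simp only [fun j => (hN j).2]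
      exact Matrix.blockDiagonal'_one
  obtain ⟨A', hA'⟩ := hA
  refine ⟨A', fun a b hab => ?_, ?_⟩
  · rw [hA', hAdef]
    exact Matrix.blockDiagonal'_apply_ne _ _ _ hab
  have hlin : ∀ j c, linAut A' (coord k ⟨j, c⟩) =
      (e (w j * act z (y ⟨j, c⟩)) : RatField k _) * coord k ⟨j, 0⟩ := by
    intro j c
    rw [linAut_coord, hA', hAdef, Fintype.sum_sigma, Finset.sum_eq_single j, ← hM]
    · simp only [map_sum, map_smul, IntermediateField.coe_sum, IntermediateField.coe_smul, he,
        Finset.sum_mul, affCoord, smul_mul_assoc, coord_div_mul]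
      refine Finset.sum_congr rfl fun c' _ => ?_
      rw [Matrix.blockDiagonal'_apply_eq, Matrix.of_apply]
    · intro j' _ hj
      refine Finset.sum_eq_zero fun c' _ => ?_
      rw [Matrix.blockDiagonal'_apply_ne _ _ _ hj, zero_smul]
    · simp
  have key := algHom_ext_of_adjoin_eq_top h.adjoin
    (f := (IntermediateField.val _).comp (e.toAlgHom.comp (act z).toAlgHom))
    (g := (linAut A').toAlgHom.comp ((IntermediateField.val _).comp e.toAlgHom))
    (by
      rintro _ ⟨⟨j, c⟩, rfl⟩
      change (e (act z (y ⟨j, c⟩)) : RatField k _) = linAut A' (e (y ⟨j, c⟩))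
      have hne : ((e (w j) : projField k _) : RatField k (Σ j : Fin m, Fin (d j + 1))) ≠ 0 := by
        simpa using hw0 j
      rw [he, affCoord, map_div₀, hlin, hlin, h.zero, map_one, mul_one,
        mul_div_mul_right _ _ (coord_ne_zero _), map_mul, IntermediateField.coe_mul,
        mul_div_cancel_left₀ _ hne])
  exact fun x => DFunLike.congr_fun key x

end ProjLinear

/-! ### Rational connectedness of rational varieties -/

section RationallyConnected

open scoped TensorProduct

variable {k : Type u} [Field k] {K : Type u} [Field K] [Algebra k K] {ι : Type} {x : ι → K}

theorem exists_aeval_div (hgen : IntermediateField.adjoin k (Set.range x) = ⊤) (a : K) :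
    ∃ f g : MvPolynomial ι k, MvPolynomial.aeval x g ≠ 0 ∧
      MvPolynomial.aeval x g * a = MvPolynomial.aeval x f := by
  obtain ⟨b, hb, c, hc, hc0, rfl⟩ := exists_div_of_adjoin_eq_top hgen a
  obtain ⟨f, rfl⟩ := exists_aeval_of_mem_adjoin hb
  obtain ⟨g, rfl⟩ := exists_aeval_of_mem_adjoin hc
  exact ⟨f, g, hc0, mul_div_cancel₀ _ hc0⟩

/-- A common denominator of the form `d ⊗ d` reduces an element of the tensor product to one coming
from polynomials. The tensor square of the polynomial ring is a polynomial ring in two sets of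
variables, where independence of the images gives injectivity. -/
theorem productMap_injective (hgen : IntermediateField.adjoin k (Set.range x) = ⊤) {N : Type*}
    [Field N] [Algebra k N] (f g : K →ₐ[k] N)
    (h : AlgebraicIndependent k (Sum.elim (f ∘ x) (g ∘ x))) :
    Function.Injective (Algebra.TensorProduct.productMap f g) := by
  have hden : ∀ t : K ⊗[k] K, ∃ (d : MvPolynomial ι k) (P : MvPolynomial ι k ⊗[k] MvPolynomial ι k),
      MvPolynomial.aeval x d ≠ 0 ∧ (MvPolynomial.aeval x d ⊗ₜ[k] MvPolynomial.aeval x d) * t =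
        Algebra.TensorProduct.map (MvPolynomial.aeval x) (MvPolynomial.aeval x) P := by
    intro t
    induction t using TensorProduct.induction_on with
    | zero => exact ⟨1, 0, by simp, by simp⟩
    | tmul a b =>
      obtain ⟨f₁, g₁, hg₁, h₁⟩ := exists_aeval_div hgen a
      obtain ⟨f₂, g₂, hg₂, h₂⟩ := exists_aeval_div hgen b
      refine ⟨g₁ * g₂, (f₁ * g₂) ⊗ₜ (g₁ * f₂), by rw [map_mul]; exact mul_ne_zero hg₁ hg₂, ?_⟩
      rw [Algebra.TensorProduct.map_tmul, Algebra.TensorProduct.tmul_mul_tmul, map_mul, map_mul,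
        map_mul, ← h₁, ← h₂]
      congr 1 <;> ring
    | add t t' ht ht' =>
      obtain ⟨d, P, hd, hP⟩ := ht
      obtain ⟨d', P', hd', hP'⟩ := ht'
      refine ⟨d * d', (d' ⊗ₜ d') * P + (d ⊗ₜ d) * P',
        by rw [map_mul]; exact mul_ne_zero hd hd', ?_⟩
      rw [map_add (Algebra.TensorProduct.map _ _), map_mul (Algebra.TensorProduct.map _ _),
        map_mul (Algebra.TensorProduct.map _ _), ← hP, ← hP', Algebra.TensorProduct.map_tmul,
        Algebra.TensorProduct.map_tmul, map_mul, ← Algebra.TensorProduct.tmul_mul_tmul]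
      ring
  have hcomp : (Algebra.TensorProduct.productMap f g).comp
      (Algebra.TensorProduct.map (MvPolynomial.aeval x) (MvPolynomial.aeval x)) =
      (MvPolynomial.aeval (Sum.elim (f ∘ x) (g ∘ x))).comp
        (MvPolynomial.tensorEquivSum k ι ι k).toAlgHom := by
    apply Algebra.TensorProduct.ext
    · ext i
      simp
    · ext i
      simp
  rw [injective_iff_map_eq_zero]
  intro t ht
  obtain ⟨d, P, hd, hP⟩ := hden t
  have h1 : Algebra.TensorProduct.productMap f g
      (Algebra.TensorProduct.map (MvPolynomial.aeval x) (MvPolynomial.aeval x) P) = 0 := by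
    rw [← hP, map_mul, ht, mul_zero]
  have h2 := DFunLike.congr_fun hcomp P
  rw [AlgHom.comp_apply, h1, AlgHom.comp_apply] at h2
  have h3 : P = 0 := by
    have := (injective_iff_map_eq_zero _).1 (algebraicIndependent_iff_injective_aeval.1 h) _ h2.symm
    exact (map_eq_zero_iff _ (MvPolynomial.tensorEquivSum k ι ι k).injective).1 this
  rw [h3, map_zero] at hP
  have h4 := congrArg (fun z => ((MvPolynomial.aeval x d)⁻¹ ⊗ₜ[k] (MvPolynomial.aeval x d)⁻¹) * z) hP
  simp only [← mul_assoc, Algebra.TensorProduct.tmul_mul_tmul, inv_mul_cancel₀ hd, mul_zero] at h4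
  rwa [← Algebra.TensorProduct.one_def, one_mul] at h4

theorem exists_ratFunc_algHom {L N : Type*} [Field L] [Field N] [Algebra L N] {p : N}
    (hp : Transcendental L p) : ∃ σ : RatFunc L →ₐ[L] N, σ RatFunc.X = p := by
  have hinj : Function.Injective (Polynomial.aeval (R := L) p) := transcendental_iff_injective.1 hp
  refine ⟨RatFunc.liftAlgHom (Polynomial.aeval p)
    (nonZeroDivisors_le_comap_nonZeroDivisors_of_injective _ hinj), ?_⟩
  have := RatFunc.liftAlgHom_apply_div (S := L) (φ := Polynomial.aeval (R := L) p)
    (hφ := nonZeroDivisors_le_comap_nonZeroDivisors_of_injective _ hinj) Polynomial.X 1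
  simpa using this

/-- A line is recovered from two of its points and their distinct parameters: the difference
quotient is the direction `b`, and then `a` is found by subtraction. -/
theorem adjoin_lines_eq_top {L N : Type*} [Field L] [Algebra k L] [Field N] [Algebra k N]
    [Algebra L N] [IsScalarTower k L N] {a b : ι → L} {t : Fin 2 → N}
    (hab : IntermediateField.adjoin k (Set.range (Sum.elim a b)) = ⊤) (ht : t 0 ≠ t 1)
    (htgen : IntermediateField.adjoin L (Set.range t) = ⊤) :
    IntermediateField.adjoin k (Set.range (Sum.elim (Sum.elim
      (fun i => algebraMap L N (a i) + algebraMap L N (b i) * t 0)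
      (fun i => algebraMap L N (a i) + algebraMap L N (b i) * t 1)) t)) = ⊤ := by
  set z : (ι ⊕ ι) ⊕ Fin 2 → N := Sum.elim (Sum.elim
      (fun i => algebraMap L N (a i) + algebraMap L N (b i) * t 0)
      (fun i => algebraMap L N (a i) + algebraMap L N (b i) * t 1)) t with hz
  set E := IntermediateField.adjoin k (Set.range z)
  have hzE : ∀ i, z i ∈ E := fun i => IntermediateField.subset_adjoin _ _ ⟨i, rfl⟩
  have htE : ∀ i, t i ∈ E := fun i => hzE (Sum.inr i)
  have hA : ∀ i, algebraMap L N (a i) + algebraMap L N (b i) * t 0 ∈ E :=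
    fun i => hzE (Sum.inl (Sum.inl i))
  have hB : ∀ i, algebraMap L N (a i) + algebraMap L N (b i) * t 1 ∈ E :=
    fun i => hzE (Sum.inl (Sum.inr i))
  have hbE : ∀ i, algebraMap L N (b i) ∈ E := by
    intro i
    have := div_mem (sub_mem (hA i) (hB i)) (sub_mem (htE 0) (htE 1))
    rwa [add_sub_add_left_eq_sub, ← mul_sub, mul_div_cancel_right₀ _ (sub_ne_zero.2 ht)] at this
  have haE : ∀ i, algebraMap L N (a i) ∈ E := by
    intro i
    have := sub_mem (hA i) (mul_mem (hbE i) (htE 0))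
    rwa [add_sub_cancel_right] at this
  have hL : ∀ c : L, algebraMap L N c ∈ E := by
    intro c
    have hc : c ∈ IntermediateField.adjoin k (Set.range (Sum.elim a b)) := hab ▸ trivial
    induction hc using IntermediateField.adjoin_induction with
    | mem x hx =>
      obtain ⟨i | i, rfl⟩ := hx
      · exact haE i
      · exact hbE i
    | algebraMap c =>
      rw [← IsScalarTower.algebraMap_apply]
      exact IntermediateField.algebraMap_mem _ _
    | add x y _ _ hx hy => rw [map_add]; exact add_mem hx hy
    | inv x _ hx => rw [map_inv₀]; exact inv_mem hx
    | mul x y _ _ hx hy => rw [map_mul]; exact mul_mem hx hy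
  rw [eq_top_iff]
  intro c _
  have hc : c ∈ IntermediateField.adjoin L (Set.range t) := htgen ▸ trivial
  induction hc using IntermediateField.adjoin_induction with
  | mem x hx =>
    obtain ⟨i, rfl⟩ := hx
    exact htE i
  | algebraMap c => exact hL c
  | add x y _ _ hx hy => exact add_mem (hx trivial) (hy trivial)
  | inv x _ hx => exact inv_mem (hx trivial)
  | mul x y _ _ hx hy => exact mul_mem (hx trivial) (hy trivial)

/-- The points of an affine space are joined by lines. -/
theorem isRationallyConnected_of_lines [Fintype ι] (hx : AlgebraicIndependent k x)
    (hgen : IntermediateField.adjoin k (Set.range x) = ⊤) {L N : Type u} [Field L] [Algebra k L]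
    [Field N] [Algebra k N] [Algebra L N] [IsScalarTower k L N] {a b : ι → L} {t : Fin 2 → N}
    (habi : AlgebraicIndependent k (Sum.elim a b))
    (hab : IntermediateField.adjoin k (Set.range (Sum.elim a b)) = ⊤)
    (ht : AlgebraicIndependent L t)
    (htgen : IntermediateField.adjoin L (Set.range t) = ⊤) : IsRationallyConnected k K := by
  have hne : t 0 ≠ t 1 := fun h => absurd (ht.injective h) (by decide)
  -- The coordinates of both points and the two parameters number `2 * card ι + 2`, the
  -- transcendence degree of the field they generate. So the two points are independent generic
  -- points.
  have hz := algebraicIndependent_of_adjoin_eq_top (adjoin_lines_eq_top hab hne htgen) (by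
    rw [← trdeg_add_eq k L (A := N), trdeg_eq_of_algebraicIndependent habi hab,
      trdeg_eq_of_algebraicIndependent ht htgen, Fintype.card_sum, Nat.cast_add])
  have hAB := hz.comp Sum.inl Sum.inl_injective
  rw [Sum.elim_comp_inl] at hAB
  obtain ⟨σ, hσ⟩ := exists_ratFunc_algHom (ht.transcendental 0)
  obtain ⟨τ, hτ⟩ := exists_ratFunc_algHom (ht.transcendental 1)
  let y : ι → RatFunc L := fun i => algebraMap L _ (a i) + algebraMap L _ (b i) * RatFunc.X
  have hσy : σ.restrictScalars k ∘ y =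
      fun i => algebraMap L N (a i) + algebraMap L N (b i) * t 0 := by
    funext i
    change σ (algebraMap L _ (a i) + algebraMap L _ (b i) * RatFunc.X) = _
    rw [map_add, map_mul, AlgHom.commutes, AlgHom.commutes, hσ]
  have hτy : τ.restrictScalars k ∘ y =
      fun i => algebraMap L N (a i) + algebraMap L N (b i) * t 1 := by
    funext i
    change τ (algebraMap L _ (a i) + algebraMap L _ (b i) * RatFunc.X) = _
    rw [map_add, map_mul, AlgHom.commutes, AlgHom.commutes, hτ]
  have hy : AlgebraicIndependent k y := by
    apply AlgebraicIndependent.of_comp (σ.restrictScalars k)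
    rw [hσy]
    exact hAB.comp Sum.inl Sum.inl_injective
  obtain ⟨e, he⟩ := exists_algEquiv_adjoin hx hgen hy
  let φ : K →ₐ[k] RatFunc L := (IntermediateField.val _).comp e.toAlgHom
  have hφ : ∀ i, φ (x i) = y i := he
  refine ⟨L, inferInstance, inferInstance, N, inferInstance, inferInstance, inferInstance,
    inferInstance, φ, σ, τ, ?_, ?_, ?_⟩
  · exact IntermediateField.fg_def.2 ⟨_, Set.finite_range _, hab⟩
  · rw [hσ, hτ]
    convert ht using 1
    funext i
    fin_cases i <;> rfl
  · apply productMap_injective hgen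
    convert hAB using 2
    · rw [← hσy]
      funext i
      exact congrArg σ (hφ i)
    · rw [← hτy]
      funext i
      exact congrArg τ (hφ i)

theorem isRationallyConnected_of_algebraicIndependent [Fintype ι] (hx : AlgebraicIndependent k x)
    (hgen : IntermediateField.adjoin k (Set.range x) = ⊤) : IsRationallyConnected k K := by
  have h : (Sum.elim (fun i => coord k (Sum.inl i)) (fun i => coord k (Sum.inr i)) :
      ι ⊕ ι → RatField k (ι ⊕ ι)) = coord k := by
    funext i
    cases i <;> rfl
  exact isRationallyConnected_of_lines (L := RatField k (ι ⊕ ι))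
    (N := RatField (RatField k (ι ⊕ ι)) (Fin 2)) (t := coord _) hx hgen
    (a := fun i => coord k (Sum.inl i)) (b := fun i => coord k (Sum.inr i))
    (by rw [h]; exact algebraicIndependent_coord) (by rw [h]; exact adjoin_coord)
    algebraicIndependent_coord adjoin_coord

theorem IsProjFrame.isRationallyConnected {κ : Type u} [Field κ] [Algebra k κ] {m : ℕ}
    {d : Fin m → ℕ} {y : (Σ j : Fin m, Fin (d j + 1)) → κ} (h : IsProjFrame k y) :
    IsRationallyConnected k κ :=
  isRationallyConnected_of_algebraicIndependent h.indep h.adjoin_ne_zero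

end RationallyConnected

/-! ### Orders of rational functions along prime divisors -/

section Orders

variable {k : Type u} [Field k] {K : Type u} [Field K] [Algebra k K]

/-- The order of `f` with respect to the discrete valuation ring `P` is `n`. -/
def IsOrd (P : Subalgebra k K) (f : K) (n : ℤ) : Prop :=
  ∀ ϖ : P, Irreducible ϖ → ∃ u : Pˣ, f = ((u : P) : K) * (ϖ : K) ^ n

variable {P : Subalgebra k K}

theorem coe_unit_ne_zero (u : Pˣ) : ((u : P) : K) ≠ 0 := fun h => u.ne_zero (Subtype.ext h)

theorem coe_unit_inv (u : Pˣ) : (((u⁻¹ : Pˣ) : P) : K) = ((u : P) : K)⁻¹ := by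
  apply eq_inv_of_mul_eq_one_left
  exact congrArg Subtype.val u.inv_mul

theorem coe_irreducible_ne_zero {ϖ : P} (h : Irreducible ϖ) : (ϖ : K) ≠ 0 :=
  fun h' => h.ne_zero (Subtype.ext h')

theorem IsOrd.mul {f g : K} {n l : ℤ} (hf : IsOrd P f n) (hg : IsOrd P g l) :
    IsOrd P (f * g) (n + l) := by
  intro ϖ hϖ
  obtain ⟨u, rfl⟩ := hf ϖ hϖ
  obtain ⟨u', rfl⟩ := hg ϖ hϖ
  refine ⟨u * u', ?_⟩
  rw [zpow_add₀ (coe_irreducible_ne_zero hϖ), Units.val_mul]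
  push_cast
  ring

theorem IsOrd.inv {f : K} {n : ℤ} (hf : IsOrd P f n) : IsOrd P f⁻¹ (-n) := by
  intro ϖ hϖ
  obtain ⟨u, rfl⟩ := hf ϖ hϖ
  exact ⟨u⁻¹, by rw [coe_unit_inv, mul_inv, zpow_neg]⟩

theorem isOrd_zero {f : K} (h0 : f ≠ 0) (hf : f ∈ P) (hi : f⁻¹ ∈ P) : IsOrd P f 0 := by
  intro ϖ _
  refine ⟨⟨⟨f, hf⟩, ⟨f⁻¹, hi⟩, Subtype.ext (mul_inv_cancel₀ h0), Subtype.ext (inv_mul_cancel₀ h0)⟩, ?_⟩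
  simp

theorem isOrd_of_irreducible [IsDiscreteValuationRing P] {g : P} (hg : Irreducible g) :
    IsOrd P (g : K) 1 := by
  intro ϖ hϖ
  obtain ⟨u, hu⟩ := IsDiscreteValuationRing.associated_of_irreducible P hϖ hg
  exact ⟨u, by rw [← hu, zpow_one, mul_comm]; rfl⟩

theorem irreducible_coe_mem_maxSet {ϖ : P} (h : Irreducible ϖ) : (ϖ : K) ∈ maxSet P := by
  rw [← mem_nonunits_iff_mem_maxSet]
  exact h.not_isUnit

variable [IsDiscreteValuationRing P]

theorem IsOrd.mem_of_nonneg {f : K} {n : ℤ} (hf : IsOrd P f n) (hn : 0 ≤ n) : f ∈ P := by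
  obtain ⟨ϖ, hϖ⟩ := IsDiscreteValuationRing.exists_irreducible P
  obtain ⟨u, rfl⟩ := hf ϖ hϖ
  lift n to ℕ using hn
  rw [zpow_natCast]
  exact P.mul_mem (u : P).2 (P.pow_mem ϖ.2 n)

theorem IsOrd.ne_zero {f : K} {n : ℤ} (hf : IsOrd P f n) : f ≠ 0 := by
  obtain ⟨ϖ, hϖ⟩ := IsDiscreteValuationRing.exists_irreducible P
  obtain ⟨u, rfl⟩ := hf ϖ hϖ
  exact mul_ne_zero (coe_unit_ne_zero u) (zpow_ne_zero _ (coe_irreducible_ne_zero hϖ))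

theorem isOrd_zero_iff {f : K} : IsOrd P f 0 ↔ f ≠ 0 ∧ f ∈ P ∧ f⁻¹ ∈ P :=
  ⟨fun h => ⟨h.ne_zero, h.mem_of_nonneg le_rfl, h.inv.mem_of_nonneg (by simp)⟩,
    fun h => isOrd_zero h.1 h.2.1 h.2.2⟩

theorem IsOrd.unique {f : K} {n l : ℤ} (hf : IsOrd P f n) (hf' : IsOrd P f l) : n = l := by
  wlog h : n ≤ l generalizing n l
  · exact (this hf' hf (not_le.1 h).le).symm
  obtain ⟨ϖ, hϖ⟩ := IsDiscreteValuationRing.exists_irreducible P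
  obtain ⟨u, hu⟩ := hf ϖ hϖ
  obtain ⟨u', hu'⟩ := hf' ϖ hϖ
  by_contra hne
  obtain ⟨j, hj⟩ : ∃ j : ℕ, l = n + (j + 1 : ℕ) := by
    obtain ⟨j, hj⟩ := Int.eq_ofNat_of_zero_le (show 0 ≤ l - n - 1 by omega)
    exact ⟨j, by push_cast; omega⟩
  have h0 := coe_irreducible_ne_zero hϖ
  rw [hu, hj, zpow_add₀ h0, zpow_natCast] at hu'
  have h1 : ((u : P) : K) = ((u' : P) : K) * (ϖ : K) ^ (j + 1) := by
    apply mul_right_cancel₀ (zpow_ne_zero n h0)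
    rw [hu']
    ring
  have h2 : (u : P) = u' * ϖ ^ (j + 1) := Subtype.ext h1
  refine hϖ.not_isUnit (isUnit_of_dvd_unit ?_ u.isUnit)
  rw [h2]
  exact (dvd_pow_self ϖ (Nat.succ_ne_zero j)).mul_left _

theorem exists_isOrd (hP : ∀ x : K, ∃ a ∈ P, ∃ b ∈ P, b ≠ 0 ∧ x = a / b) {f : K} (hf : f ≠ 0) :
    ∃ n, IsOrd P f n := by
  have key : ∀ a : P, a ≠ 0 → ∃ n : ℤ, IsOrd P (a : K) n := by
    intro a ha
    obtain ⟨ϖ, hϖ⟩ := IsDiscreteValuationRing.exists_irreducible P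
    obtain ⟨n, hn⟩ := IsDiscreteValuationRing.associated_pow_irreducible ha hϖ
    obtain ⟨u, hu⟩ := hn.symm
    refine ⟨n, fun ϖ' hϖ' => ?_⟩
    obtain ⟨v, hv⟩ := IsDiscreteValuationRing.associated_of_irreducible P hϖ' hϖ
    refine ⟨u * v ^ n, ?_⟩
    rw [zpow_natCast]
    have : a = (u * v ^ n : Pˣ) * ϖ' ^ n := by
      rw [← hu, ← hv, mul_pow]
      push_cast
      ring
    exact congrArg Subtype.val this
  obtain ⟨a, ha, b, hb, hb0, rfl⟩ := hP f
  have ha0 : a ≠ 0 := fun h => hf (by simp [h])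
  obtain ⟨n, hn⟩ := key ⟨a, ha⟩ fun h => ha0 (congrArg Subtype.val h)
  obtain ⟨l, hl⟩ := key ⟨b, hb⟩ fun h => hb0 (congrArg Subtype.val h)
  exact ⟨n + -l, by rw [div_eq_mul_inv]; exact hn.mul hl.inv⟩

omit [IsDiscreteValuationRing P] in
theorem IsOrd.map {f : K} {n : ℤ} (hf : IsOrd P f n) (y : K ≃ₐ[k] K) :
    IsOrd (P.map (y : K →ₐ[k] K)) (y f) n := by
  intro ϖ hϖ
  let e := P.equivMapOfInjective (y : K →ₐ[k] K) y.injective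
  obtain ⟨ϖ', rfl⟩ := e.surjective ϖ
  obtain ⟨u, hu⟩ := hf ϖ' ((MulEquiv.irreducible_iff e).mp hϖ)
  refine ⟨Units.map (e.toMulEquiv.toMonoidHom : P →* _) u, ?_⟩
  change y f = y ((u : P) : K) * (y (ϖ' : K)) ^ n
  rw [hu, map_mul, map_zpow₀]

/-- A discrete valuation ring that is a localization of `A` and whose maximal ideal contains a prime
element of `A`. -/
theorem IsLocOf.maxSet_iff_dvd {A : Subalgebra k K} (h : IsLocOf A P) {g : A} (hg : Prime g)
    (hgm : (g : K) ∈ maxSet P) :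
    Irreducible (⟨g, h.1 g.2⟩ : P) ∧ ∀ a : A, (a : K) ∈ maxSet P ↔ g ∣ a := by
  have hunit : ∀ d : A, (d : K) ∉ maxSet P → ¬ g ∣ d := by
    rintro d hd ⟨c, rfl⟩
    refine hd ?_
    push_cast
    exact mul_mem_maxSet' (h.1 c.2) hgm
  obtain ⟨ϖ, hϖ⟩ := IsDiscreteValuationRing.exists_irreducible P
  have hg0 : (⟨g, h.1 g.2⟩ : P) ≠ 0 := fun h' => hg.ne_zero (Subtype.ext
    (congrArg (fun x : P => (x : K)) h'))
  obtain ⟨n, hn⟩ := IsDiscreteValuationRing.associated_pow_irreducible hg0 hϖ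
  obtain ⟨u, hu⟩ := hn
  obtain ⟨a, ha, b, hb, hb0, hbi, hab⟩ := h.2.2 ϖ ϖ.2
  obtain ⟨c, hc, d, hd, hd0, hdi, hcd⟩ := h.2.2 _ (u : P).2
  have hdu : (d : K) ∉ maxSet P := notMem_maxSet_of_inv_mem hd0 hdi
  have hu0 := coe_unit_ne_zero u
  -- This clears denominators in `g * u = ϖ ^ n`, with the uniformizer `ϖ = a / b` and the unit `u =
  -- c / d`. As `g` is prime and does not divide `d`, it divides `a`. Hence `g` divides `ϖ` in `P`
  -- and is itself a uniformizer.
  have h1 : (⟨a, ha⟩ : A) ^ n * ⟨d, hd⟩ = g * (⟨b, hb⟩ ^ n * ⟨c, hc⟩) := by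
    apply Subtype.ext
    push_cast
    have hu' : (g : K) * ((u : P) : K) = (ϖ : K) ^ n := congrArg Subtype.val hu
    rw [hab, hcd, div_pow] at hu'
    field_simp at hu'
    linear_combination -hu'
  have hga : g ∣ ⟨a, ha⟩ := by
    rcases hg.dvd_or_dvd (Dvd.intro _ h1.symm) with h2 | h2
    · exact hg.dvd_of_dvd_pow h2
    · exact absurd h2 (hunit _ hdu)
  have hgϖ : (⟨g, h.1 g.2⟩ : P) ∣ ϖ := by
    obtain ⟨e, he⟩ := hga
    refine ⟨⟨e, h.1 e.2⟩ * ⟨b⁻¹, hbi⟩, Subtype.ext ?_⟩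
    rw [hab]
    have : a = g * e := congrArg Subtype.val he
    rw [this]
    push_cast
    field_simp
  have hgnu : ¬ IsUnit (⟨g, h.1 g.2⟩ : P) := by
    rw [← mem_nonunits_iff, mem_nonunits_iff_mem_maxSet]
    exact hgm
  have hgirr : Irreducible (⟨g, h.1 g.2⟩ : P) := by
    obtain ⟨e, he⟩ := hgϖ
    have he' := (hϖ.isUnit_or_isUnit he).resolve_left hgnu
    rw [he] at hϖ
    exact (irreducible_mul_isUnit he').1 hϖ
  refine ⟨hgirr, fun a' => ⟨fun ha' => ?_, fun hga' => ?_⟩⟩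
  · have hm : (⟨a', h.1 a'.2⟩ : P) ∈ nonunits P := by
      rw [mem_nonunits_iff_mem_maxSet]
      exact ha'
    have hdvd : (⟨g, h.1 g.2⟩ : P) ∣ ⟨a', h.1 a'.2⟩ := by
      have := (IsLocalRing.mem_maximalIdeal _).2 hm
      rw [hgirr.maximalIdeal_eq, Ideal.mem_span_singleton] at this
      exact this
    obtain ⟨⟨q, hq⟩, hq'⟩ := hdvd
    obtain ⟨x, hx, z, hz, hz0, hzi, rfl⟩ := h.2.2 q hq
    have h2 : a' * ⟨z, hz⟩ = g * ⟨x, hx⟩ := by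
      apply Subtype.ext
      push_cast
      have : (a' : K) = g * (x / z) := congrArg Subtype.val hq'
      rw [this]
      field_simp
    exact (hg.dvd_or_dvd (Dvd.intro _ h2.symm)).resolve_right
      (hunit _ (notMem_maxSet_of_inv_mem hz0 hzi))
  · by_contra hn
    exact hunit _ hn hga'

end Orders

/-! ### Discrete valuation rings at prime elements -/

section PrimeLoc

variable {k : Type u} [Field k] {K : Type u} [Field K] [Algebra k K]

/-- The local ring of a factorial ring at a prime element is a discrete valuation ring. -/
theorem isDiscreteValuationRing_localRingAt {A : Subalgebra k K} [UniqueFactorizationMonoid A]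
    {g : A} (hg : Prime g) [hp : (Ideal.span {g}).IsPrime] :
    IsDiscreteValuationRing (localRingAt A (Ideal.span {g})) := by
  obtain ⟨h, hmax⟩ := isLocOf_localRingAt A (Ideal.span {g})
  set P := localRingAt A (Ideal.span {g})
  simp only [Ideal.mem_span_singleton] at hmax
  have hg0 : (g : K) ≠ 0 := fun h' => hg.ne_zero (Subtype.ext h')
  refine IsDiscreteValuationRing.ofHasUnitMulPowIrreducibleFactorization
    ⟨⟨g, h.1 g.2⟩, ⟨?_, ?_⟩, ?_⟩
  · rw [← mem_nonunits_iff, mem_nonunits_iff_mem_maxSet]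
    exact (hmax g).1 dvd_rfl
  · intro x y hxy
    by_contra hne
    push Not at hne
    obtain ⟨hx, hy⟩ := hne
    rw [← mem_nonunits_iff, mem_nonunits_iff_mem_maxSet] at hx hy
    obtain ⟨a, ha, b, hb, hb0, hbi, hxab⟩ := h.2.2 x x.2
    obtain ⟨c, hc, d, hd, hd0, hdi, hycd⟩ := h.2.2 y y.2
    obtain ⟨a', ha'⟩ := (hmax ⟨a, ha⟩).2 (by
      have := mul_mem_maxSet' (h.1 hb) hx
      rwa [hxab, div_mul_cancel₀ _ hb0] at this)
    obtain ⟨c', hc'⟩ := (hmax ⟨c, hc⟩).2 (by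
      have := mul_mem_maxSet' (h.1 hd) hy
      rwa [hycd, div_mul_cancel₀ _ hd0] at this)
    have ha'' : a = g * a' := congrArg Subtype.val ha'
    have hc'' : c = g * c' := congrArg Subtype.val hc'
    have h1 : (⟨b, hb⟩ * ⟨d, hd⟩ : A) = g * (a' * c') := by
      apply Subtype.ext
      push_cast
      have h2 : (g : K) = x * y := congrArg Subtype.val hxy
      rw [hxab, hycd, ha'', hc''] at h2
      field_simp at h2
      linear_combination h2
    rcases hg.dvd_or_dvd (Dvd.intro _ h1.symm) with h2 | h2
    · exact notMem_maxSet_of_inv_mem hb0 hbi ((hmax _).1 h2)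
    · exact notMem_maxSet_of_inv_mem hd0 hdi ((hmax _).1 h2)
  · intro x hx
    obtain ⟨a, ha, b, hb, hb0, hbi, hxab⟩ := h.2.2 x x.2
    have ha0 : (⟨a, ha⟩ : A) ≠ 0 := by
      intro h'
      have : a = 0 := congrArg Subtype.val h'
      exact hx (Subtype.ext (by rw [hxab, this, zero_div]; rfl))
    obtain ⟨c, hc, hac⟩ := (FiniteMultiplicity.of_prime_left hg ha0).exists_eq_pow_mul_and_not_dvd
    set n := multiplicity g (⟨a, ha⟩ : A)
    have hcm : (c : K) ∉ maxSet P := fun h' => hac ((hmax c).2 h')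
    obtain ⟨hc0, hci⟩ := ne_zero_and_inv_mem_of_notMem_maxSet (h.1 c.2) hcm
    refine ⟨n, ⟨⟨⟨c / b, ?_⟩, ⟨b / c, ?_⟩, ?_, ?_⟩, ?_⟩⟩
    · rw [div_eq_mul_inv]
      exact P.mul_mem (h.1 c.2) hbi
    · rw [div_eq_mul_inv]
      exact P.mul_mem (h.1 hb) hci
    · apply Subtype.ext
      change (c : K) / b * (b / c) = 1
      field_simp
    · apply Subtype.ext
      change b / (c : K) * (c / b) = 1
      field_simp
    · apply Subtype.ext
      change (g : K) ^ n * (c / b) = x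
      have : a = (g : K) ^ n * c := congrArg Subtype.val hc
      rw [hxab, this, mul_div_assoc]

end PrimeLoc

/-! ### The product of projective spaces as a projective model -/

section ChartChange

variable {k : Type u} [Field k] {K : Type u} [Field K] [Algebra k K]

theorem div_mem_chart {ι : Type*} (S : ι → Submodule k K) (s : ι → K) {i : ι} {a : K}
    (ha : a ∈ S i) : a / s i ∈ chart S s := Algebra.subset_adjoin ⟨i, a, ha, rfl⟩

/-- If each `t i` divides all of `S i` at the point, it differs from the denominator of any other
chart at the point by a unit, so one may pass to the chart of `t`. -/
theorem isLocOf_chart {ι : Type*} {S : ι → Submodule k K} {O : Subalgebra k K}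
    (hO : O ∈ projModel S) {t : ι → K} (ht : ∀ i, t i ∈ S i ∧ t i ≠ 0)
    (h : ∀ i, ∀ a ∈ S i, a / t i ∈ O) : IsLocOf (chart S t) O := by
  obtain ⟨s, hs, hloc⟩ := mem_projModel_iff.1 hO
  refine IsLocOf.of_generators (s := {y | ∃ i, ∃ t ∈ S i, y = t / s i}) hloc ?_ ?_
  · refine Algebra.adjoin_le ?_
    rintro _ ⟨i, a, ha, rfl⟩
    exact h i a ha
  · rintro _ ⟨i, a, ha, rfl⟩
    refine ⟨a / t i, div_mem_chart S t ha, s i / t i, div_mem_chart S t (hs i).1,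
      div_ne_zero (hs i).2 (ht i).2, ?_, ?_⟩
    · rw [inv_div]
      exact hloc.1 (div_mem_chart S s (ht i).1)
    · rw [div_div_div_cancel_right₀ (ht i).2]

theorem IsLocOf.map {A O : Subalgebra k K} (h : IsLocOf A O) (f : K ≃ₐ[k] K) :
    IsLocOf (A.map (f : K →ₐ[k] K)) (O.map (f : K →ₐ[k] K)) := by
  refine ⟨Subalgebra.map_mono h.1, ?_, ?_⟩
  · have := h.2.1
    exact (O.equivMapOfInjective (f : K →ₐ[k] K) f.injective).toRingEquiv.isLocalRing
  · rintro _ ⟨x, hx, rfl⟩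
    obtain ⟨a, ha, b, hb, hb0, hbi, rfl⟩ := h.2.2 x hx
    refine ⟨f a, ⟨a, ha, rfl⟩, f b, ⟨b, hb, rfl⟩, by simpa using hb0, ⟨b⁻¹, hbi, map_inv₀ f b⟩, ?_⟩
    exact map_div₀ f a b

/-- Only quotients of elements of one `S i` enter the charts, so it is enough that the automorphism
preserves each space up to a multiplier. -/
theorem map_mem_projModel {ι : Type*} {S : ι → Submodule k K} {O : Subalgebra k K}
    (hO : O ∈ projModel S) (f : K ≃ₐ[k] K) {w : ι → K} (hw : ∀ i, w i ≠ 0)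
    (hS : ∀ i a, a ∈ S i → w i * f a ∈ S i) (hS' : ∀ i, ∀ b ∈ S i, ∃ a ∈ S i, b = w i * f a) :
    O.map (f : K →ₐ[k] K) ∈ projModel S := by
  obtain ⟨s, hs, hloc⟩ := mem_projModel_iff.1 hO
  have hfs : ∀ i, f (s i) ≠ 0 := fun i => by simpa using (hs i).2
  refine mem_projModel_iff.2 ⟨fun i => w i * f (s i), fun i =>
    ⟨hS i _ (hs i).1, mul_ne_zero (hw i) (hfs i)⟩, (hloc.map f).of_le ?_ ?_⟩
  · rw [chart, AlgHom.map_adjoin]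
    refine Algebra.adjoin_le ?_
    rintro _ ⟨_, ⟨i, a, ha, rfl⟩, rfl⟩
    have := div_mem_chart S (fun i => w i * f (s i)) (hS i a ha)
    rw [mul_div_mul_left _ _ (hw i), ← map_div₀] at this
    exact this
  · refine Algebra.adjoin_le ?_
    rintro _ ⟨i, b, hb, rfl⟩
    obtain ⟨a, ha, rfl⟩ := hS' i b hb
    rw [mul_div_mul_left _ _ (hw i), ← map_div₀]
    exact ⟨_, hloc.1 (div_mem_chart S s ha), rfl⟩

end ChartChange

section ProductModel

variable {k : Type u} [Field k] {κ : Type u} [Field κ] [Algebra k κ] {m : ℕ} {d : Fin m → ℕ}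

/-- The linear forms on the factors of a product of projective spaces. -/
def frameSpaces (k : Type u) [Field k] [Algebra k κ] (y : (Σ j : Fin m, Fin (d j + 1)) → κ)
    (j : Fin m) : Submodule k κ := Submodule.span k (Set.range fun c => y ⟨j, c⟩)

/-- The standard affine chart on a product of projective spaces. -/
abbrev stdChart (k : Type u) [Field k] [Algebra k κ] (y : (Σ j : Fin m, Fin (d j + 1)) → κ)
    (c : ∀ j, Fin (d j + 1)) : Subalgebra k κ := chart (frameSpaces k y) fun j => y ⟨j, c j⟩

/-- The coordinates on a standard affine chart. -/
def stdCoord (y : (Σ j : Fin m, Fin (d j + 1)) → κ) (c : ∀ j, Fin (d j + 1))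
    (a : {a : Σ j : Fin m, Fin (d j + 1) // a.2 ≠ c a.1}) : κ := y a.1 / y ⟨a.1.1, c a.1.1⟩

variable {y : (Σ j : Fin m, Fin (d j + 1)) → κ}

theorem mem_frameSpaces (j : Fin m) (c : Fin (d j + 1)) : y ⟨j, c⟩ ∈ frameSpaces k y j :=
  Submodule.subset_span ⟨c, rfl⟩

theorem div_mem_of_forall {j : Fin m} {s : κ} {O : Subalgebra k κ} (h : ∀ c, y ⟨j, c⟩ / s ∈ O)
    {a : κ} (ha : a ∈ frameSpaces k y j) : a / s ∈ O := by
  induction ha using Submodule.span_induction with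
  | mem x hx =>
    obtain ⟨c, rfl⟩ := hx
    exact h c
  | zero => simp [O.zero_mem]
  | add x y _ _ hx hy => rw [add_div]; exact O.add_mem hx hy
  | smul r x _ hx => rw [smul_div_assoc]; exact O.smul_mem hx r

namespace IsProjFrame

variable (h : IsProjFrame k y)
include h

theorem one_mem_frameSpaces (j : Fin m) : (1 : κ) ∈ frameSpaces k y j := by
  rw [← h.zero j]
  exact mem_frameSpaces j 0

theorem ne_zero (a : Σ j : Fin m, Fin (d j + 1)) : y a ≠ 0 :=
  (h.linearIndependent a.1).ne_zero a.2

theorem stdChart_eq_adjoin (c : ∀ j, Fin (d j + 1)) :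
    stdChart k y c = Algebra.adjoin k (Set.range (stdCoord y c)) := by
  apply le_antisymm
  · refine Algebra.adjoin_le ?_
    rintro _ ⟨j, a, ha, rfl⟩
    refine div_mem_of_forall (fun c' => ?_) ha
    by_cases hc : c' = c j
    · rw [hc, div_self (h.ne_zero _)]
      exact Subalgebra.one_mem _
    · exact Algebra.subset_adjoin ⟨⟨⟨j, c'⟩, hc⟩, rfl⟩
  · refine Algebra.adjoin_le ?_
    rintro _ ⟨⟨⟨j, c'⟩, hc⟩, rfl⟩
    exact div_mem_chart (frameSpaces k y) (fun j => y ⟨j, c j⟩) (mem_frameSpaces j c')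

theorem adjoin_stdCoord (c : ∀ j, Fin (d j + 1)) :
    IntermediateField.adjoin k (Set.range (stdCoord y c)) = ⊤ := by
  rw [eq_top_iff, ← h.adjoin, IntermediateField.adjoin_le_iff]
  have key : ∀ j c', y ⟨j, c'⟩ / y ⟨j, c j⟩ ∈
      IntermediateField.adjoin k (Set.range (stdCoord y c)) := by
    intro j c'
    by_cases hc : c' = c j
    · rw [hc, div_self (h.ne_zero _)]
      exact one_mem _
    · exact IntermediateField.subset_adjoin _ _ ⟨⟨⟨j, c'⟩, hc⟩, rfl⟩
  rintro _ ⟨⟨j, c'⟩, rfl⟩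
  have := div_mem (key j c') (key j 0)
  rwa [div_div_div_cancel_right₀ (h.ne_zero _), h.zero, div_one] at this

theorem algebraicIndependent_stdCoord (c : ∀ j, Fin (d j + 1)) :
    AlgebraicIndependent k (stdCoord y c) := by
  refine algebraicIndependent_of_adjoin_eq_top (h.adjoin_stdCoord c) ?_
  rw [trdeg_eq_of_algebraicIndependent h.indep h.adjoin_ne_zero]
  refine le_of_eq (congrArg Nat.cast (Fintype.card_congr ?_))
  refine (Equiv.sigmaCongrRight fun j => Equiv.swap (c j) 0).subtypeEquiv fun a => ?_
  change _ ↔ Equiv.swap (c a.1) 0 a.2 ≠ 0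
  rw [not_iff_not]
  constructor
  · intro ha
    rw [ha, Equiv.swap_apply_left]
  · intro ha
    rw [Equiv.swap_apply_eq_iff, Equiv.swap_apply_right] at ha
    exact ha

/-- The standard chart is a polynomial ring. -/
theorem exists_stdChart_equiv (c : ∀ j, Fin (d j + 1)) :
    ∃ e : MvPolynomial {a : Σ j : Fin m, Fin (d j + 1) // a.2 ≠ c a.1} k ≃ₐ[k] stdChart k y c,
      ∀ a, (e (MvPolynomial.X a) : κ) = stdCoord y c a := by
  refine ⟨(h.algebraicIndependent_stdCoord c).aevalEquiv.trans
    (Subalgebra.equivOfEq _ _ (h.stdChart_eq_adjoin c).symm), fun a => ?_⟩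
  have := (h.algebraicIndependent_stdCoord c).algebraMap_aevalEquiv (MvPolynomial.X a)
  rw [MvPolynomial.aeval_X] at this
  exact this

theorem uniqueFactorizationMonoid_stdChart (c : ∀ j, Fin (d j + 1)) :
    UniqueFactorizationMonoid (stdChart k y c) := by
  obtain ⟨e, -⟩ := h.exists_stdChart_equiv c
  exact e.toMulEquiv.uniqueFactorizationMonoid inferInstance

theorem exists_eq_div_stdChart (c : ∀ j, Fin (d j + 1)) (x : κ) :
    ∃ a ∈ stdChart k y c, ∃ b ∈ stdChart k y c, b ≠ 0 ∧ x = a / b := by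
  rw [h.stdChart_eq_adjoin]
  exact exists_div_of_adjoin_eq_top (h.adjoin_stdCoord c) x

theorem isLocOf_stdChart {O : Subalgebra k κ} (hO : O ∈ projModel (frameSpaces k y))
    {c : ∀ j, Fin (d j + 1)} (hc : ∀ j c', y ⟨j, c'⟩ / y ⟨j, c j⟩ ∈ O) :
    IsLocOf (stdChart k y c) O :=
  isLocOf_chart hO (fun j => ⟨mem_frameSpaces j _, h.ne_zero _⟩)
    fun j _ ha => div_mem_of_forall (hc j) ha

/-- On each factor some coordinate is a unit relative to `s j`; otherwise `s j / s j = 1`, a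
combination of such quotients, would lie in the maximal ideal. -/
theorem exists_stdChart {O : Subalgebra k κ} (hO : O ∈ projModel (frameSpaces k y)) :
    ∃ c : ∀ j, Fin (d j + 1), IsLocOf (stdChart k y c) O := by
  obtain ⟨s, hs, hloc⟩ := mem_projModel_iff.1 hO
  have := hloc.2.1
  have key : ∀ j, ∃ c, y ⟨j, c⟩ / s j ∉ maxSet O := by
    intro j
    by_contra hne
    push Not at hne
    have : ∀ a ∈ frameSpaces k y j, a / s j ∈ maxSet O := by
      intro a ha
      induction ha using Submodule.span_induction with
      | mem x hx =>
        obtain ⟨c, rfl⟩ := hx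
        exact hne c
      | zero => rw [zero_div]; exact zero_mem_maxSet O
      | add x y _ _ hx hy => rw [add_div]; exact add_mem_maxSet hx hy
      | smul r x _ hx => rw [smul_div_assoc]; exact smul_mem_maxSet r hx
    have h1 := this _ (hs j).1
    rw [div_self (hs j).2] at h1
    exact one_notMem_maxSet O h1
  choose c hc using key
  refine ⟨c, h.isLocOf_stdChart hO fun j c' => ?_⟩
  have h1 := hloc.1 (div_mem_chart (frameSpaces k y) s (mem_frameSpaces j (c j)))
  obtain ⟨-, h2⟩ := ne_zero_and_inv_mem_of_notMem_maxSet h1 (hc j)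
  have := O.mul_mem (hloc.1 (div_mem_chart (frameSpaces k y) s (mem_frameSpaces j c'))) h2
  rwa [inv_div, div_mul_div_cancel₀ (hs j).2] at this

theorem isProjectiveModel : IsProjectiveModel (projModel (frameSpaces k y)) := by
  refine ⟨m, frameSpaces k y, fun i => ⟨fun h0 => ?_, ?_⟩, ?_, rfl⟩
  · have := h.one_mem_frameSpaces i
    rw [h0, Submodule.mem_bot] at this
    exact one_ne_zero this
  · exact FiniteDimensional.span_of_finite k (Set.finite_range _)
  · rw [eq_top_iff, ← h.adjoin]
    apply IntermediateField.adjoin.mono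
    rintro _ ⟨⟨j, c⟩, rfl⟩
    exact ⟨j, y ⟨j, c⟩, mem_frameSpaces j c, 1, h.one_mem_frameSpaces j, (div_one _).symm⟩

/-- Every local ring is a localization of a standard chart, which is a polynomial ring. -/
theorem isSmoothModel : IsSmoothModel (projModel (frameSpaces k y)) := by
  intro O hO
  obtain ⟨c, hc⟩ := h.exists_stdChart hO
  obtain ⟨p, hp, -, hp'⟩ := hc.exists_prime
  obtain ⟨e, -⟩ := h.exists_stdChart_equiv c
  have : Algebra.FormallySmooth k (stdChart k y c) := Algebra.FormallySmooth.of_equiv e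
  let alg : Algebra (stdChart k y c) O := (Subalgebra.inclusion hc.1).toRingHom.toAlgebra
  have htower : IsScalarTower k (stdChart k y c) O := IsScalarTower.of_algebraMap_eq fun _ => rfl
  have hcoe : ∀ a : stdChart k y c, ((algebraMap (stdChart k y c) O a : O) : κ) = a := fun _ => rfl
  have hunit : ∀ b : p.primeCompl, ∃ hb : ((b : stdChart k y c) : κ) ≠ 0,
      ((b : stdChart k y c) : κ)⁻¹ ∈ O := fun b =>
    let hb := ne_zero_and_inv_mem_of_notMem_maxSet (hc.1 b.1.2) fun hm => b.2 ((hp' b).2 hm)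
    ⟨hb.1, hb.2⟩
  have hloc : IsLocalization p.primeCompl O := by
    refine ⟨fun b => ?_, fun x => ?_, fun {a b} hab => ⟨1, ?_⟩⟩
    · obtain ⟨hb0, hbi⟩ := hunit b
      exact ⟨⟨_, ⟨_, hbi⟩, Subtype.ext (mul_inv_cancel₀ hb0), Subtype.ext (inv_mul_cancel₀ hb0)⟩, rfl⟩
    · obtain ⟨a, ha, b, hb, hb0, hbi, hx⟩ := hc.2.2 x x.2
      refine ⟨⟨⟨a, ha⟩, ⟨⟨b, hb⟩, fun hbp => notMem_maxSet_of_inv_mem hb0 hbi ((hp' _).1 hbp)⟩⟩, ?_⟩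
      apply Subtype.ext
      change (x : κ) * b = a
      rw [hx, div_mul_cancel₀ _ hb0]
    · have : a = b := Subtype.ext (congrArg (fun z : O => (z : κ)) hab)
      rw [this]
  have : Algebra.FormallySmooth (stdChart k y c) O :=
    Algebra.FormallySmooth.of_isLocalization p.primeCompl
  exact Algebra.FormallySmooth.comp k (stdChart k y c) O

-- The twisted map `w j * f` is injective on the finite-dimensional space of forms of a factor,
-- hence also surjective.
omit h in
theorem _root_.Burnside.IsFrameAction.exists_smul {f : κ ≃ₐ[k] κ} (hf : IsFrameAction y f) :
    ∃ w : Fin m → κ, (∀ j, w j ≠ 0) ∧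
      (∀ j a, a ∈ frameSpaces k y j → w j * f a ∈ frameSpaces k y j) ∧
      ∀ j, ∀ b ∈ frameSpaces k y j, ∃ a ∈ frameSpaces k y j, b = w j * f a := by
  choose w hw0 hw using hf
  have h1 : ∀ j a, a ∈ frameSpaces k y j → w j * f a ∈ frameSpaces k y j := by
    intro j a ha
    induction ha using Submodule.span_induction with
    | mem x hx =>
      obtain ⟨c, rfl⟩ := hx
      exact hw j c
    | zero => simp
    | add x y _ _ hx hy => rw [map_add, mul_add]; exact add_mem hx hy
    | smul r x _ hx => rw [map_smul, mul_smul_comm]; exact Submodule.smul_mem _ _ hx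
  refine ⟨w, hw0, h1, fun j b hb => ?_⟩
  have : FiniteDimensional k (frameSpaces k y j) :=
    FiniteDimensional.span_of_finite k (Set.finite_range _)
  let F : frameSpaces k y j →ₗ[k] frameSpaces k y j :=
    ((LinearMap.mulLeft k (w j)).comp f.toLinearMap).restrict (h1 j)
  have hF : Function.Injective F := by
    intro a a' haa
    have h2 : w j * f a = w j * f a' := congrArg (fun z : frameSpaces k y j => (z : κ)) haa
    exact Subtype.ext (f.injective (mul_left_cancel₀ (hw0 j) h2))
  obtain ⟨a, ha⟩ := LinearMap.injective_iff_surjective.1 hF ⟨b, hb⟩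
  exact ⟨a, a.2, (congrArg (fun z : frameSpaces k y j => (z : κ)) ha).symm⟩

omit h in
theorem actsOn {Y : Subgroup (κ ≃ₐ[k] κ)} (hY : ∀ f ∈ Y, IsFrameAction y f) :
    ActsOn Y (projModel (frameSpaces k y)) := by
  intro f hf O hO
  obtain ⟨w, hw0, h1, h2⟩ := (hY f hf).exists_smul
  exact map_mem_projModel hO f hw0 h1 h2

end IsProjFrame

end ProductModel

/-! ### The Picard group of a product of projective spaces -/

section Picard

variable {k : Type u} [Field k] {κ : Type u} [Field κ] [Algebra k κ] {m : ℕ} {d : Fin m → ℕ}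
  {y : (Σ j : Fin m, Fin (d j + 1)) → κ}

instance {M : Set (Subalgebra k κ)} (P : PrimeDivisor M) : IsDiscreteValuationRing P.1 := P.2.2

/-- The `j`th coordinate functions are not all regular along the divisor. -/
def IsAtInfinity (k : Type u) [Field k] [Algebra k κ] (y : (Σ j : Fin m, Fin (d j + 1)) → κ)
    (j : Fin m) (P : Subalgebra k κ) : Prop := ∃ c, y ⟨j, c⟩ ∉ P

namespace IsProjFrame

variable (h : IsProjFrame k y)
include h

theorem exists_isOrd (P : PrimeDivisor (projModel (frameSpaces k y))) {f : κ} (hf : f ≠ 0) :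
    ∃ n, IsOrd P.1 f n := by
  refine Burnside.exists_isOrd (fun x => ?_) hf
  obtain ⟨c, hc⟩ := h.exists_stdChart P.2.1
  obtain ⟨a, ha, b, hb, hb0, rfl⟩ := h.exists_eq_div_stdChart c x
  exact ⟨a, hc.1 ha, b, hc.1 hb, hb0, rfl⟩

/-- In a chart at the divisor, infinity on the factor `j` is given by the vanishing of the variable
`1 / y ⟨j, c j⟩`. This prime element generates the maximal ideal, and no other variable is divisible
by it. -/
theorem stdCoord_spec_of_isAtInfinity {P : Subalgebra k κ} [IsDiscreteValuationRing P]
    {c : ∀ j, Fin (d j + 1)} (hc : IsLocOf (stdChart k y c) P) {j : Fin m}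
    (hj : IsAtInfinity k y j P) :
    c j ≠ 0 ∧ (∃ g : stdChart k y c, (g : κ) = (y ⟨j, c j⟩)⁻¹ ∧ Irreducible (⟨g, hc.1 g.2⟩ : P) ∧
      ∀ a : stdChart k y c, (a : κ) ∈ maxSet P ↔ g ∣ a) ∧
    ∀ a : Σ j : Fin m, Fin (d j + 1), a ≠ ⟨j, 0⟩ → y a / y ⟨a.1, c a.1⟩ ∉ maxSet P := by
  have hmem : ∀ i c', y ⟨i, c'⟩ / y ⟨i, c i⟩ ∈ P := fun i c' =>
    hc.1 (div_mem_chart (frameSpaces k y) (fun j => y ⟨j, c j⟩) (mem_frameSpaces i c'))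
  have hinv : (y ⟨j, c j⟩)⁻¹ ∈ maxSet P := by
    have h1 : (y ⟨j, c j⟩)⁻¹ ∈ P := by
      have := hmem j 0
      rwa [h.zero, one_div] at this
    by_contra hne
    obtain ⟨-, h2⟩ := ne_zero_and_inv_mem_of_notMem_maxSet h1 hne
    rw [inv_inv] at h2
    obtain ⟨c', hc'⟩ := hj
    refine hc' ?_
    have := P.mul_mem (hmem j c') h2
    rwa [div_mul_cancel₀ _ (h.ne_zero _)] at this
  have hcj : c j ≠ 0 := by
    intro h0
    rw [h0, h.zero, inv_one] at hinv
    exact one_notMem_maxSet P hinv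
  obtain ⟨e, he⟩ := h.exists_stdChart_equiv c
  let v : {a : Σ j : Fin m, Fin (d j + 1) // a.2 ≠ c a.1} := ⟨⟨j, 0⟩, hcj.symm⟩
  have hev : (e (MvPolynomial.X v) : κ) = (y ⟨j, c j⟩)⁻¹ := by
    rw [he, stdCoord, h.zero, one_div]
  have hprime : Prime (e (MvPolynomial.X v)) :=
    (MulEquiv.prime_iff e.toMulEquiv).2 MvPolynomial.X_prime
  obtain ⟨hirr, hdvd⟩ := hc.maxSet_iff_dvd hprime (by rw [hev]; exact hinv)
  refine ⟨hcj, ⟨_, hev, hirr, hdvd⟩, fun a ha hm => ?_⟩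
  by_cases hac : a.2 = c a.1
  · have : y a / y ⟨a.1, c a.1⟩ = 1 := by
      rw [← hac]
      exact div_self (h.ne_zero a)
    rw [this] at hm
    exact one_notMem_maxSet P hm
  · have h1 : (e (MvPolynomial.X ⟨a, hac⟩) : κ) = y a / y ⟨a.1, c a.1⟩ := he _
    rw [← h1, hdvd, map_dvd_iff, MvPolynomial.X_dvd_X] at hm
    exact ha (congrArg Subtype.val hm.symm)

/-- No coordinate other than the one with index `⟨j, 0⟩` vanishes along `P`, so `P` is visible in
the chart used for `P'`. There both primes are generated by the same variable. -/
theorem eq_of_isAtInfinity {P P' : PrimeDivisor (projModel (frameSpaces k y))} {j : Fin m}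
    (hP : IsAtInfinity k y j P.1) (hP' : IsAtInfinity k y j P'.1) : P = P' := by
  obtain ⟨c, hc⟩ := h.exists_stdChart P.2.1
  obtain ⟨c', hc'⟩ := h.exists_stdChart P'.2.1
  obtain ⟨-, -, h1⟩ := h.stdCoord_spec_of_isAtInfinity hc hP
  obtain ⟨hcj', ⟨g', hg', -, hdvd'⟩, -⟩ := h.stdCoord_spec_of_isAtInfinity hc' hP'
  have hmem : ∀ i a, y ⟨i, a⟩ / y ⟨i, c i⟩ ∈ P.1 := fun i a =>
    hc.1 (div_mem_chart (frameSpaces k y) (fun j => y ⟨j, c j⟩) (mem_frameSpaces i a))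
  have hPc' : IsLocOf (stdChart k y c') P.1 := by
    refine h.isLocOf_stdChart P.2.1 fun i a => ?_
    have hne : (⟨i, c' i⟩ : Σ j : Fin m, Fin (d j + 1)) ≠ ⟨j, 0⟩ := by
      intro heq
      obtain ⟨rfl, h2⟩ := Sigma.mk.inj heq
      exact hcj' (eq_of_heq h2)
    obtain ⟨-, h3⟩ := ne_zero_and_inv_mem_of_notMem_maxSet (hmem i (c' i)) (h1 _ hne)
    have := P.1.mul_mem (hmem i a) h3
    rwa [inv_div, div_mul_div_cancel₀ (h.ne_zero _)] at this
  obtain ⟨-, ⟨g, hg, -, hdvd⟩, -⟩ := h.stdCoord_spec_of_isAtInfinity hPc' hP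
  have hgg : g = g' := Subtype.ext (hg.trans hg'.symm)
  refine Subtype.ext (hPc'.eq_of_maxSet hc' fun a ha => ?_)
  exact (hdvd ⟨a, ha⟩).trans (hgg ▸ (hdvd' ⟨a, ha⟩).symm)

theorem isOrd_neg_one {P : PrimeDivisor (projModel (frameSpaces k y))} {j : Fin m}
    (hP : IsAtInfinity k y j P.1) {s : κ} (hs : s ∈ frameSpaces k y j) (hs0 : s ≠ 0)
    (hdiv : ∀ a ∈ frameSpaces k y j, a / s ∈ P.1) : IsOrd P.1 s (-1) := by
  obtain ⟨c, hc⟩ := h.exists_stdChart P.2.1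
  obtain ⟨-, ⟨g, hg, hirr, -⟩, -⟩ := h.stdCoord_spec_of_isAtInfinity hc hP
  have h1 : IsOrd P.1 (y ⟨j, c j⟩) (-1) := by
    have := (isOrd_of_irreducible hirr).inv
    change IsOrd P.1 (g : κ)⁻¹ (-1) at this
    rwa [hg, inv_inv] at this
  have h2 : IsOrd P.1 (s / y ⟨j, c j⟩) 0 := by
    refine isOrd_zero (div_ne_zero hs0 (h.ne_zero _)) ?_ ?_
    · exact hc.1 (div_mem_chart (frameSpaces k y) (fun j => y ⟨j, c j⟩) hs)
    · rw [inv_div]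
      exact hdiv _ (mem_frameSpaces j _)
  have := h2.mul h1
  rwa [div_mul_cancel₀ _ (h.ne_zero _), zero_add] at this

theorem isOrd_zero_of_not_isAtInfinity {P : Subalgebra k κ} {j : Fin m}
    (hP : ¬ IsAtInfinity k y j P) {s : κ} (hs : s ∈ frameSpaces k y j) (hs0 : s ≠ 0)
    (hdiv : ∀ a ∈ frameSpaces k y j, a / s ∈ P) : IsOrd P s 0 := by
  refine isOrd_zero hs0 ?_ ?_
  · have hc : ∀ c, y ⟨j, c⟩ / 1 ∈ P := fun c => by
      rw [div_one]
      by_contra hc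
      exact hP ⟨c, hc⟩
    have := div_mem_of_forall hc hs
    rwa [div_one] at this
  · have := hdiv 1 (h.one_mem_frameSpaces j)
    rwa [one_div] at this

omit h in
theorem exists_div_mem (P : PrimeDivisor (projModel (frameSpaces k y))) (j : Fin m) :
    ∃ s ∈ frameSpaces k y j, s ≠ 0 ∧ ∀ a ∈ frameSpaces k y j, a / s ∈ P.1 := by
  obtain ⟨s, hs, hloc⟩ := mem_projModel_iff.1 P.2.1
  exact ⟨s j, (hs j).1, (hs j).2, fun a ha => hloc.1 (div_mem_chart _ _ ha)⟩

-- An element dividing all forms of the factor `j` locally generates the line bundle of the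
-- hyperplane at infinity, whose only contribution is a simple pole along that hyperplane.
open scoped Classical in
theorem isOrd_ite {P : PrimeDivisor (projModel (frameSpaces k y))} {j : Fin m}
    (hP : IsAtInfinity k y j P.1) (Q : PrimeDivisor (projModel (frameSpaces k y))) {s : κ}
    (hs : s ∈ frameSpaces k y j) (hs0 : s ≠ 0) (hdiv : ∀ a ∈ frameSpaces k y j, a / s ∈ Q.1) :
    IsOrd Q.1 s (-(if P = Q then 1 else 0)) := by
  split_ifs with hQ
  · subst hQ
    exact h.isOrd_neg_one hP hs hs0 hdiv
  · rw [neg_zero]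
    exact h.isOrd_zero_of_not_isAtInfinity (fun hq => hQ (h.eq_of_isAtInfinity hP hq)) hs hs0 hdiv

/-- A hyperplane at infinity is linearly equivalent to its translates. -/
theorem move_sub_mem_principal {Y : Subgroup (κ ≃ₐ[k] κ)} (hY : ∀ f ∈ Y, IsFrameAction y f)
    {f : κ ≃ₐ[k] κ} (hf : f ∈ Y) {P : PrimeDivisor (projModel (frameSpaces k y))} {j : Fin m}
    (hP : IsAtInfinity k y j P.1) :
    Finsupp.single (PrimeDivisor.move f (actsOn hY f hf) P) 1 - Finsupp.single P 1 ∈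
      principal (projModel (frameSpaces k y)) := by
  classical
  obtain ⟨w, hw0, hw1, hw2⟩ := (hY f hf).exists_smul
  refine ⟨Units.mk0 (w j) (hw0 j), fun Q => ?_⟩
  change IsOrd Q.1 (w j) _
  let Q' := PrimeDivisor.move f⁻¹ (actsOn hY _ (inv_mem hf)) Q
  have hQQ : PrimeDivisor.move f (actsOn hY f hf) Q' = Q := by
    refine Subtype.ext ?_
    ext x
    simp [Q', PrimeDivisor.move]
  -- Let `s` be a local generator of the forms at `Q' = f⁻¹ Q`. Then `f s` has at `Q` the order of
  -- `s` at `Q'`, while `w j * f s` is a local generator at `Q`. Comparing them, `w j` has order [P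
  -- = Q'] - [P = Q] at `Q`, so its divisor is `f P - P`.
  obtain ⟨s, hs, hs0, hdiv⟩ := exists_div_mem Q' j
  have h1 := (h.isOrd_ite hP Q' hs hs0 hdiv).map f
  change IsOrd (PrimeDivisor.move f (actsOn hY f hf) Q').1 _ _ at h1
  rw [hQQ] at h1
  have hfs : f s ≠ 0 := by simpa using hs0
  have h2 := h.isOrd_ite hP Q (hw1 j s hs) (mul_ne_zero (hw0 j) hfs) (by
    intro b hb
    obtain ⟨a, ha, rfl⟩ := hw2 j b hb
    rw [mul_div_mul_left _ _ (hw0 j), ← map_div₀, ← hQQ]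
    exact ⟨_, hdiv a ha, rfl⟩)
  have h3 := h2.mul h1.inv
  rw [mul_inv_cancel_right₀ hfs, neg_neg] at h3
  convert h3 using 1
  have hiff : P = Q' ↔ PrimeDivisor.move f (actsOn hY f hf) P = Q := by
    conv_rhs => rw [← hQQ]
    exact (PrimeDivisor.move_injective f (actsOn hY f hf)).eq_iff.symm
  rw [Finsupp.sub_apply, Finsupp.single_apply, Finsupp.single_apply, ← if_congr hiff rfl rfl]
  ring

theorem finite_isAtInfinity :
    {P : PrimeDivisor (projModel (frameSpaces k y)) | ∃ j, IsAtInfinity k y j P.1}.Finite := by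
  rw [Set.ofPred_exists]
  refine Set.finite_iUnion fun j => Set.Subsingleton.finite fun P hP P' hP' =>
    h.eq_of_isAtInfinity hP hP'

theorem isLocOf_stdChart_zero {P : PrimeDivisor (projModel (frameSpaces k y))}
    (hP : ∀ j, ¬ IsAtInfinity k y j P.1) : IsLocOf (stdChart k y fun _ => 0) P.1 := by
  refine h.isLocOf_stdChart P.2.1 fun j c' => ?_
  rw [h.zero, div_one]
  by_contra hc
  exact hP j ⟨c', hc⟩

/-- A prime divisor that meets the standard affine chart is the zero divisor of a function on this
chart. -/
theorem exists_prime_isOrd {P : PrimeDivisor (projModel (frameSpaces k y))}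
    (hP : ∀ j, ¬ IsAtInfinity k y j P.1) : ∃ g : κ, IsOrd P.1 g 1 ∧
      ∀ Q : PrimeDivisor (projModel (frameSpaces k y)), (∀ j, ¬ IsAtInfinity k y j Q.1) → Q ≠ P →
        IsOrd Q.1 g 0 := by
  have hloc := h.isLocOf_stdChart_zero hP
  have := h.uniqueFactorizationMonoid_stdChart (fun _ => 0)
  obtain ⟨p, hp, -, hp'⟩ := hloc.exists_prime
  have hpb : p ≠ ⊥ := by
    intro hpb
    obtain ⟨ϖ, hϖ⟩ := IsDiscreteValuationRing.exists_irreducible P.1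
    obtain ⟨a, ha, b, hb, hb0, hbi, hab⟩ := hloc.2.2 ϖ ϖ.2
    have h1 : a ∈ maxSet P.1 := by
      have := mul_mem_maxSet' (hloc.1 hb) (irreducible_coe_mem_maxSet hϖ)
      rwa [hab, div_mul_cancel₀ _ hb0] at this
    have h2 := (hp' ⟨a, ha⟩).2 h1
    rw [hpb, Ideal.mem_bot] at h2
    have h3 : a = 0 := congrArg Subtype.val h2
    exact coe_irreducible_ne_zero hϖ (by rw [hab, h3, zero_div])
  obtain ⟨g, hgp, hg⟩ := hp.exists_mem_prime_of_ne_bot hpb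
  obtain ⟨hirr, hdvd⟩ := hloc.maxSet_iff_dvd hg ((hp' g).1 hgp)
  refine ⟨g, isOrd_of_irreducible hirr, fun Q hQ hne => ?_⟩
  have hlocQ := h.isLocOf_stdChart_zero hQ
  have hgQ : (g : κ) ∉ maxSet Q.1 := by
    intro hm
    obtain ⟨-, hdvd'⟩ := hlocQ.maxSet_iff_dvd hg hm
    exact hne (Subtype.ext (hlocQ.eq_of_maxSet hloc fun a ha =>
      (hdvd' ⟨a, ha⟩).trans (hdvd ⟨a, ha⟩).symm))
  obtain ⟨h1, h2⟩ := ne_zero_and_inv_mem_of_notMem_maxSet (hlocQ.1 g.2) hgQ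
  exact isOrd_zero h1 (hlocQ.1 g.2) h2

/-- Every divisor is linearly equivalent to a combination of the hyperplanes at infinity. -/
theorem exists_sub_mem_principal (D : PrimeDivisor (projModel (frameSpaces k y)) →₀ ℤ) :
    ∃ E : PrimeDivisor (projModel (frameSpaces k y)) →₀ ℤ,
      (∀ P, (∀ j, ¬ IsAtInfinity k y j P.1) → E P = 0) ∧
      D - E ∈ principal (projModel (frameSpaces k y)) := by
  classical
  induction D using Finsupp.induction_linear with
  | zero => exact ⟨0, fun _ _ => rfl, by simp⟩
  | add D D' hD hD' =>
    obtain ⟨E, hE, hDE⟩ := hD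
    obtain ⟨E', hE', hDE'⟩ := hD'
    refine ⟨E + E', fun P hP => by rw [Finsupp.add_apply, hE P hP, hE' P hP, add_zero], ?_⟩
    rw [add_sub_add_comm]
    exact add_mem hDE hDE'
  | single P n =>
    suffices H : ∃ E : PrimeDivisor (projModel (frameSpaces k y)) →₀ ℤ,
        (∀ P, (∀ j, ¬ IsAtInfinity k y j P.1) → E P = 0) ∧
        Finsupp.single P 1 - E ∈ principal (projModel (frameSpaces k y)) by
      obtain ⟨E, hE, hPE⟩ := H
      refine ⟨n • E, fun Q hQ => by rw [Finsupp.smul_apply, hE Q hQ, smul_zero], ?_⟩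
      have := Submodule.smul_mem _ n hPE
      rwa [smul_sub, Finsupp.smul_single, smul_eq_mul, mul_one] at this
    by_cases hP : ∀ j, ¬ IsAtInfinity k y j P.1
    · obtain ⟨g, hg1, hg2⟩ := h.exists_prime_isOrd hP
      have hg0 : g ≠ 0 := hg1.ne_zero
      choose n hn using fun Q => h.exists_isOrd Q hg0
      -- Outside the finitely many hyperplanes at infinity and `P` itself, the function `g` has
      -- order 0.
      have hfin : n.support.Finite := by
        refine (h.finite_isAtInfinity.union (Set.finite_singleton P)).subset fun Q hQ => ?_
        by_contra hne
        simp only [Set.mem_union, Set.mem_ofPred_eq, Set.mem_singleton_iff, not_or, not_exists] at hne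
        exact hQ ((hn Q).unique (hg2 Q hne.1 hne.2))
      have hD : Finsupp.ofSupportFinite n hfin ∈ principal (projModel (frameSpaces k y)) :=
        ⟨Units.mk0 g hg0, hn⟩
      refine ⟨Finsupp.single P 1 - Finsupp.ofSupportFinite n hfin, fun Q hQ => ?_, ?_⟩
      · rw [Finsupp.sub_apply, Finsupp.single_apply]
        change _ - n Q = 0
        split_ifs with hPQ
        · subst hPQ
          rw [(hn P).unique hg1, sub_self]
        · rw [(hn Q).unique (hg2 Q hQ (Ne.symm hPQ)), sub_zero]
      · rw [sub_sub_cancel]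
        exact hD
    · refine ⟨Finsupp.single P 1, fun Q hQ => ?_, by rw [sub_self]; exact zero_mem _⟩
      rw [Finsupp.single_apply, if_neg]
      rintro rfl
      exact hP hQ

/-- The function has neither zeros nor poles on the standard affine chart. -/
theorem exists_eq_algebraMap {f : κ} (hf : f ≠ 0)
    (hP : ∀ P : PrimeDivisor (projModel (frameSpaces k y)), (∀ j, ¬ IsAtInfinity k y j P.1) →
      IsOrd P.1 f 0) : ∃ c : k, f = algebraMap k κ c := by
  set A := stdChart k y fun _ => 0
  have hufd : UniqueFactorizationMonoid A := h.uniqueFactorizationMonoid_stdChart (fun _ => 0)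
  obtain ⟨e, -⟩ := h.exists_stdChart_equiv fun _ => 0
  have hconst : ∀ a : A, IsUnit a → ∃ c : k, (a : κ) = algebraMap k κ c := by
    intro a ha
    have h1 : IsUnit (e.symm a) := ha.map e.symm
    obtain ⟨c, -, hc⟩ := MvPolynomial.isUnit_iff_eq_C_of_isReduced.1 h1
    refine ⟨c, ?_⟩
    rw [AlgEquiv.symm_apply_eq] at hc
    rw [hc, ← MvPolynomial.algebraMap_eq, AlgEquiv.commutes]
    rfl
  -- Every prime element of the affine chart defines a prime divisor of the model, so the hypothesis
  -- on orders can be tested on each prime factor.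
  have hM : ∀ (g : A), Prime g → ∃ P : PrimeDivisor (projModel (frameSpaces k y)),
      (∀ j, ¬ IsAtInfinity k y j P.1) ∧ A ≤ P.1 ∧ ∀ a : A, g ∣ a ↔ (a : κ) ∈ maxSet P.1 := by
    intro g hg
    have hp : (Ideal.span {g}).IsPrime := (Ideal.span_singleton_prime hg.ne_zero).2 hg
    obtain ⟨h1, h2⟩ := isLocOf_localRingAt A (Ideal.span {g})
    refine ⟨⟨localRingAt A (Ideal.span {g}), ⟨_, fun j => ⟨mem_frameSpaces j 0, h.ne_zero _⟩, _, hp,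
      rfl⟩, isDiscreteValuationRing_localRingAt hg⟩, ?_, h1.1, fun a => ?_⟩
    · rintro j ⟨c, hc⟩
      refine hc (h1.1 ?_)
      have := div_mem_chart (frameSpaces k y) (fun j => y ⟨j, 0⟩) (mem_frameSpaces j c)
      rwa [h.zero, div_one] at this
    · rw [← h2, Ideal.mem_span_singleton]
  obtain ⟨a₀, ha₀, b₀, hb₀, hb0, hfab⟩ := h.exists_eq_div_stdChart (fun _ => 0) f
  obtain ⟨a, b, c, hrel, hca, hcb⟩ := UniqueFactorizationMonoid.exists_reduced_factors'
    (⟨a₀, ha₀⟩ : A) ⟨b₀, hb₀⟩ fun h' => hb0 (congrArg Subtype.val h')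
  have hca' : (c : κ) * a = a₀ := congrArg Subtype.val hca
  have hcb' : (c : κ) * b = b₀ := congrArg Subtype.val hcb
  rw [← hcb'] at hb0
  have hc0 := left_ne_zero_of_mul hb0
  have hb0' := right_ne_zero_of_mul hb0
  rw [← hca', ← hcb', mul_div_mul_left _ _ hc0] at hfab
  have ha0 : (a : κ) ≠ 0 := fun h0 => hf (by rw [hfab, h0, zero_div])
  -- Along the divisor of a prime factor of the numerator `a`, `f⁻¹` is regular, so the denominator
  -- `b = f⁻¹ * a` vanishes there too. This contradicts that the fraction is reduced.
  have hau : IsUnit a := by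
    by_contra hau
    obtain ⟨g, hg, hga⟩ := WfDvdMonoid.exists_irreducible_factor hau
      fun h0 => ha0 (congrArg Subtype.val h0)
    obtain ⟨P, hPi, hAP, hP'⟩ := hM g hg.prime
    obtain ⟨-, -, hfi⟩ := isOrd_zero_iff.1 (hP P hPi)
    have h1 := mul_mem_maxSet hfi ((hP' a).1 hga)
    rw [hfab, inv_div, div_mul_cancel₀ _ ha0, ← hP'] at h1
    exact hg.not_isUnit (hrel hga h1)
  have hbu : IsUnit b := by
    by_contra hbu
    obtain ⟨g, hg, hgb⟩ := WfDvdMonoid.exists_irreducible_factor hbu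
      fun h0 => hb0' (congrArg Subtype.val h0)
    obtain ⟨P, hPi, hAP, hP'⟩ := hM g hg.prime
    obtain ⟨-, hfm, -⟩ := isOrd_zero_iff.1 (hP P hPi)
    have h1 := mul_mem_maxSet hfm ((hP' b).1 hgb)
    rw [hfab, div_mul_cancel₀ _ hb0', ← hP'] at h1
    exact hg.not_isUnit (hrel h1 hgb)
  obtain ⟨α, hα⟩ := hconst a hau
  obtain ⟨β, hβ⟩ := hconst b hbu
  exact ⟨α / β, by rw [hfab, hα, hβ, map_div₀]⟩

/-- Torsion-freeness of the Picard group: replace `D` by an equivalent `E` supported at infinity. A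
function with divisor `n • E` has neither zeros nor poles on affine space, so it is constant and `E
= 0`. -/
theorem mem_principal_of_smul_mem {D : PrimeDivisor (projModel (frameSpaces k y)) →₀ ℤ} {n : ℤ}
    (hn : n ≠ 0) (hD : n • D ∈ principal (projModel (frameSpaces k y))) :
    D ∈ principal (projModel (frameSpaces k y)) := by
  obtain ⟨E, hE, hDE⟩ := h.exists_sub_mem_principal D
  have h1 : n • E ∈ principal (projModel (frameSpaces k y)) := by
    have := sub_mem hD (Submodule.smul_mem _ n hDE)
    rwa [smul_sub, sub_sub_cancel] at this
  obtain ⟨f, hf⟩ := h1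
  have hf' : ∀ P, IsOrd P.1 (f : κ) ((n • E) P) := hf
  obtain ⟨c, hc⟩ := h.exists_eq_algebraMap f.ne_zero fun P hP => by
    have := hf' P
    rwa [Finsupp.smul_apply, hE P hP, smul_zero] at this
  have hE0 : E = 0 := by
    ext P
    have h2 : IsOrd P.1 (f : κ) 0 := by
      refine isOrd_zero f.ne_zero ?_ ?_
      · rw [hc]
        exact P.1.algebraMap_mem c
      · rw [hc, ← map_inv₀]
        exact P.1.algebraMap_mem _
    have h3 := (hf' P).unique h2
    rw [Finsupp.smul_apply, smul_eq_mul] at h3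
    exact (mul_eq_zero.1 h3).resolve_left hn
  rwa [hE0, sub_zero] at hDE

/-- The hyperplanes at infinity generate the Picard group, and each is equivalent to its translates
since the factors are not permuted. -/
theorem picRep_eq_one {Y : Subgroup (κ ≃ₐ[k] κ)} (hY : ∀ f ∈ Y, IsFrameAction y f)
    (hact : ActsOn Y (projModel (frameSpaces k y))) (f : Y)
    (x : Pic (projModel (frameSpaces k y))) : picRep hact f x = x := by
  obtain ⟨D, rfl⟩ := Submodule.Quotient.mk_surjective _ x
  obtain ⟨E, hE, hDE⟩ := h.exists_sub_mem_principal D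
  rw [(Submodule.Quotient.eq _).2 hDE]
  change Submodule.Quotient.mk (Finsupp.lmapDomain ℤ ℤ (PrimeDivisor.move f.1 (hact f.1 f.2)) E) = _
  rw [Submodule.Quotient.eq]
  clear hDE D
  have hsum : Finsupp.lmapDomain ℤ ℤ (PrimeDivisor.move f.1 (hact f.1 f.2)) E - E =
      E.sum fun P n => n • (Finsupp.single (PrimeDivisor.move f.1 (hact f.1 f.2) P) (1 : ℤ) -
        Finsupp.single P 1) := by
    simp only [smul_sub, Finsupp.smul_single, smul_eq_mul, mul_one]
    rw [Finsupp.sum_sub, Finsupp.sum_single]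
    rfl
  rw [hsum]
  refine Submodule.sum_mem _ fun P hP => Submodule.smul_mem _ _ ?_
  have hP' : ∃ j, IsAtInfinity k y j P.1 := by
    by_contra hne
    push Not at hne
    exact Finsupp.mem_support_iff.1 hP (hE P hne)
  obtain ⟨j, hj⟩ := hP'
  exact h.move_sub_mem_principal hY f.2 hj

/-- The action on the Picard group is trivial, so cocycles are homomorphisms from a finite group to
a torsion-free one. -/
theorem isH1Trivial {Y : Subgroup (κ ≃ₐ[k] κ)} [Finite Y] (hY : ∀ f ∈ Y, IsFrameAction y f) :
    IsH1Trivial Y := by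
  refine ⟨projModel (frameSpaces k y), actsOn hY, h.isProjectiveModel, h.isSmoothModel,
    fun Y' hle F hF => ⟨0, fun g => ?_⟩⟩
  have hfin : Finite Y' := Finite.of_injective _ (Subgroup.inclusion_injective hle)
  have hadd : ∀ a b, F (a * b) = F b + F a := fun a b => by
    rw [hF]
    exact congrArg (· + F a) (h.picRep_eq_one (fun f hf => hY f (hle hf))
      (fun f hf => actsOn hY f (hle hf)) a (F b))
  have hone : F 1 = 0 := by
    have := hadd 1 1
    rwa [mul_one, left_eq_add] at this
  have hpow : ∀ n : ℕ, F (g ^ n) = (n : ℤ) • F g := by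
    intro n
    induction n with
    | zero => rw [pow_zero, hone, Nat.cast_zero, zero_smul]
    | succ n ih => rw [pow_succ, hadd, ih, Nat.cast_succ, add_smul, one_smul, add_comm]
  have h0 : (Nat.card Y' : ℤ) • F g = 0 := by
    rw [← hpow, pow_card_eq_one', hone]
  obtain ⟨D, hD⟩ := Submodule.Quotient.mk_surjective _ (F g)
  rw [← hD, ← Submodule.Quotient.mk_smul, Submodule.Quotient.mk_eq_zero] at h0
  rw [map_zero, sub_zero, ← hD, Submodule.Quotient.mk_eq_zero]
  exact h.mem_principal_of_smul_mem (by exact_mod_cast Nat.card_pos.ne') h0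

end IsProjFrame

end Picard

/-! ### The symbol of a maximal stratum -/

section Duality

variable {k : Type u} [Field k]

/-- A group of characters that separates the points is the whole dual group. -/
theorem eq_top_of_separates [IsAlgClosed k] [CharZero k] {A : Type*} [CommGroup A] [Finite A]
    (Λ : Subgroup (A →* kˣ)) (h : ∀ a, (∀ χ ∈ Λ, χ a = 1) → a = 1) : Λ = ⊤ := by
  have : NeZero ((Monoid.exponent A : ℕ) : k) :=
    ⟨by exact_mod_cast Monoid.exponent_ne_zero_of_finite⟩
  have hA : Nat.card (A →* kˣ) = Nat.card A := CommGroup.card_monoidHom_of_hasEnoughRootsOfUnity A k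
  have hAfin : Finite (A →* kˣ) := Nat.finite_of_card_ne_zero (hA ▸ Nat.card_pos.ne')
  have : NeZero ((Monoid.exponent Λ : ℕ) : k) :=
    ⟨by exact_mod_cast Monoid.exponent_ne_zero_of_finite⟩
  have hΛ : Nat.card (Λ →* kˣ) = Nat.card Λ := CommGroup.card_monoidHom_of_hasEnoughRootsOfUnity Λ k
  have hΛfin : Finite (Λ →* kˣ) := Nat.finite_of_card_ne_zero (hΛ ▸ Nat.card_pos.ne')
  -- Separation of points means that evaluation embeds `A` in the dual of `Λ`. Hence `Λ` has at
  -- least as many elements as `A`, and so as the dual of `A`.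
  let ev : A →* (Λ →* kˣ) :=
    { toFun := fun a =>
        { toFun := fun χ => (χ : A →* kˣ) a
          map_one' := rfl
          map_mul' := fun _ _ => rfl }
      map_one' := by ext; simp
      map_mul' := fun a b => by ext; simp }
  have hev : Function.Injective ev := by
    rw [injective_iff_map_eq_one]
    intro a ha
    exact h a fun χ hχ => DFunLike.congr_fun ha ⟨χ, hχ⟩
  have h1 := Nat.card_le_card_of_injective ev hev
  rw [hΛ, ← hA] at h1
  exact Subgroup.eq_top_of_le_card _ h1

theorem exists_character {K : Type*} [Field K] [Algebra k K] {Q : Type*} [Group Q]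
    (φ : Q →* (K ≃ₐ[k] K)) (H : Subgroup Q) {x : K} (hx : x ≠ 0)
    (h : ∀ q ∈ H, ∃ c : kˣ, φ q x = (c : k) • x) :
    ∃ χ : H →* kˣ, ∀ q : H, φ q x = ((χ q : kˣ) : k) • x := by
  choose c hc using fun q : H => h q q.2
  have huniq : ∀ a b : kˣ, (a : k) • x = (b : k) • x → a = b := fun a b hab =>
    Units.ext (smul_left_injective k hx hab)
  refine ⟨⟨⟨c, huniq _ _ ?_⟩, fun q q' => huniq _ _ ?_⟩, hc⟩
  · rw [← hc]
    simp
  · change (c (q * q') : k) • x = ((c q * c q' : kˣ) : k) • x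
    rw [← hc, Subgroup.coe_mul, map_mul, AlgEquiv.mul_apply, hc q', map_smul, hc q, smul_smul,
      Units.val_mul, mul_comm]

end Duality

/-! ### The stabilizer acting on the residue field, and the symbol of a stratum -/

section Residue

variable {k : Type u} [Field k] {K : Type u} [Field K] [Algebra k K] {Q : Type v} [Group Q]
  {φ : Q →* (K ≃ₐ[k] K)} {O : Subalgebra k K} {κ : Type u} [Field κ] [Algebra k κ]
  {π : O →ₐ[k] κ}

/-- The action of the stabilizer on the local ring. -/
def localAction (φ : Q →* (K ≃ₐ[k] K)) (O : Subalgebra k K) (z : stab φ O) : O →ₐ[k] O :=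
  ((φ z : K →ₐ[k] K).comp O.val).codRestrict O fun x => mem_of_map_eq z.2 x.2

theorem coe_localAction (z : stab φ O) (x : O) : (localAction φ O z x : K) = φ z x := rfl

theorem localAction_mul (z z' : stab φ O) (x : O) :
    localAction φ O (z * z') x = localAction φ O z (localAction φ O z' x) := by
  apply Subtype.ext
  simp only [coe_localAction, Subgroup.coe_mul, map_mul, AlgEquiv.mul_apply]

theorem localAction_one (x : O) : localAction φ O 1 x = x := by
  apply Subtype.ext
  simp [coe_localAction]

theorem exists_residueMap [IsLocalRing O] (hπ : Function.Surjective π) (z : stab φ O) :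
    ∃ f : κ →ₐ[k] κ, ∀ x, f (π x) = π (localAction φ O z x) := by
  let F : (O ⧸ RingHom.ker π) →ₐ[k] κ :=
    Ideal.Quotient.liftₐ (RingHom.ker π) (π.comp (localAction φ O z)) (by
      intro a ha
      rw [RingHom.mem_ker, ker_eq_maxSet hπ] at ha
      rw [AlgHom.comp_apply, ker_eq_maxSet hπ, coe_localAction]
      exact mem_maxSet_of_map_eq z.2 ha)
  refine ⟨F.comp (Ideal.quotientKerAlgEquivOfSurjective hπ).symm.toAlgHom, fun x => ?_⟩
  have h1 : (Ideal.quotientKerAlgEquivOfSurjective hπ).symm (π x) =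
      Ideal.Quotient.mk (RingHom.ker π) x := by
    rw [AlgEquiv.symm_apply_eq]
    rfl
  change F ((Ideal.quotientKerAlgEquivOfSurjective hπ).symm (π x)) = _
  rw [h1]
  rfl

/-- The action of the stabilizer on the residue field. -/
theorem exists_residueAction [IsLocalRing O] (hπ : Function.Surjective π) :
    ∃ act : stab φ O →* (κ ≃ₐ[k] κ), ∀ z x, act z (π x) = π (localAction φ O z x) := by
  choose f hf using exists_residueMap (φ := φ) hπ
  have hmul : ∀ z z', f (z * z') = (f z).comp (f z') := by
    intro z z'
    ext y
    obtain ⟨x, rfl⟩ := hπ y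
    rw [hf, AlgHom.comp_apply, hf, hf, localAction_mul]
  have hone : f 1 = AlgHom.id k κ := by
    ext y
    obtain ⟨x, rfl⟩ := hπ y
    rw [hf, localAction_one]
    rfl
  refine ⟨⟨⟨fun z => AlgEquiv.ofAlgHom (f z) (f z⁻¹) ?_ ?_, ?_⟩, ?_⟩, hf⟩
  · rw [← hmul, mul_inv_cancel, hone]
  · rw [← hmul, inv_mul_cancel, hone]
  · ext y
    exact DFunLike.congr_fun hone y
  · intro z z'
    ext y
    exact DFunLike.congr_fun (hmul z z') y

theorem residueAction_eq_one_iff [IsLocalRing O] (hπ : Function.Surjective π)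
    {act : stab φ O →* (κ ≃ₐ[k] κ)} (hact : ∀ z x, act z (π x) = π (localAction φ O z x))
    (z : stab φ O) : act z = 1 ↔ (z : Q) ∈ inertia φ O := by
  rw [mem_inertia_iff]
  constructor
  · intro h
    refine ⟨z.2, fun x hx => ?_⟩
    have h1 := hact z ⟨x, hx⟩
    rw [h, AlgEquiv.one_apply, eq_comm, ← sub_eq_zero, ← map_sub, ker_eq_maxSet hπ] at h1
    exact h1
  · rintro ⟨-, h⟩
    ext y
    obtain ⟨x, rfl⟩ := hπ y
    rw [hact, AlgEquiv.one_apply, ← sub_eq_zero, ← map_sub, ker_eq_maxSet hπ]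
    exact h x x.2

/-- The symbol of a stratum on which the generic stabilizer acts diagonally in suitable
coordinates. -/
theorem exists_symb [IsAlgClosed k] [CharZero k] [Finite Q] (hφ : Function.Injective φ)
    {τ : Type*} [Fintype τ] {x : τ → K} (hx : AlgebraicIndependent k x)
    (hgen : IntermediateField.adjoin k (Set.range x) = ⊤)
    (hP : IsPolyLoc x {v | ∃ q ∈ inertia φ O, φ q (x v) ≠ x v} O)
    (hchar : ∀ v, ∀ q ∈ inertia φ O, ∃ c : kˣ, φ q (x v) = (c : k) • x v)
    (hcomm : ∀ a ∈ stab φ O, ∀ b ∈ inertia φ O, a * b = b * a) :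
    ∃ s : Symb k Q (Fintype.card τ), IsSymbolOf φ O s := by
  classical
  have hloc : IsLocalRing O := hP.1.2.1
  set P : Set τ := {v | ∃ q ∈ inertia φ O, φ q (x v) ≠ x v} with hPdef
  let H := inertiaGroup φ O
  let π : O →ₐ[k] IsLocalRing.ResidueField O :=
    { IsLocalRing.residue O with commutes' := fun _ => rfl }
  have hπ : Function.Surjective π := IsLocalRing.residue_surjective
  obtain ⟨act, hact⟩ := exists_residueAction (φ := φ) hπ
  choose χ hχ using fun v => exists_character φ H (hx.ne_zero v) (hchar v)
  have hχP : ∀ v ∈ P, χ v ≠ 1 := by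
    rintro v ⟨q, hq, hne⟩ h1
    refine hne ?_
    rw [hχ v ⟨q, hq⟩, h1]
    simp
  have hχP' : ∀ v ∉ P, χ v = 1 := by
    intro v hv
    ext q
    have h1 : φ q (x v) = x v := by
      by_contra hne
      exact hv ⟨q, q.2, hne⟩
    rw [hχ] at h1
    exact smul_left_injective k (hx.ne_zero v) (by simpa using h1)
  let E := Fintype.equivFin P
  let b : Fin (Fintype.card P) → (H →* kˣ) := fun i => χ (E.symm i)
  have hmem : ∀ c, c ∈ Finset.univ.val.map b ↔ ∃ v ∈ P, χ v = c := by
    intro c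
    simp only [Multiset.mem_map, Finset.mem_val, Finset.mem_univ, true_and]
    constructor
    · rintro ⟨i, rfl⟩
      exact ⟨_, (E.symm i).2, rfl⟩
    · rintro ⟨v, hv, rfl⟩
      exact ⟨E ⟨v, hv⟩, by simp [b]⟩
  have hcommH : ∀ a ∈ H, ∀ b ∈ H, a * b = b * a := fun a ha b hb => hcomm a ha.1 b hb
  -- An element on which all weights are trivial fixes every coordinate, hence the whole field, and
  -- is 1 by faithfulness. So the weights separate points.
  have hgenH : Subgroup.closure {c : H →* kˣ | c ∈ Finset.univ.val.map b} = ⊤ := by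
    let _ : CommGroup H := { (inferInstance : Group H) with
      mul_comm := fun a b => Subtype.ext (hcommH a a.2 b b.2) }
    refine eq_top_of_separates _ fun a ha => ?_
    have h1 : φ a = 1 := by
      have := algHom_ext_of_adjoin_eq_top hgen (f := (φ a).toAlgHom) (g := AlgHom.id k K) (by
        rintro _ ⟨v, rfl⟩
        change φ a (x v) = x v
        by_cases hv : v ∈ P
        · rw [hχ, ha (χ v) (Subgroup.subset_closure ((hmem _).2 ⟨v, hv, rfl⟩))]
          simp
        · rw [hχ, hχP' v hv]
          simp)
      ext y
      exact DFunLike.congr_fun this y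
    exact Subtype.ext (hφ (h1.trans (map_one φ).symm))
  have hdim : Algebra.trdeg k (IsLocalRing.ResidueField O) +
      (Multiset.card (Finset.univ.val.map b) : Cardinal) = (Fintype.card τ : Cardinal) := by
    rw [trdeg_eq_of_algebraicIndependent (hP.residue_algebraicIndependent hπ)
      (hP.residue_adjoin_eq_top hπ), Multiset.card_map, Finset.card_val, Finset.card_univ,
      Fintype.card_fin, ← Nat.cast_add, Fintype.card_compl_set,
      Nat.sub_add_cancel (set_fintype_card_le_univ P)]
  let s : Symb k Q (Fintype.card τ) :=
    { H := H
      H_comm := hcommH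
      Z := stab φ O
      H_le_Z := inertiaGroup_le_stab
      Z_le := fun z hz => Subgroup.mem_centralizer_iff.2 fun b hb => (hcomm z hz b hb).symm
      K := IsLocalRing.ResidueField O
      fg := IntermediateField.fg_def.2 ⟨_, Set.finite_range _, hP.residue_adjoin_eq_top hπ⟩
      act := act
      act_eq_one := residueAction_eq_one_iff hπ hact
      β := Finset.univ.val.map b
      one_notMem := fun h1 => by
        obtain ⟨v, hv, h2⟩ := (hmem 1).1 h1
        exact hχP v hv h2
      generate := hgenH
      dim := hdim }
  refine ⟨s, rfl, fun q => Iff.rfl, π, hπ, fun z a c hac => ?_, _,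
    fun i => ⟨x (E.symm i), hP.var_mem _⟩, b, ?_, ?_, ?_, rfl⟩
  · change π c = act z (π a)
    rw [hact]
    exact congrArg π (Subtype.ext hac)
  · have : Set.range (fun i => (⟨x (E.symm i), hP.var_mem _⟩ : O)) =
        Set.range fun v : P => (⟨x v, hP.var_mem v⟩ : O) :=
      E.symm.surjective.range_comp fun v : P => (⟨x v, hP.var_mem v⟩ : O)
    rw [this, hP.ker_residue hπ]
    exact sup_eq_left.2 (Ideal.pow_le_self two_ne_zero)
  · intro c hc i
    have h1 := hP.mem_ker_of_sum_mem_sq hx hπ (fun v => c (E v)) (by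
      convert hc using 1
      refine Fintype.sum_equiv E _ _ fun v => ?_
      simp) (E.symm i)
    simpa using h1
  · intro q i a ha
    have : a - algebraMap k O ((b i q : kˣ) : k) * ⟨x (E.symm i), hP.var_mem _⟩ = 0 := by
      apply Subtype.ext
      change (a : K) - algebraMap k K ((b i q : kˣ) : k) * x (E.symm i) = 0
      rw [ha, ← Algebra.smul_def, sub_eq_zero]
      exact hχ _ q
    rw [this]
    exact Ideal.zero_mem _

end Residue

/-! ### The class of a linear action -/

section TopStratum

variable {k : Type u} [Field k] {K : Type u} [Field K] [Algebra k K] {Q : Type v} [Group Q]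
  {φ : Q →* (K ≃ₐ[k] K)}

theorem mem_maxSet_top {x : K} : x ∈ maxSet (⊤ : Subalgebra k K) ↔ x = 0 := by
  constructor
  · intro h
    exact h.2.resolve_right fun h' => h' trivial
  · rintro rfl
    exact zero_mem_maxSet _

theorem isLocalRing_top : IsLocalRing (⊤ : Subalgebra k K) :=
  (isLocOf_top (A := ⊤) fun x => ⟨x, trivial, 1, trivial, one_ne_zero, (div_one x).symm⟩).2.1

theorem map_top (f : K ≃ₐ[k] K) : (⊤ : Subalgebra k K).map (f : K →ₐ[k] K) = ⊤ := by
  rw [Algebra.map_top, AlgHom.range_eq_top]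
  exact f.surjective

theorem inertia_top (hφ : Function.Injective φ) : inertia φ ⊤ = {1} := by
  ext q
  rw [mem_inertia_iff, Set.mem_singleton_iff]
  constructor
  · rintro ⟨-, h⟩
    apply hφ
    ext x
    rw [map_one, AlgEquiv.one_apply]
    exact sub_eq_zero.1 (mem_maxSet_top.1 (h x trivial))
  · rintro rfl
    refine ⟨map_top _, fun x _ => ?_⟩
    simpa using zero_mem_maxSet (⊤ : Subalgebra k K)

theorem IsSymbolOf.of_top (hφ : Function.Injective φ) {n : ℕ} {s : Symb k Q n}
    (h : IsSymbolOf φ ⊤ s) : s.H = ⊥ ∧ s.Z = ⊤ ∧ s.β = 0 := by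
  obtain ⟨h1, h2, π, hπ, -, r, e, b, he, hc, -, hβ⟩ := h
  have := isLocalRing_top (k := k) (K := K)
  refine ⟨?_, ?_, ?_⟩
  · apply SetLike.coe_injective
    rw [h1, inertia_top hφ, Subgroup.coe_bot]
  · rw [eq_top_iff]
    exact fun q _ => (h2 q).2 (map_top _)
  · have hr : IsEmpty (Fin r) := by
      by_contra hr
      rw [not_isEmpty_iff] at hr
      obtain ⟨i⟩ := hr
      have he0 : ∀ i, e i = 0 := by
        intro i
        have h3 : e i ∈ RingHom.ker π := by
          rw [← he]
          exact Ideal.mem_sup_left (Ideal.subset_span ⟨i, rfl⟩)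
        rw [RingHom.mem_ker, ker_eq_maxSet hπ, mem_maxSet_top] at h3
        exact Subtype.ext h3
      have h4 := hc (fun _ => 1) (by simp [he0]) i
      rw [RingHom.mem_ker, map_one] at h4
      exact one_ne_zero h4
    rw [hβ, Finset.univ_eq_empty]
    rfl

theorem eq_top_of_map_eq_top {O : Subalgebra k K} {f : K ≃ₐ[k] K}
    (h : O.map (f : K →ₐ[k] K) = ⊤) : O = ⊤ := by
  rw [eq_top_iff]
  intro x _
  have hx : f x ∈ O.map (f : K →ₐ[k] K) := h ▸ trivial
  obtain ⟨y, hy, hyx⟩ := hx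
  rwa [← f.injective hyx]

/-- The class of an action, apart from the summand of the generic point. -/
theorem burnClass_sub_mem {n : ℕ} {M : Set (Subalgebra k K)} (hφ : Function.Injective φ)
    (hfin : (strata φ M).Finite) (htop : ⊤ ∈ M)
    (hex : ∀ O ∈ strata φ M, ∃ s : Symb k Q n, IsSymbolOf φ O s)
    (hrc : ∀ O ∈ strata φ M, ∀ s : Symb k Q n, IsSymbolOf φ O s →
      IsRationallyConnected k s.K ∧ IsH1Trivial s.act.range) :
    ∃ s₀ : Symb k Q n, IsSymbolOf φ ⊤ s₀ ∧ s₀.H = ⊥ ∧ s₀.Z = ⊤ ∧ s₀.β = 0 ∧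
      burnClass n φ M - s₀.cls ∈ burnRcH1 k Q n := by
  classical
  have hts : ⊤ ∈ strata φ M := ⟨htop, fun O' _ hlt => absurd hlt not_top_lt⟩
  have h0 := hex ⊤ hts
  obtain ⟨hH, hZ, hβ⟩ := h0.choose_spec.of_top hφ
  refine ⟨h0.choose, h0.choose_spec, hH, hZ, hβ, ?_⟩
  have : Finite (strata φ M) := hfin
  have : Fintype (Quotient (orbitSetoid φ M)) := Fintype.ofFinite _
  let o : Quotient (orbitSetoid φ M) := Quotient.mk _ ⟨⊤, hts⟩
  -- The orbit of the generic point is a singleton, so the chosen representative is the generic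
  -- point itself.
  have ho : o.out.1 = ⊤ := by
    obtain ⟨q, hq⟩ := Quotient.exact (s := orbitSetoid φ M) o.out_eq
    exact eq_top_of_map_eq_top hq.symm
  have hcls : strataClass n φ o.out.1 = h0.choose.cls := by
    rw [ho, strataClass, dif_pos h0]
  rw [burnClass, finsum_eq_sum_of_fintype, ← Finset.add_sum_erase _ _ (Finset.mem_univ o), hcls,
    add_sub_cancel_left]
  refine sum_mem fun o' ho' => ?_
  have hO := o'.out.2
  have hne : o'.out.1 ≠ ⊤ := by
    intro h1
    refine Finset.ne_of_mem_erase ho' ?_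
    rw [← o'.out_eq]
    exact congrArg (Quotient.mk _) (Subtype.ext h1)
  have hs := hex _ hO
  rw [strataClass, dif_pos hs]
  obtain ⟨h1, h2⟩ := hrc _ hO _ hs.choose_spec
  refine AddSubgroup.subset_closure ⟨_, fun hbot => ?_, h1, h2, rfl⟩
  -- A trivial `H` would equal the generic stabilizer of the generic point, against the maximality
  -- of the stratum.
  refine hO.2 ⊤ htop (lt_top_iff_ne_top.2 hne) ?_
  rw [inertia_top hφ, ← hs.choose_spec.1, hbot, Subgroup.coe_bot]

end TopStratum

/-! ### Passage to the quotient group acting faithfully -/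

namespace LinModel

variable {k : Type u} [Field k] {K : Type u} [Field K] [Algebra k K] {U : Type w}
  [AddCommGroup U] [Module k U] {G : Type v} [Group G] {Q : Type v} [Group Q]

/-- The group `Q` acts faithfully on the `n`-dimensional variety, and this action comes from the
linear action of `G`. -/
structure IsQuotientAction (D : LinModel k K U G) (n : ℕ) (p : G →* Q) (φ : Q →* (K ≃ₐ[k] K)) :
    Prop where
  surjective : Function.Surjective p
  φ_apply : ∀ g, φ (p g) = D.φ g
  injective : Function.Injective φ
  ρ_injective : Function.Injective D.ρ
  adjoin : IntermediateField.adjoin k {y | ∃ a c, y = D.ψ a / D.ψ c} = ⊤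
  finrank : Module.finrank k U = n + 1
  trdeg : Algebra.trdeg k K = n

namespace IsQuotientAction

variable {D : LinModel k K U G} {n : ℕ} {p : G →* Q} {φ : Q →* (K ≃ₐ[k] K)}
  (h : D.IsQuotientAction n p φ)
include h

theorem trdeg_add_one : Algebra.trdeg k K + 1 = (Module.finrank k U : Cardinal) := by
  rw [h.trdeg, h.finrank]
  push_cast
  rfl

theorem mem_inertia {O : Subalgebra k K} {g : G} : g ∈ inertia D.φ O ↔ p g ∈ inertia φ O := by
  rw [mem_inertia_iff, mem_inertia_iff, h.φ_apply]

theorem mem_stab {O : Subalgebra k K} {g : G} : g ∈ stab D.φ O ↔ p g ∈ stab φ O := by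
  rw [Burnside.mem_stab, Burnside.mem_stab, h.φ_apply]

/-- Generic stabilizers in `G` are the preimages of those in `Q`, and taking preimages under a
surjection is injective. -/
theorem strata_eq (M : Set (Subalgebra k K)) : strata φ M = strata D.φ M := by
  have hpre : ∀ O, inertia D.φ O = p ⁻¹' inertia φ O := fun O => Set.ext fun g => h.mem_inertia
  have hinj : Function.Injective (Set.preimage p) := Set.preimage_injective.2 h.surjective
  ext O
  refine and_congr_right fun _ => forall₂_congr fun O' _ => ?_
  rw [hpre, hpre, hinj.ne_iff]

variable [IsAlgClosed k] [CharZero k] [Finite G] [FiniteDimensional k U]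

theorem exists_frame_isPolyLoc {O : Subalgebra k K} (hO : O ∈ strata φ D.model) :
    ∃ (s : Submodule k U → U) (b : Set U) (S : Subgroup G), (S : Set G) = inertia D.φ O ∧
      D.IsFrame O s b S ∧ IsPolyLoc (D.coordAt (D.levels O s) s b)
        (D.movedCoords S (D.coordAt (D.levels O s) s b)) O := by
  rw [h.strata_eq] at hO
  obtain ⟨s, hs⟩ := hO.1
  have hloc := hs.isLocalRing
  have hS : ((inertiaGroup D.φ O : Subgroup G) : Set G) = inertia D.φ O := rfl
  obtain ⟨hcomm, hle⟩ := inertia_commute h.ρ_injective hO.1 hS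
  obtain ⟨b, h1, h2, h3⟩ := hs.exists_adapted hcomm hle
  obtain ⟨s', hf, -⟩ := hs.exists_frame h1 h2 h3
  exact ⟨s', b, _, hS, hf, hf.isPolyLoc h.adjoin h.trdeg_add_one hO hS⟩

theorem exists_symb {O : Subalgebra k K} (hO : O ∈ strata φ D.model) :
    ∃ s : Symb k Q n, IsSymbolOf φ O s := by
  obtain ⟨s, b, S, hS, hf, hP⟩ := h.exists_frame_isPolyLoc hO
  have : Finite Q := Finite.of_surjective p h.surjective
  have : Fintype ↥(b \ {s ⊤}) := (hf.finite.subset (Set.sdiff_subset (t := {s ⊤}))).fintype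
  have hcard : Fintype.card ↥(b \ {s ⊤}) = n := by
    have := hf.card_add_one
    rw [h.finrank, Nat.card_eq_fintype_card] at this
    omega
  subst hcard
  have hmem : ∀ g, g ∈ S ↔ p g ∈ inertia φ O := fun g => by
    rw [← h.mem_inertia, ← hS]
    rfl
  refine Burnside.exists_symb h.injective (hf.algebraicIndependent h.adjoin h.trdeg_add_one)
    (hf.adjoin_eq_top h.adjoin) ?_ ?_ ?_
  · convert hP using 1
    ext v
    constructor
    · rintro ⟨q, hq, hne⟩
      obtain ⟨g, rfl⟩ := h.surjective q
      exact ⟨g, (hmem g).2 hq, by rwa [← h.φ_apply]⟩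
    · rintro ⟨g, hg, hne⟩
      exact ⟨p g, (hmem g).1 hg, by rwa [h.φ_apply]⟩
  · intro v q hq
    obtain ⟨g, rfl⟩ := h.surjective q
    obtain ⟨χ, hχ⟩ := hf.exists_char v
    rw [h.φ_apply]
    exact ⟨_, hχ ⟨g, (hmem g).2 hq⟩⟩
  · intro a ha c hc
    obtain ⟨a, rfl⟩ := h.surjective a
    obtain ⟨c, rfl⟩ := h.surjective c
    rw [← map_mul, ← map_mul, hf.point.commute h.ρ_injective (h.mem_stab.2 ha) (h.mem_inertia.2 hc)]

theorem exists_isProjFrame {O : Subalgebra k K} (hO : O ∈ strata φ D.model) {s : Symb k Q n}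
    (hs : IsSymbolOf φ O s) :
    ∃ (m : ℕ) (d : Fin m → ℕ) (y : (Σ j : Fin m, Fin (d j + 1)) → s.K), IsProjFrame k y ∧
      ∀ z, IsFrameAction y (s.act z) := by
  obtain ⟨s', b, S, hS, hf, hP⟩ := h.exists_frame_isPolyLoc hO
  obtain ⟨-, hZ, π, hπ, hact, -⟩ := hs
  obtain ⟨m, d, y, hy, hy'⟩ := hf.exists_isProjFrame hP hπ
  refine ⟨m, d, y, hy, fun z => hy' _ ?_⟩
  obtain ⟨g, hg⟩ := h.surjective z
  refine ⟨g, h.mem_stab.2 (by rw [hg]; exact (hZ z).1 z.2), fun x y hxy => hact z x y ?_⟩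
  rw [hxy, ← h.φ_apply, hg]

omit [IsAlgClosed k] [CharZero k] [Finite G] [FiniteDimensional k U] in
theorem top_mem_model : ⊤ ∈ D.model := by
  have hex : ∀ A ∈ D.arr, ∃ a ∈ A, a ≠ 0 := fun A hA =>
    (Submodule.ne_bot_iff A).1 fun hA' => D.bot_notMem (hA' ▸ hA)
  choose! s hs hs0 using hex
  refine ⟨s, hs, hs0, fun _ _ _ _ => trivial, isLocOf_top fun x => ?_⟩
  refine exists_div_of_adjoin_eq_top ?_ x
  rw [eq_top_iff, ← h.adjoin, IntermediateField.adjoin_le_iff]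
  rintro _ ⟨a, c, rfl⟩
  have key : ∀ a, D.ψ a / D.ψ (s ⊤) ∈ IntermediateField.adjoin k
      {y | ∃ A ∈ D.arr, ∃ a ∈ A, y = D.ψ a / D.ψ (s A)} := fun a =>
    IntermediateField.subset_adjoin _ _ ⟨⊤, D.top_mem, a, trivial, rfl⟩
  have := div_mem (key a) (key c)
  rwa [div_div_div_cancel_right₀ (D.ψ_ne_zero (hs0 ⊤ D.top_mem))] at this

theorem main_properties : (strata φ D.model).Finite ∧
    (∀ O ∈ strata φ D.model, ∃ s : Symb k Q n, IsSymbolOf φ O s) ∧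
    (∀ O ∈ strata φ D.model, ∀ s : Symb k Q n, IsSymbolOf φ O s → IsProductOfProjLinear s.act) ∧
    ∃ s₀ : Symb k Q n, IsSymbolOf φ ⊤ s₀ ∧ s₀.H = ⊥ ∧ s₀.Z = ⊤ ∧ s₀.β = 0 ∧
      burnClass n φ D.model - s₀.cls ∈ burnRcH1 k Q n := by
  have hfin : (strata φ D.model).Finite := by
    rw [h.strata_eq]
    exact strata_finite h.ρ_injective h.adjoin h.trdeg_add_one
  refine ⟨hfin, fun O hO => h.exists_symb hO, fun O hO s hs => ?_,
    burnClass_sub_mem h.injective hfin h.top_mem_model (fun O hO => h.exists_symb hO)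
      fun O hO s hs => ?_⟩
  · obtain ⟨m, d, y, hy, hact⟩ := h.exists_isProjFrame hO hs
    exact hy.isProductOfProjLinear s.act hact
  · obtain ⟨m, d, y, hy, hact⟩ := h.exists_isProjFrame hO hs
    have : Finite Q := Finite.of_surjective p h.surjective
    have : Finite s.act.range := Finite.of_surjective _ s.act.rangeRestrict_surjective
    refine ⟨hy.isRationallyConnected, hy.isH1Trivial ?_⟩
    rintro _ ⟨z, rfl⟩
    exact hact z

end IsQuotientAction

end LinModel

/-! ### The arrangement of eigenspaces -/

section Arrangement

variable {k : Type u} [Field k] {n : ℕ} {G : Type v} [Group G]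
  (ρ : G →* Matrix.GeneralLinearGroup (Fin (n + 1)) k)

/-- The right action of an element on `V`. -/
def rightAct (g : G) : Module.End k (Fin (n + 1) → k) := (ρ g).1.vecMulLinear

theorem rightAct_apply (g : G) (w : Fin (n + 1) → k) : rightAct ρ g w = Matrix.vecMul w (ρ g).1 := rfl

theorem rightAct_mul (g h : G) (w : Fin (n + 1) → k) :
    rightAct ρ (g * h) w = rightAct ρ h (rightAct ρ g w) := by
  simp only [rightAct_apply, map_mul, Units.val_mul, Matrix.vecMul_vecMul]

theorem rightAct_one (w : Fin (n + 1) → k) : rightAct ρ 1 w = w := by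
  simp [rightAct_apply]

theorem rightAct_inv (g : G) (w : Fin (n + 1) → k) : rightAct ρ g⁻¹ (rightAct ρ g w) = w := by
  rw [← rightAct_mul, mul_inv_cancel, rightAct_one]

theorem rightAct_inv' (g : G) (w : Fin (n + 1) → k) : rightAct ρ g (rightAct ρ g⁻¹ w) = w := by
  rw [← rightAct_mul, inv_mul_cancel, rightAct_one]

theorem mem_eigenspace_iff {g : G} {c : k} {w : Fin (n + 1) → k} :
    w ∈ (rightAct ρ g).eigenspace c ↔ rightAct ρ g w = c • w := Module.End.mem_eigenspace_iff

theorem mem_eigenSubspace {v w : Fin (n + 1) → k} : w ∈ eigenSubspace ρ v ↔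
    ∀ (g : G) (c : k), rightAct ρ g v = c • v → rightAct ρ g w = c • w := Iff.rfl

theorem self_mem_eigenSubspace (v : Fin (n + 1) → k) : v ∈ eigenSubspace ρ v := fun _ _ h => h

/-- For the zero vector every pair `(g, c)` is a condition, in particular `(1, 0)`. This lets `⊥` be
treated like the members of the arrangement. -/
theorem eigenSubspace_zero : eigenSubspace ρ 0 = ⊥ := by
  rw [eq_bot_iff]
  intro w hw
  have := (mem_eigenSubspace ρ).1 hw 1 0 (by simp)
  rwa [rightAct_one, zero_smul] at this

theorem eigenSubspace_le {v w : Fin (n + 1) → k} (h : w ∈ eigenSubspace ρ v) :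
    eigenSubspace ρ w ≤ eigenSubspace ρ v := by
  intro w' hw' g c hv
  exact hw' g c (h g c hv)

/-- As an intersection of eigenspaces of single elements, of which a finite group has finitely many,
it can take only finitely many values. -/
theorem eigenSubspace_eq_sInf (v : Fin (n + 1) → k) : eigenSubspace ρ v =
    sInf {W | W ∈ Set.range (fun x : G × k => (rightAct ρ x.1).eigenspace x.2) ∧ v ∈ W} := by
  ext w
  rw [mem_eigenSubspace, Submodule.mem_sInf]
  constructor
  · rintro h _ ⟨⟨⟨g, c⟩, rfl⟩, hv⟩
    exact (mem_eigenspace_iff ρ).2 (h g c ((mem_eigenspace_iff ρ).1 hv))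
  · intro h g c hv
    exact (mem_eigenspace_iff ρ).1 (h _ ⟨⟨(g, c), rfl⟩, (mem_eigenspace_iff ρ).2 hv⟩)

theorem finite_range_eigenSubspace [Finite G] : (Set.range (eigenSubspace ρ)).Finite := by
  have h1 : (Set.range (fun x : G × k => (rightAct ρ x.1).eigenspace x.2)).Finite := by
    refine ((Set.finite_singleton ⊥).union (Set.finite_iUnion fun g : G =>
      ((rightAct ρ g).finite_hasEigenvalue.image fun c => (rightAct ρ g).eigenspace c))).subset ?_
    rintro _ ⟨⟨g, c⟩, rfl⟩
    by_cases hc : (rightAct ρ g).eigenspace c = ⊥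
    · exact Or.inl hc
    · exact Or.inr (Set.mem_iUnion.2 ⟨g, c, Module.End.hasEigenvalue_iff.2 hc, rfl⟩)
  refine (h1.powerset.image sInf).subset ?_
  rintro _ ⟨v, rfl⟩
  exact ⟨_, fun W hW => hW.1, (eigenSubspace_eq_sInf ρ v).symm⟩

/-- A subspace which is a union of subspaces of the form `V_{Γ,ε}` has itself this form. -/
theorem exists_eq_eigenSubspace [Finite G] [Infinite k] {E : Submodule k (Fin (n + 1) → k)}
    (hE : ∀ v ∈ E, eigenSubspace ρ v ≤ E) : ∃ v, E = eigenSubspace ρ v := by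
  let ι := {W : Submodule k (Fin (n + 1) → k) // W ∈ Set.range (eigenSubspace ρ) ∧ W ≤ E}
  have : Finite ι := ((finite_range_eigenSubspace ρ).subset fun W hW => hW.1 :
    {W : Submodule k (Fin (n + 1) → k) | W ∈ Set.range (eigenSubspace ρ) ∧ W ≤ E}.Finite).to_subtype
  -- A vector space over an infinite field is not a finite union of proper subspaces.
  obtain ⟨⟨W, ⟨v, rfl⟩, hWE⟩, hW⟩ := Subspace.exists_eq_top_of_iUnion_eq_univ (ι := ι)
    (p := fun W => W.1.comap E.subtype) (by
      rw [Set.eq_univ_iff_forall]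
      intro w
      exact Set.mem_iUnion.2 ⟨⟨eigenSubspace ρ w, ⟨w, rfl⟩, hE w w.2⟩,
        self_mem_eigenSubspace ρ _⟩)
  refine ⟨v, le_antisymm (fun w hw => ?_) hWE⟩
  have : (⟨w, hw⟩ : E) ∈ (eigenSubspace ρ v).comap E.subtype := by
    rw [show (eigenSubspace ρ v).comap E.subtype = ⊤ from hW]
    trivial
  exact this

theorem mem_scalarSubgroup_iff {g : G} :
    g ∈ scalarSubgroup ρ ↔ ∃ c : k, ∀ w, rightAct ρ g w = c • w := by
  rw [scalarSubgroup, Subgroup.mem_comap,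
    Matrix.GeneralLinearGroup.mem_center_iff_val_mem_range_scalar]
  refine exists_congr fun c => ⟨fun h w => ?_, fun h => ?_⟩
  · rw [rightAct_apply, ← h]
    ext i
    simp [Matrix.scalar_apply, mul_comm]
  · ext i j
    have := congrFun (h (Pi.single i 1)) j
    rw [rightAct_apply, Matrix.single_one_vecMul] at this
    change _ = c * (Pi.single i (1 : k) : Fin (n + 1) → k) j at this
    change Matrix.scalar (Fin (n + 1)) c i j = (ρ g).1.row i j
    rw [this, Matrix.scalar_apply, Matrix.diagonal_apply, Pi.single_apply]
    simp [eq_comm]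

/-- The stabilizer of a line consists of scalars exactly when its eigenspace V_{Γ,ε} is all of V, so
the condition on Γ becomes a condition on the subspace. -/
theorem mem_insert_arrangement_iff {W : Submodule k (Fin (n + 1) → k)} :
    W ∈ insert ⊥ (arrangement ρ) ↔ W ≠ ⊤ ∧ ∃ v, W = eigenSubspace ρ v := by
  constructor
  · rintro (rfl | ⟨v, hv, hne, rfl⟩)
    · exact ⟨bot_ne_top, 0, (eigenSubspace_zero ρ).symm⟩
    · refine ⟨fun htop => hne ?_, v, rfl⟩
      ext g
      constructor
      · rintro ⟨c, hc⟩
        refine (mem_scalarSubgroup_iff ρ).2 ⟨c, fun w => ?_⟩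
        have hw : w ∈ eigenSubspace ρ v := htop ▸ trivial
        exact hw g c hc
      · intro hg
        obtain ⟨c, hc⟩ := (mem_scalarSubgroup_iff ρ).1 hg
        exact ⟨c, hc v⟩
  · rintro ⟨hne, v, rfl⟩
    by_cases hv : v = 0
    · rw [hv, eigenSubspace_zero]
      exact Set.mem_insert _ _
    · refine Set.mem_insert_of_mem _ ⟨v, hv, fun hC => hne ?_, rfl⟩
      rw [eq_top_iff]
      intro w _ g c hg
      have hgC : g ∈ scalarSubgroup ρ := by
        rw [← SetLike.mem_coe, ← hC]
        exact ⟨c, hg⟩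
      obtain ⟨c', hc'⟩ := (mem_scalarSubgroup_iff ρ).1 hgC
      have hcc : c = c' := by
        have := hc' v
        rw [rightAct_apply, hg] at this
        exact smul_left_injective k hv this
      rw [hcc]
      exact hc' w

theorem finite_insert_arrangement [Finite G] : (insert ⊥ (arrangement ρ)).Finite := by
  refine (finite_range_eigenSubspace ρ).subset fun W hW => ?_
  obtain ⟨-, v, rfl⟩ := (mem_insert_arrangement_iff ρ).1 hW
  exact ⟨v, rfl⟩

theorem inf_mem_insert_arrangement [Finite G] [Infinite k] {W W' : Submodule k (Fin (n + 1) → k)}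
    (hW : W ∈ insert ⊥ (arrangement ρ)) (hW' : W' ∈ insert ⊥ (arrangement ρ)) :
    W ⊓ W' ∈ insert ⊥ (arrangement ρ) := by
  rw [mem_insert_arrangement_iff] at *
  obtain ⟨hne, v, rfl⟩ := hW
  obtain ⟨-, v', rfl⟩ := hW'
  exact ⟨fun h => hne (top_le_iff.1 (h ▸ inf_le_left)), exists_eq_eigenSubspace ρ fun w hw =>
    le_inf (eigenSubspace_le ρ hw.1) (eigenSubspace_le ρ hw.2)⟩

theorem eigenspace_mem_insert_arrangement [Finite G] [Infinite k] (g : G) (c : k)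
    (h : (rightAct ρ g).eigenspace c ≠ ⊤) :
    (rightAct ρ g).eigenspace c ∈ insert ⊥ (arrangement ρ) := by
  rw [mem_insert_arrangement_iff]
  refine ⟨h, exists_eq_eigenSubspace ρ fun v hv w hw => ?_⟩
  rw [mem_eigenspace_iff] at hv ⊢
  exact hw g c hv

/-- Moving a line conjugates its stabilizer and preserves the values of the character. -/
theorem comap_eigenSubspace (g : G) (v : Fin (n + 1) → k) :
    (eigenSubspace ρ v).comap (rightAct ρ g) = eigenSubspace ρ (rightAct ρ g⁻¹ v) := by
  ext w
  rw [Submodule.mem_comap, mem_eigenSubspace, mem_eigenSubspace]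
  constructor
  · intro h g' c hg'
    have h1 : rightAct ρ (g⁻¹ * g' * g) v = c • v := by
      rw [rightAct_mul, rightAct_mul, hg', map_smul, rightAct_inv']
    have h2 := h _ _ h1
    rw [rightAct_mul, rightAct_mul, rightAct_inv, ← map_smul] at h2
    have h3 := congrArg (rightAct ρ g⁻¹) h2
    rwa [rightAct_inv, rightAct_inv] at h3
  · intro h g' c hg'
    have h1 : rightAct ρ (g * g' * g⁻¹) (rightAct ρ g⁻¹ v) = c • rightAct ρ g⁻¹ v := by
      rw [rightAct_mul, rightAct_mul, rightAct_inv', hg', map_smul]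
    have h2 := h _ _ h1
    rw [rightAct_mul, rightAct_mul] at h2
    have h3 := congrArg (rightAct ρ g) h2
    rwa [rightAct_inv', map_smul] at h3

theorem comap_mem_insert_arrangement (g : G) {W : Submodule k (Fin (n + 1) → k)}
    (hW : W ∈ insert ⊥ (arrangement ρ)) :
    W.comap (rightAct ρ g) ∈ insert ⊥ (arrangement ρ) := by
  rw [mem_insert_arrangement_iff] at *
  obtain ⟨hne, v, rfl⟩ := hW
  refine ⟨fun h => hne ?_, _, comap_eigenSubspace ρ g v⟩
  rw [eq_top_iff]
  intro w _
  have : rightAct ρ g⁻¹ w ∈ (eigenSubspace ρ v).comap (rightAct ρ g) := h ▸ trivial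
  rw [Submodule.mem_comap, rightAct_inv'] at this
  exact this

end Arrangement

/-! ### Annihilators -/

section Annihilator

variable {k : Type u} [Field k] {n : ℕ}

/-- The linear forms that vanish on `W`. -/
def annihilator (W : Submodule k (Fin (n + 1) → k)) : Submodule k (Fin (n + 1) → k) :=
  W.dualAnnihilator.comap (dotProductEquiv k (Fin (n + 1))).toLinearMap

theorem mem_annihilator {W : Submodule k (Fin (n + 1) → k)} {a : Fin (n + 1) → k} :
    a ∈ annihilator W ↔ ∀ w ∈ W, a ⬝ᵥ w = 0 := Submodule.mem_dualAnnihilator _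

theorem annihilator_injective :
    Function.Injective (annihilator : Submodule k (Fin (n + 1) → k) → _) := by
  intro W W' h
  exact Subspace.dualAnnihilator_inj.1
    (Submodule.comap_injective_of_surjective (dotProductEquiv k (Fin (n + 1))).surjective h)

theorem annihilator_bot : annihilator (⊥ : Submodule k (Fin (n + 1) → k)) = ⊤ := by
  rw [annihilator, Submodule.dualAnnihilator_bot, Submodule.comap_top]

theorem annihilator_top : annihilator (⊤ : Submodule k (Fin (n + 1) → k)) = ⊥ := by
  rw [eq_bot_iff]
  intro a ha
  rw [Submodule.mem_bot]
  ext i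
  have := mem_annihilator.1 ha (Pi.single i 1) trivial
  simpa using this

theorem annihilator_inf (W W' : Submodule k (Fin (n + 1) → k)) :
    annihilator (W ⊓ W') = annihilator W ⊔ annihilator W' := by
  rw [annihilator, Subspace.dualAnnihilator_inf_eq, annihilator, annihilator,
    Submodule.comap_equiv_eq_map_symm, Submodule.comap_equiv_eq_map_symm,
    Submodule.comap_equiv_eq_map_symm, Submodule.map_sup]

theorem annihilator_setOf (R : Submodule k (Fin (n + 1) → k)) (W : Submodule k (Fin (n + 1) → k))
    (h : ∀ w, w ∈ W ↔ ∀ a ∈ R, a ⬝ᵥ w = 0) : annihilator W = R := by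
  have hW : W = (R.map (dotProductEquiv k (Fin (n + 1))).toLinearMap).dualCoannihilator := by
    ext w
    rw [h, Submodule.mem_dualCoannihilator]
    constructor
    · rintro hw _ ⟨a, ha, rfl⟩
      exact hw a ha
    · intro hw a ha
      exact hw _ ⟨a, ha, rfl⟩
  rw [annihilator, hW, Subspace.dualCoannihilator_dualAnnihilator_eq,
    Submodule.comap_map_eq_of_injective (dotProductEquiv k (Fin (n + 1))).injective]

end Annihilator

/-! ### The linear model of a projective space -/

section Concrete

variable {k : Type u} [Field k] {n : ℕ}

theorem linForm_injective {σ : Type} [Fintype σ] :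
    Function.Injective (linForm : (σ → k) →ₗ[k] RatField k σ) :=
  algebraicIndependent_coord.linearIndependent.fintypeLinearCombination_injective

theorem linForm_apply {σ : Type} [Fintype σ] (a : σ → k) :
    linForm a = ∑ i, a i • coord k i := Fintype.linearCombination_apply ..

theorem linForm_single {σ : Type} [Fintype σ] [DecidableEq σ] (i : σ) :
    linForm (Pi.single i (1 : k)) = coord k i := by
  rw [linForm, Fintype.linearCombination_apply_single, one_smul]

theorem linAut_linForm {σ : Type} [Fintype σ] [DecidableEq σ] (A : GL σ k) (a : σ → k) :
    linAut A (linForm a) = linForm (A.1.mulVec a) := by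
  simp only [linForm_apply, map_sum, map_smul, linAut_coord, Matrix.mulVec, dotProduct,
    Finset.sum_smul, Finset.smul_sum, smul_smul]
  rw [Finset.sum_comm]
  refine Finset.sum_congr rfl fun i _ => Finset.sum_congr rfl fun j _ => ?_
  rw [mul_comm]

theorem linForm_eq_algebraMap {σ : Type} [Fintype σ] (a : σ → k) : linForm a =
    algebraMap (MvPolynomial σ k) (RatField k σ) (∑ i, MvPolynomial.C (a i) * MvPolynomial.X i) := by
  simp only [linForm_apply, map_sum, map_mul, Algebra.smul_def, coord]
  rfl

theorem eval_linForm {σ : Type} [Fintype σ] (a w : σ → k) :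
    MvPolynomial.eval w (∑ i, MvPolynomial.C (a i) * MvPolynomial.X i) = a ⬝ᵥ w := by
  simp [dotProduct]

theorem dotProduct_mul_eq_of_linForm {σ : Type} [Fintype σ] {a b c d : σ → k}
    (h : linForm a * linForm b = linForm c * linForm d) (w : σ → k) :
    (a ⬝ᵥ w) * (b ⬝ᵥ w) = (c ⬝ᵥ w) * (d ⬝ᵥ w) := by
  simp only [linForm_eq_algebraMap, ← map_mul] at h
  have := congrArg (MvPolynomial.eval w)
    (FaithfulSMul.algebraMap_injective (MvPolynomial σ k) (RatField k σ) h)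
  simpa only [map_mul, eval_linForm] using this

theorem coord_div_coord_mem (a b : Fin (n + 1)) : coord k a / coord k b ∈ PField k n :=
  IntermediateField.subset_adjoin k
    {y | ∃ a b, (fun _ : Fin (n + 1) => ()) a = (fun _ => ()) b ∧ y = coord k a / coord k b}
    ⟨a, b, rfl, rfl⟩

theorem linForm_div_coord_mem (a : Fin (n + 1) → k) : linForm a / coord k 0 ∈ PField k n := by
  rw [linForm_apply, Finset.sum_div]
  refine sum_mem fun i _ => ?_
  rw [smul_div_assoc]
  exact IntermediateField.smul_mem _ (coord_div_coord_mem i 0)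

/-- The linear forms, divided by the first coordinate function. -/
def affForm : (Fin (n + 1) → k) →ₗ[k] PField k n where
  toFun a := ⟨linForm a / coord k 0, linForm_div_coord_mem a⟩
  map_add' a b := Subtype.ext (by
    change linForm (a + b) / coord k 0 = linForm a / coord k 0 + linForm b / coord k 0
    rw [map_add, add_div])
  map_smul' c a := Subtype.ext (by
    change linForm (c • a) / coord k 0 = c • (linForm a / coord k 0)
    rw [map_smul, smul_div_assoc])

theorem affForm_coe (a : Fin (n + 1) → k) :
    (affForm a : RatField k (Fin (n + 1))) = linForm a / coord k 0 := rfl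

theorem affForm_injective : Function.Injective (affForm : (Fin (n + 1) → k) →ₗ[k] PField k n) := by
  intro a b h
  have h' : linForm a / coord k 0 = linForm b / coord k 0 := congrArg Subtype.val h
  exact linForm_injective ((div_left_inj' (coord_ne_zero 0)).1 h')

theorem affForm_div (a b : Fin (n + 1) → k) :
    ((affForm a / affForm b : PField k n) : RatField k (Fin (n + 1))) = linForm a / linForm b := by
  change linForm a / coord k 0 / (linForm b / coord k 0) = _
  rw [div_div_div_cancel_right₀ (coord_ne_zero 0)]

theorem projAut_affForm_div (A : GL (Fin (n + 1)) k) (a b : Fin (n + 1) → k) :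
    projAut A (affForm a / affForm b) = affForm (A.1.mulVec a) / affForm (A.1.mulVec b) := by
  apply Subtype.ext
  rw [affForm_div]
  change linAut A ((affForm a / affForm b : PField k n) : RatField k (Fin (n + 1))) = _
  rw [affForm_div, map_div₀, linAut_linForm, linAut_linForm]

theorem mem_quotientForms {W : Submodule k (Fin (n + 1) → k)} {y : PField k n} :
    y ∈ quotientForms W ↔ ∃ a ∈ annihilator W, y = affForm a := by
  constructor
  · rintro ⟨a, ha, h⟩
    exact ⟨a, mem_annihilator.2 ha, Subtype.ext h⟩
  · rintro ⟨a, ha, rfl⟩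
    exact ⟨a, mem_annihilator.1 ha, rfl⟩

theorem adjoin_affForm_div :
    IntermediateField.adjoin k {y : PField k n | ∃ a c, y = affForm a / affForm c} = ⊤ := by
  apply IntermediateField.map_injective (PField k n).val
  rw [IntermediateField.adjoin_map, ← AlgHom.fieldRange_eq_map, IntermediateField.fieldRange_val]
  apply le_antisymm
  · rw [IntermediateField.adjoin_le_iff]
    rintro _ ⟨y, -, rfl⟩
    exact y.2
  · conv_lhs => rw [PField, projField]
    rw [IntermediateField.adjoin_le_iff]
    rintro _ ⟨a, b, -, rfl⟩
    refine IntermediateField.subset_adjoin _ _ ⟨_, ⟨Pi.single a 1, Pi.single b 1, rfl⟩, ?_⟩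
    change ((affForm _ / affForm _ : PField k n) : RatField k (Fin (n + 1))) = _
    rw [affForm_div, linForm_single, linForm_single]

theorem algebraicIndependent_coord_div : AlgebraicIndependent k
    (fun i : Fin n => (⟨coord k i.succ / coord k 0, coord_div_coord_mem _ _⟩ : PField k n)) := by
  let z : Fin (n + 1) → RatField k (Fin (n + 1)) :=
    Fin.cons (coord k 0) fun i : Fin n => coord k i.succ / coord k 0
  have hz : IntermediateField.adjoin k (Set.range z) = ⊤ := by
    rw [eq_top_iff, ← adjoin_coord, IntermediateField.adjoin_le_iff]
    have h0 : coord k 0 ∈ IntermediateField.adjoin k (Set.range z) :=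
      IntermediateField.subset_adjoin _ _ ⟨0, rfl⟩
    rintro _ ⟨j, rfl⟩
    induction j using Fin.cases with
    | zero => exact h0
    | succ i =>
      have h1 : coord k i.succ / coord k 0 ∈ IntermediateField.adjoin k (Set.range z) :=
        IntermediateField.subset_adjoin _ _ ⟨i.succ, rfl⟩
      have := mul_mem h1 h0
      rwa [coord_div_mul] at this
  have h := algebraicIndependent_of_adjoin_eq_top hz trdeg_ratField.ge
  exact AlgebraicIndependent.of_comp (PField k n).val (h.comp Fin.succ (Fin.succ_injective n))

theorem adjoin_coord_div : IntermediateField.adjoin k (Set.range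
    (fun i : Fin n => (⟨coord k i.succ / coord k 0, coord_div_coord_mem _ _⟩ : PField k n))) = ⊤ := by
  rw [eq_top_iff, ← adjoin_affForm_div, IntermediateField.adjoin_le_iff]
  set S := IntermediateField.adjoin k (Set.range
    (fun i : Fin n => (⟨coord k i.succ / coord k 0, coord_div_coord_mem _ _⟩ : PField k n))) with hS
  have key : ∀ a : Fin (n + 1) → k, affForm a ∈ S := by
    intro a
    rw [← Finset.univ_sum_single a, map_sum]
    refine sum_mem fun i _ => ?_
    rw [← mul_one (a i), ← smul_eq_mul, Pi.single_smul, map_smul]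
    refine IntermediateField.smul_mem _ ?_
    induction i using Fin.cases with
    | zero =>
      have : affForm (Pi.single (0 : Fin (n + 1)) (1 : k)) = 1 := Subtype.ext (by
        rw [affForm_coe, linForm_single, div_self (coord_ne_zero 0)]
        rfl)
      rw [this]
      exact one_mem _
    | succ i =>
      refine IntermediateField.subset_adjoin _ _ ⟨i, Subtype.ext ?_⟩
      rw [affForm_coe, linForm_single]
  rintro _ ⟨a, c, rfl⟩
  exact div_mem (key a) (key c)

theorem trdeg_pField : Algebra.trdeg k (PField k n) = n := by
  rw [trdeg_eq_of_algebraicIndependent algebraicIndependent_coord_div adjoin_coord_div,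
    Fintype.card_fin]

end Concrete

/-! ### The linear model of a representation -/

section LinearRepresentation

variable {k : Type u} [Field k] {n : ℕ} {G : Type v} [Group G]
  (ρ : G →* Matrix.GeneralLinearGroup (Fin (n + 1)) k)

/-- The action on linear forms, dual to `rightAct`. -/
def leftAct : G →* ((Fin (n + 1) → k) ≃ₗ[k] (Fin (n + 1) → k)) :=
  (LinearMap.GeneralLinearGroup.generalLinearEquiv k (Fin (n + 1) → k)).toMonoidHom.comp
    (Matrix.GeneralLinearGroup.toLin.toMonoidHom.comp ρ)

theorem leftAct_apply (g : G) (a : Fin (n + 1) → k) : leftAct ρ g a = (ρ g).1.mulVec a := rfl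

theorem leftAct_dotProduct (g : G) (a w : Fin (n + 1) → k) :
    leftAct ρ g a ⬝ᵥ w = a ⬝ᵥ rightAct ρ g w := by
  rw [leftAct_apply, rightAct_apply, dotProduct_comm, Matrix.dotProduct_mulVec, dotProduct_comm]

theorem map_annihilator (g : G) (W : Submodule k (Fin (n + 1) → k)) :
    (annihilator W).map (leftAct ρ g).toLinearMap = annihilator (W.comap (rightAct ρ g)) := by
  ext y
  rw [mem_annihilator]
  constructor
  · rintro ⟨a, ha, rfl⟩ w hw
    exact (leftAct_dotProduct ρ g a w).trans (mem_annihilator.1 ha _ hw)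
  · intro hy
    refine ⟨leftAct ρ g⁻¹ y, mem_annihilator.2 fun w hw => ?_, ?_⟩
    · rw [leftAct_dotProduct]
      refine hy _ ?_
      rwa [Submodule.mem_comap, rightAct_inv']
    · change leftAct ρ g (leftAct ρ g⁻¹ y) = y
      rw [map_inv]
      exact (leftAct ρ g).apply_symm_apply y

/-- The eigenspace is the kernel of `g - c` on V, and the annihilator of a kernel is the image of
the transposed map. -/
theorem annihilator_eigenspace (g : G) (c : k) : annihilator ((rightAct ρ g).eigenspace c) =
    LinearMap.range ((leftAct ρ g).toLinearMap - c • LinearMap.id) := by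
  apply annihilator_setOf
  intro w
  have key : ∀ b, ((leftAct ρ g).toLinearMap - c • LinearMap.id :
      (Fin (n + 1) → k) →ₗ[k] (Fin (n + 1) → k)) b ⬝ᵥ w =
      b ⬝ᵥ (rightAct ρ g w - c • w) := by
    intro b
    change (leftAct ρ g b - c • b) ⬝ᵥ w = _
    rw [sub_dotProduct, leftAct_dotProduct, dotProduct_sub, smul_dotProduct, dotProduct_smul]
  rw [mem_eigenspace_iff]
  constructor
  · rintro h _ ⟨b, rfl⟩
    rw [key, h, sub_self, dotProduct_zero]
  · intro h
    rw [← sub_eq_zero]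
    ext i
    have := h _ ⟨Pi.single i 1, rfl⟩
    rw [key] at this
    simpa using this

theorem leftAct_injective (hρ : Function.Injective ρ) : Function.Injective (leftAct ρ) :=
  (LinearMap.GeneralLinearGroup.generalLinearEquiv k (Fin (n + 1) → k)).injective.comp
    (Matrix.GeneralLinearGroup.toLin.injective.comp hρ)

/-- The collection of the subspaces of forms which vanish on the members of the arrangement. -/
def dualArrangement : Set (Submodule k (Fin (n + 1) → k)) :=
  annihilator '' insert ⊥ (arrangement ρ)

/-- The linear model given by a representation. -/
def linModel [Finite G] [Infinite k] : LinModel k (PField k n) (Fin (n + 1) → k) G where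
  ψ := affForm
  ψ_inj := affForm_injective
  ρ := leftAct ρ
  φ := projAut.comp ρ
  compat g a b := projAut_affForm_div (ρ g) a b
  arr := dualArrangement ρ
  arr_finite := (finite_insert_arrangement ρ).image _
  top_mem := ⟨⊥, Set.mem_insert _ _, annihilator_bot⟩
  bot_notMem := by
    rintro ⟨W, hW, h⟩
    rw [← annihilator_top] at h
    exact ((mem_insert_arrangement_iff ρ).1 hW).1 (annihilator_injective h)
  sup_mem := by
    rintro _ ⟨W, hW, rfl⟩ _ ⟨W', hW', rfl⟩
    exact ⟨_, inf_mem_insert_arrangement ρ hW hW', annihilator_inf W W'⟩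
  map_mem := by
    rintro g _ ⟨W, hW, rfl⟩
    exact ⟨_, comap_mem_insert_arrangement ρ g hW, (map_annihilator ρ g W).symm⟩
  range_mem g c := by
    rw [← annihilator_eigenspace]
    by_cases h : (rightAct ρ g).eigenspace c = ⊤
    · left
      rw [h, annihilator_top]
    · exact Or.inr ⟨_, eigenspace_mem_insert_arrangement ρ g c h, rfl⟩

theorem dcpModel_eq [Finite G] [Infinite k] : dcpModel ρ = (linModel ρ).model := by
  ext O
  rw [dcpModel, mem_projModel_iff]
  constructor
  · rintro ⟨s, hs, hloc⟩
    choose t ht hst using fun W => mem_quotientForms.1 (hs W).1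
    have hinj : Function.Injective fun W : ↥(insert ⊥ (arrangement ρ)) => annihilator W.1 :=
      fun W W' h => Subtype.ext (annihilator_injective h)
    -- The denominators are reindexed by annihilators instead of members of the arrangement; the
    -- value 0 elsewhere is never used.
    let s' : Submodule k (Fin (n + 1) → k) → (Fin (n + 1) → k) :=
      Function.extend (fun W : ↥(insert ⊥ (arrangement ρ)) => annihilator W.1) t 0
    have hs' : ∀ W : ↥(insert ⊥ (arrangement ρ)), s' (annihilator W.1) = t W :=
      fun W => hinj.extend_apply t 0 W
    have hchart : chart (fun W : ↥(insert ⊥ (arrangement ρ)) => quotientForms W.1) s =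
        Algebra.adjoin k {y | ∃ A ∈ (linModel ρ).arr, ∃ a ∈ A,
          y = (linModel ρ).ψ a / (linModel ρ).ψ (s' A)} := by
      rw [chart]
      congr 1
      ext y
      constructor
      · rintro ⟨W, x, hx, rfl⟩
        obtain ⟨a, ha, rfl⟩ := mem_quotientForms.1 hx
        exact ⟨_, ⟨W.1, W.2, rfl⟩, a, ha, by rw [hs' W, hst W]; rfl⟩
      · rintro ⟨_, ⟨W, hW, rfl⟩, a, ha, rfl⟩
        refine ⟨⟨W, hW⟩, affForm a, mem_quotientForms.2 ⟨a, ha, rfl⟩, ?_⟩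
        rw [hs' ⟨W, hW⟩, hst ⟨W, hW⟩]
        rfl
    refine ⟨s', ?_, ?_, ?_, hchart ▸ hloc⟩
    · rintro _ ⟨W, hW, rfl⟩
      rw [hs' ⟨W, hW⟩]
      exact ht ⟨W, hW⟩
    · rintro _ ⟨W, hW, rfl⟩ h0
      rw [hs' ⟨W, hW⟩] at h0
      exact (hs ⟨W, hW⟩).2 (by rw [hst, h0, map_zero])
    · intro A hA a ha
      refine hloc.1 ?_
      rw [hchart]
      exact Algebra.subset_adjoin ⟨A, hA, a, ha, rfl⟩
  · rintro ⟨s, hs⟩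
    refine ⟨fun W => affForm (s (annihilator W.1)), fun W => ⟨mem_quotientForms.2
      ⟨_, hs.mem _ ⟨W.1, W.2, rfl⟩, rfl⟩, fun h => hs.ne _ ⟨W.1, W.2, rfl⟩
        (affForm_injective (h.trans (map_zero _).symm))⟩, ?_⟩
    convert hs.loc using 1
    rw [chart]
    congr 1
    ext y
    constructor
    · rintro ⟨W, x, hx, rfl⟩
      obtain ⟨a, ha, rfl⟩ := mem_quotientForms.1 hx
      exact ⟨_, ⟨W.1, W.2, rfl⟩, a, ha, rfl⟩
    · rintro ⟨_, ⟨W, hW, rfl⟩, a, ha, rfl⟩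
      exact ⟨⟨W, hW⟩, affForm a, mem_quotientForms.2 ⟨a, ha, rfl⟩, rfl⟩

/-- Triviality on quotients of forms gives `(g a) b = a (g b)` as products of linear forms.
Evaluated at a vector `w`, this says that `w` and its image are proportional; a linear map for which
every vector is an eigenvector is a scalar. -/
theorem mem_scalarSubgroup_of_projAut_eq_one {g : G} (h : projAut (ρ g) = 1) :
    g ∈ scalarSubgroup ρ := by
  have h1 : ∀ a b : Fin (n + 1) → k,
      linForm (leftAct ρ g a) * linForm b = linForm a * linForm (leftAct ρ g b) := by
    intro a b
    by_cases hb : b = 0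
    · rw [hb, map_zero, map_zero, map_zero, mul_zero, mul_zero]
    · have h2 := congrArg Subtype.val (projAut_affForm_div (ρ g) a b)
      rw [h, AlgEquiv.one_apply, affForm_div, affForm_div] at h2
      have hb' : linForm b ≠ 0 := fun h0 => hb (linForm_injective (h0.trans (map_zero _).symm))
      have hgb : linForm (leftAct ρ g b) ≠ 0 := fun h0 => hb ((leftAct ρ g).injective
        ((linForm_injective (h0.trans (map_zero _).symm)).trans (map_zero _).symm))
      exact ((div_eq_div_iff hb' hgb).1 h2).symm
  have h3 : ∀ a b w : Fin (n + 1) → k,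
      (a ⬝ᵥ rightAct ρ g w) * (b ⬝ᵥ w) = (a ⬝ᵥ w) * (b ⬝ᵥ rightAct ρ g w) := by
    intro a b w
    rw [← leftAct_dotProduct, ← leftAct_dotProduct]
    exact dotProduct_mul_eq_of_linForm (h1 a b) w
  obtain ⟨c, hc⟩ := (rightAct ρ g).exists_eq_smul_id_of_forall_notLinearIndependent fun w hw => by
    have hw0 : w ≠ 0 := by simpa using hw.ne_zero 0
    obtain ⟨i, hi⟩ := Function.ne_iff.1 hw0
    have h4 : w i • rightAct ρ g w = rightAct ρ g w i • w := by
      ext j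
      have := h3 (Pi.single j 1) (Pi.single i 1) w
      simp only [single_one_dotProduct] at this
      rw [Pi.smul_apply, Pi.smul_apply, smul_eq_mul, smul_eq_mul, mul_comm, this, mul_comm]
    have := (LinearIndependent.pair_iff.1 hw) (rightAct ρ g w i) (-(w i)) (by
      rw [neg_smul, h4, add_neg_cancel])
    exact hi (neg_eq_zero.1 this.2)
  exact (mem_scalarSubgroup_iff ρ).2 ⟨c, fun w => by rw [hc]; rfl⟩

theorem projAction_injective : Function.Injective (projAction ρ) := by
  rw [injective_iff_map_eq_one]
  intro q hq
  obtain ⟨g, rfl⟩ := QuotientGroup.mk_surjective q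
  exact (QuotientGroup.eq_one_iff g).2 (mem_scalarSubgroup_of_projAut_eq_one ρ hq)

theorem isQuotientAction_linModel [Finite G] [Infinite k] (hρ : Function.Injective ρ) :
    (linModel ρ).IsQuotientAction n (QuotientGroup.mk' (scalarSubgroup ρ)) (projAction ρ) where
  surjective := QuotientGroup.mk'_surjective _
  φ_apply _ := rfl
  injective := projAction_injective ρ
  ρ_injective := leftAct_injective ρ hρ
  adjoin := adjoin_affForm_div
  finrank := by simp
  trdeg := trdeg_pField

end LinearRepresentation

end Burnside

end

/-! ### The class of the De Concini--Procesi model -/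

theorem mainTheorem11 {k : Type u} [Field k] [IsAlgClosed k] [CharZero k] {G : Type v} [Group G]
    [Finite G] (n : ℕ) (ρ : G →* Matrix.GeneralLinearGroup (Fin (n + 1)) k)
    (hρ : Function.Injective ρ) :
    -- the class is a finite sum of symbols, indexed by the orbits of strata
    (Burnside.strata (Burnside.projAction ρ) (Burnside.dcpModel ρ)).Finite ∧
    (∀ O ∈ Burnside.strata (Burnside.projAction ρ) (Burnside.dcpModel ρ),
      ∃ s : Burnside.Symb k (G ⧸ Burnside.scalarSubgroup ρ) n,
        Burnside.IsSymbolOf (Burnside.projAction ρ) O s) ∧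
    -- every symbol has the asserted shape
    (∀ O ∈ Burnside.strata (Burnside.projAction ρ) (Burnside.dcpModel ρ),
      ∀ s : Burnside.Symb k (G ⧸ Burnside.scalarSubgroup ρ) n,
        Burnside.IsSymbolOf (Burnside.projAction ρ) O s → Burnside.IsProductOfProjLinear s.act) ∧
    -- apart from the summand `(1, G/C ⟲ k(ℙ(V)), ())`, the class is rationally connected and
    -- `H¹`-trivial
    ∃ s₀ : Burnside.Symb k (G ⧸ Burnside.scalarSubgroup ρ) n,
      Burnside.IsSymbolOf (Burnside.projAction ρ) ⊤ s₀ ∧ s₀.H = ⊥ ∧ s₀.Z = ⊤ ∧ s₀.β = 0 ∧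
      Burnside.burnClass n (Burnside.projAction ρ) (Burnside.dcpModel ρ) - s₀.cls ∈
        Burnside.burnRcH1 k (G ⧸ Burnside.scalarSubgroup ρ) n := by
  have : Infinite k := Infinite.of_injective _ Nat.cast_injective
  rw [Burnside.dcpModel_eq]
  exact (Burnside.isQuotientAction_linModel ρ hρ).main_properties
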